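/- All digraphs are finite, without loops and without parallel arcs (two opposite arcs are allowed). Write $u\to v$ if $uv$ is an arc. For a fixed digraph $H$, the problem $\mathrm{MinHOM}(H)$ is: given a digraph $G$ and costs $c_i(u)\in\mathbb{Q}$ (of any sign, written in binary) for $u\in V(G)$, $i\in V(H)$, decide whether there is a homomorphism of $G$ to $H$ (a map $f:V(G)\to V(H)$ with $f(u)\to f(v)$ in $H$ whenever $u\to v$ in $G$) and, if there is one, find one that minimizes $\sum_{u\in V(G)}c_{f(u)}(u)$. **Theorem.** Let $H$ be a connected quasi-transitive digraph, i.e. the underlying undirected graph of $H$ is connected, and whenever $x,y,z$ are distinct vertices with $x\to y$ and $y\to z$, then $x\to z$ or $z\to x$. Then $\mathrm{MinHOM}(H)$ is solvable in time polynomial in the bit length of the input $(G,c)$ if one of the following holds: * $H$ is (isomorphic to) the directed cycle $\overrightarrow{C_2}$, or $H$ is an extension of the directed cycle $\overrightarrow{C_3}$; that is, $V(H)$ is partitioned into three nonempty sets $S_1,S_2,S_3$ such that the arcs of $H$ are exactly the pairs in $(S_1\times S_2)\cup(S_2\times S_3)\cup(S_3\times S_1)$; * $H$ is acyclic (has no directed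 cycle), $B(H)$ is a proper interval bigraph, and $H$ contains none of the digraphs $O_1,O_2,O_3,O_4$ as an induced subdigraph. Here $B(H)$ is the bipartite graph with a white vertex $v'$ and a black vertex $v''$ for each $v\in V(H)$, and with an edge $v'w''$ for each arc $vw$ of $H$. A bipartite graph with a fixed bipartition into white and black vertices is a *proper interval bigraph* if there are two families of nonempty closed bounded real intervals, $I_v$ for the white vertices $v$ and $J_w$ for the black vertices $w$, such that neither family has a member properly contained in another member of the same family, and such that, for white $v$ and black $w$, $vw$ is an edge if and only if $I_v\cap J_w\neq\emptyset$. The digraphs $O_1,\dots,O_4$ are the four digraphs on the vertex set $\{1,\dots,6\}$ whose arc set is $\{13,14,15,16,24,25,26,36,45,46\}\cup S$ with $S\subseteq\{12,56\}$. -/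

import Mathlib

/-! ### A machine model with a step count

A random-access machine under the logarithmic cost criterion. Its store consists of integer cells
(arbitrarily large integers); a program addresses finitely many arrays, each indexed by the
integers, and indices may be computed (indirect addressing). Programs are built from assignments by
sequencing, branching and loops. Every operation is charged the bit lengths of the integers that
it handles, so that a time bound in this model agrees, up to a polynomial, with a time bound on a
multitape Turing machine. -/

namespace RAM

/-- The store: `σ a i` is the content of cell `i` of array `a`. -/
abbrev Store : Type := ℕ → ℤ → ℤ

/-- The number of bits charged for an integer (binary length of `|z|` and a sign bit). -/
def bitLen (z : ℤ) : ℕ := z.natAbs.size + 1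

/-- Arithmetic expressions; `read a i` is the content of the cell of array `a` with index `i`. -/
inductive Exp : Type
  | lit (z : ℤ)
  | read (a : ℕ) (i : Exp)
  | add (e f : Exp)
  | sub (e f : Exp)
  | mul (e f : Exp)
  | div (e f : Exp)

/-- The value of an expression in a store (`div` is Euclidean division, with `x / 0 = 0`). -/
def Exp.val (σ : Store) : Exp → ℤ
  | .lit z => z
  | .read a i => σ a (i.val σ)
  | .add e f => e.val σ + f.val σ
  | .sub e f => e.val σ - f.val σ
  | .mul e f => e.val σ * f.val σ
  | .div e f => e.val σ / f.val σ

/-- The logarithmic cost of evaluating an expression: the total bit length of the values of all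
its subexpressions (in particular of the operands, addresses and results). -/
def Exp.cost (σ : Store) : Exp → ℕ
  | .lit z => bitLen z
  | .read a i => i.cost σ + bitLen (σ a (i.val σ))
  | .add e f => e.cost σ + f.cost σ + bitLen (e.val σ + f.val σ)
  | .sub e f => e.cost σ + f.cost σ + bitLen (e.val σ - f.val σ)
  | .mul e f => e.cost σ + f.cost σ + bitLen (e.val σ * f.val σ)
  | .div e f => e.cost σ + f.cost σ + bitLen (e.val σ / f.val σ)

/-- Programs. `assign a i e` stores the value of `e` in cell `i` of array `a`; branching and loops
test whether the value of an expression is positive. -/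
inductive Prog : Type
  | skip
  | assign (a : ℕ) (i e : Exp)
  | seq (P Q : Prog)
  | ite (e : Exp) (P Q : Prog)
  | loop (e : Exp) (P : Prog)

/-- `Exec P σ t τ`: started in the store `σ`, the program `P` halts in the store `τ` after a
running time (total logarithmic cost) of exactly `t`. -/
inductive Exec : Prog → Store → ℕ → Store → Prop
  | skip (σ : Store) : Exec .skip σ 1 σ
  | assign (σ : Store) (a : ℕ) (i e : Exp) :
      Exec (.assign a i e) σ (i.cost σ + e.cost σ + 1)
        (Function.update σ a (Function.update (σ a) (i.val σ) (e.val σ)))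
  | seq {P Q : Prog} {σ τ ρ : Store} {s t : ℕ} (hP : Exec P σ s τ) (hQ : Exec Q τ t ρ) :
      Exec (.seq P Q) σ (s + t) ρ
  | ite_pos {e : Exp} {P Q : Prog} {σ τ : Store} {t : ℕ} (he : 0 < e.val σ)
      (hP : Exec P σ t τ) : Exec (.ite e P Q) σ (e.cost σ + t + 1) τ
  | ite_neg {e : Exp} {P Q : Prog} {σ τ : Store} {t : ℕ} (he : ¬ 0 < e.val σ)
      (hQ : Exec Q σ t τ) : Exec (.ite e P Q) σ (e.cost σ + t + 1) τ
  | loop_step {e : Exp} {P : Prog} {σ τ ρ : Store} {s t : ℕ} (he : 0 < e.val σ)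
      (hP : Exec P σ s τ) (hrec : Exec (.loop e P) τ t ρ) :
      Exec (.loop e P) σ (e.cost σ + s + t + 1) ρ
  | loop_stop {e : Exp} {P : Prog} {σ : Store} (he : ¬ 0 < e.val σ) :
      Exec (.loop e P) σ (e.cost σ + 1) σ

/-- The initial store on input `xs`: array `0` holds the length of `xs` followed by the entries of
`xs`, and every other cell holds `0`. -/
def initStore (xs : List ℤ) : Store := fun a i =>
  if a = 0 ∧ 0 ≤ i then ((xs.length : ℤ) :: xs).getD i.toNat 0 else 0

/-- The store `σ` presents the output `ys`: array `1` holds the length of `ys` followed by the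
entries of `ys`. -/
def HasOutput (σ : Store) (ys : List ℤ) : Prop :=
  σ 1 0 = (ys.length : ℤ) ∧ ∀ k : Fin ys.length, σ 1 ((k : ℤ) + 1) = ys.get k

/-- The size of an input: its total length in bits. -/
def inputSize (xs : List ℤ) : ℕ := (xs.map bitLen).sum

/-- A computational problem, given by its instances, their encodings as lists of integers and the
correct answers to each instance, is solvable in polynomial time if some program halts on every
instance with a correct answer, within a time that is polynomial in the size of the encoding. -/
def PolyTimeSolvable {I : Type*} (encode : I → List ℤ) (correct : I → List ℤ → Prop) : Prop :=
  ∃ (P : Prog) (p : Polynomial ℕ), ∀ x : I, ∃ (t : ℕ) (σ : Store) (ys : List ℤ),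
    Exec P (initStore (encode x)) t σ ∧ t ≤ p.eval (inputSize (encode x)) ∧
      HasOutput σ ys ∧ correct x ys

end RAM

/-! ### Minimum cost homomorphisms -/

namespace MinHOM

/-- A digraph without loops. (Parallel arcs are excluded by `Digraph` itself.) -/
def Loopless {V : Type*} (D : Digraph V) : Prop := ∀ v, ¬ D.Adj v v

/-- `f` is a homomorphism of `G` to `H`. -/
def IsHom {U V : Type*} (G : Digraph U) (H : Digraph V) (f : U → V) : Prop :=
  ∀ u v, G.Adj u v → H.Adj (f u) (f v)

/-- An instance of the problem for a digraph with vertex set `V`: a loopless input digraph on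
vertices `0, …, n - 1`, and a (rational, possibly negative) cost `cost u i` of mapping `u` to `i`. -/
structure Instance (V : Type*) where
  n : ℕ
  graph : Digraph (Fin n)
  loopless : Loopless graph
  cost : Fin n → V → ℚ

/-- The cost of a mapping. -/
def Instance.totalCost {V : Type*} (I : Instance V) (f : Fin I.n → V) : ℚ :=
  ∑ u, I.cost u (f u)

/-- `f` is a homomorphism to `H`, and no homomorphism to `H` has a smaller cost. -/
def Instance.IsMinCostHom {V : Type*} (I : Instance V) (H : Digraph V) (f : Fin I.n → V) : Prop :=
  IsHom I.graph H f ∧ ∀ g, IsHom I.graph H g → I.totalCost f ≤ I.totalCost g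

open Classical in
/-- The encoding of an instance, for a fixed numbering `e` of the vertices of `H`: the number of
vertices, the `0`-`1` adjacency matrix row by row, the numerators of the costs, and the
denominators of the costs (both vertex by vertex). -/
noncomputable def Instance.encode {V : Type*} {m : ℕ} (e : V ≃ Fin m) (I : Instance V) : List ℤ :=
  (I.n : ℤ) ::
    (List.ofFn (fun k : Fin (I.n * I.n) => if I.graph.Adj k.divNat k.modNat then (1 : ℤ) else 0) ++
      List.ofFn (fun k : Fin (I.n * m) => (I.cost k.divNat (e.symm k.modNat)).num) ++
      List.ofFn (fun k : Fin (I.n * m) => ((I.cost k.divNat (e.symm k.modNat)).den : ℤ)))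

/-- The correct answers: `[0]` if there is no homomorphism to `H`; otherwise `1` followed by the
(numbers of the) images of the vertices `0, …, n - 1` under a homomorphism of minimum cost. -/
def Instance.Correct {V : Type*} {m : ℕ} (H : Digraph V) (e : V ≃ Fin m) (I : Instance V)
    (ys : List ℤ) : Prop :=
  (ys = [0] ∧ ¬ ∃ f, IsHom I.graph H f) ∨
    ∃ f, I.IsMinCostHom H f ∧ ys = 1 :: List.ofFn (fun u => ((e (f u)).val : ℤ))

/-- The minimum cost homomorphism problem for the fixed digraph `H` is solvable in polynomial time
(whichever way the vertices of `H` are numbered). -/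
def PolyTime {V : Type*} (H : Digraph V) : Prop :=
  ∀ (m : ℕ) (e : V ≃ Fin m),
    RAM.PolyTimeSolvable (Instance.encode e) (Instance.Correct H e)

/-! ### Digraphs -/

/-- The underlying undirected graph is connected. -/
def Connected {V : Type*} (D : Digraph V) : Prop := D.toSimpleGraphInclusive.Connected

def QuasiTransitive {V : Type*} (D : Digraph V) : Prop :=
  ∀ x y z, x ≠ y → y ≠ z → x ≠ z → D.Adj x y → D.Adj y z → D.Adj x z ∨ D.Adj z x

/-- No directed closed walk of positive length, equivalently no directed cycle (a loop and a pair
of opposite arcs being directed cycles). -/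
def Acyclic {V : Type*} (D : Digraph V) : Prop := ∀ v, ¬ Relation.TransGen D.Adj v v

/-- The directed cycle on `k` vertices (for `k ≥ 2`). -/
def dirCycle (k : ℕ) : Digraph (ZMod k) where
  Adj i j := j = i + 1

def Isomorphic {V W : Type*} (D : Digraph V) (E : Digraph W) : Prop :=
  Nonempty (D.Adj ≃r E.Adj)

/-- `E` is isomorphic to an induced subdigraph of `D`. -/
def ContainsInduced {V W : Type*} (D : Digraph V) (E : Digraph W) : Prop :=
  Nonempty (E.Adj ↪r D.Adj)

/-- `H` is an extension of `D`: each vertex `x` of `D` is replaced by a nonempty independent set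
`S_x` (the fibre of `φ` over `x`; independent because `D` has no loops), with all arcs from `S_x`
to `S_y` if `xy` is an arc of `D`, and no further arcs. -/
def IsExtension {V W : Type*} (H : Digraph V) (D : Digraph W) : Prop :=
  ∃ φ : V → W, Function.Surjective φ ∧ ∀ u v, H.Adj u v ↔ D.Adj (φ u) (φ v)

/-- The bipartite graph `B(D)`: white vertices `v' = inl v`, black vertices `v'' = inr v`, and an
edge `v' w''` for each arc `vw` of `D`. -/
def bip {V : Type*} (D : Digraph V) : SimpleGraph (V ⊕ V) where
  Adj
    | .inl v, .inr w => D.Adj v w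
    | .inr w, .inl v => D.Adj v w
    | _, _ => False
  symm := ⟨by rintro (a | a) (b | b) h <;> exact h⟩
  loopless := ⟨by rintro (a | a) h <;> exact h⟩

/-- A family of sets is inclusion-free if no member is properly contained in another one. -/
def InclusionFree {X : Type*} (I : X → NonemptyInterval ℝ) : Prop :=
  ∀ v w, ¬ ((I v : Set ℝ) ⊂ (I w : Set ℝ))

/-- A bipartite graph with white vertices `X` and black vertices `Y` is a proper interval
bigraph. -/
def IsProperIntervalBigraph {X Y : Type*} (G : SimpleGraph (X ⊕ Y)) : Prop :=
  G ≤ completeBipartiteGraph X Y ∧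
    ∃ (I : X → NonemptyInterval ℝ) (J : Y → NonemptyInterval ℝ),
      InclusionFree I ∧ InclusionFree J ∧
        ∀ v w, G.Adj (.inl v) (.inr w) ↔ ((I v : Set ℝ) ∩ (J w : Set ℝ)).Nonempty

/-- The four obstructions. With vertices numbered `1, …, 6` (here `0, …, 5`), the arcs are
`13, 14, 15, 16, 24, 25, 26, 36, 45, 46`, together with `12` if `a` and with `56` if `b`. -/
def obstruction (a b : Bool) : Digraph (Fin 6) where
  Adj i j :=
    (i, j) ∈ ({(0, 2), (0, 3), (0, 4), (0, 5), (1, 3), (1, 4), (1, 5), (2, 5), (3, 4), (3, 5)} :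
      Set (Fin 6 × Fin 6)) ∨
    (a = true ∧ (i, j) = (0, 1)) ∨ (b = true ∧ (i, j) = (4, 5))

end MinHOM

/-! The three alternatives lead to two algorithms.

If `H` is a directed 2-cycle or an extension of a directed 3-cycle, there is a surjection `φ : V →
ZMod k` such that `uv` is an arc exactly when `φ v = φ u + 1`. A homomorphism is then a potential on
`G` that increases by one along every arc, together with a free choice of an image inside the
prescribed part. The potential is determined on each component of `G` by its value at one
representative. It therefore suffices to compute components and offsets, the cheapest image of every
vertex in every part, and the cheapest of the `k` shifts of every component (`Components`,
`correct_of_shifts`, `polyTime_of_cyclic`).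

If `H` is acyclic, quasi-transitivity makes it transitive. The interval representation of `B(H)`
orders the vertices with out-neighbours by their white intervals and those with in-neighbours by
their black intervals. On a vertex set where both orders apply, a conflict would make the
neighbourhoods of one vertex strictly larger on both sides than those of the other, which produces
one of the obstructions, or else is impossible outright (`IntervalRep.not_crossing`). So both orders
extend to one linear order (`IntervalRep.wellFounded_below`), and it is a min-max ordering
(`exists_isMinMax`).

Given a min-max ordering, the problem is a minimum cut problem. A node `(u, i)` expresses that the
image of `u` has number at least `i`. The arc relation of `H`, being closed under minima and maxima,
is described by implications between such thresholds (`Data.mem_of_thresholds`). These become arcs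
of prohibitive capacity `M`, and the costs, made nonnegative by adding `L`, are the capacities along
the chain of each vertex. Cuts below `M` correspond to homomorphisms (`Data.isHom_level`,
`Data.cutCap_cutOf_le`). The cut is found by push-relabel: the labels leave a gap, and no residual
arc crosses a gap downwards (`Preflow.excess_eq_cutCap`).

Polynomial time in the machine model follows from a calculus of preconditions for structured
programs: if the loops have polynomially many rounds and all stored values have polynomially many
bits, then so bounded is the total logarithmic cost (`Cmd.exec_of_wp`, `polyTimeSolvable_of_wp`). -/

namespace RAM

/-! ### A structured language with bounded loops -/

/-- Write `z` into cell `i` of array `a`. -/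
def Store.set (σ : Store) (a : ℕ) (i z : ℤ) : Store :=
  Function.update σ a (Function.update (σ a) i z)

@[simp] lemma Store.set_apply_of_ne (σ : Store) {a b : ℕ} (h : b ≠ a) (i z : ℤ) :
    σ.set a i z b = σ b := by
  simp [Store.set, h]

lemma Store.set_apply (σ : Store) (a : ℕ) (i z j : ℤ) :
    σ.set a i z a j = if j = i then z else σ a j := by
  simp [Store.set, Function.update_apply]

lemma Store.set_read (σ : Store) (a b : ℕ) (i z j : ℤ) :
    σ.set a i z b j = if b = a ∧ j = i then z else σ b j := by
  by_cases h : b = a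
  · subst h; simp [Store.set_apply]
  · simp [h]

/-- Commands; `rep a e P` runs `P` for the values `0, 1, …, e - 1` of the loop counter, which is
kept in cell `0` of array `a` (the bound is kept in cell `1`). -/
inductive Cmd : Type
  | skip
  | asg (a : ℕ) (i e : Exp)
  | seq (P Q : Cmd)
  | ite (e : Exp) (P Q : Cmd)
  | rep (a : ℕ) (e : Exp) (P : Cmd)

namespace Cmd

/-- The body of the compiled loop. -/
def loopProg (a : ℕ) (P : Prog) : Prog :=
  .loop (.sub (.read a (.lit 1)) (.read a (.lit 0)))
    (.seq P (.assign a (.lit 0) (.add (.read a (.lit 0)) (.lit 1))))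

def toProg : Cmd → Prog
  | skip => .skip
  | asg a i e => .assign a i e
  | seq P Q => .seq P.toProg Q.toProg
  | ite e P Q => .ite e P.toProg Q.toProg
  | rep a e P => .seq (.assign a (.lit 1) e) (.seq (.assign a (.lit 0) (.lit 0))
      (loopProg a P.toProg))

/-- `P` contains no assignment to array `b`. -/
def keeps (b : ℕ) : Cmd → Bool
  | skip => true
  | asg a _ _ => a != b
  | seq P Q => P.keeps b && Q.keeps b
  | ite _ P Q => P.keeps b && Q.keeps b
  | rep a _ P => a != b && P.keeps b

/-- No loop body writes to the loop counter. -/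
def wf : Cmd → Bool
  | skip => true
  | asg _ _ _ => true
  | seq P Q => P.wf && Q.wf
  | ite _ P Q => P.wf && Q.wf
  | rep a _ P => P.keeps a && P.wf

/-- The precondition of `r` further rounds of a loop whose counter has the value `k`. -/
def iterWp (a : ℕ) (W : (Store → Prop) → Store → Prop) (Q : Store → Prop) :
    ℕ → ℤ → Store → Prop
  | 0, _, σ => Q σ
  | r + 1, k, σ => W (fun τ => iterWp a W Q r (k + 1) (τ.set a 0 (k + 1))) σ

/-- Started in `σ`, the command halts in a store with property `Q`, all stored values being
bounded by `Z` and all loops having at most `Λ` rounds. -/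
def wp (Λ Z : ℤ) : Cmd → (Store → Prop) → Store → Prop
  | skip, Q, σ => Q σ
  | asg a i e, Q, σ => |e.val σ| ≤ Z ∧ Q (σ.set a (i.val σ) (e.val σ))
  | seq P R, Q, σ => wp Λ Z P (wp Λ Z R Q) σ
  | ite e P R, Q, σ => (0 < e.val σ → wp Λ Z P Q σ) ∧ (¬ 0 < e.val σ → wp Λ Z R Q σ)
  | rep a e P, Q, σ => 0 ≤ e.val σ ∧ e.val σ ≤ Λ ∧
      iterWp a (wp Λ Z P) Q (e.val σ).toNat 0 ((σ.set a 1 (e.val σ)).set a 0 0)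

variable {Λ Z : ℤ}

lemma wp_mono {P : Cmd} : ∀ {Q Q' : Store → Prop} {σ : Store}, wp Λ Z P Q σ →
    (∀ τ, Q τ → Q' τ) → wp Λ Z P Q' σ := by
  induction P with
  | skip => intro Q Q' σ h hQ; exact hQ _ h
  | asg a i e => intro Q Q' σ h hQ; exact ⟨h.1, hQ _ h.2⟩
  | seq P R ihP ihR => intro Q Q' σ h hQ; exact ihP h (fun τ hτ => ihR hτ hQ)
  | ite e P R ihP ihR =>
    intro Q Q' σ h hQ
    exact ⟨fun he => ihP (h.1 he) hQ, fun he => ihR (h.2 he) hQ⟩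
  | rep a e P ih =>
    intro Q Q' σ h hQ
    refine ⟨h.1, h.2.1, ?_⟩
    have key : ∀ r k σ, iterWp a (wp Λ Z P) Q r k σ → iterWp a (wp Λ Z P) Q' r k σ := by
      intro r
      induction r with
      | zero => intro k σ h; exact hQ _ h
      | succ r ihr => intro k σ h; exact ih h (fun τ hτ => ihr _ _ hτ)
    exact key _ _ _ h.2.2

/-- The arrays that a program can change are visible in its text. This keeps loop counters intact
during a round and lets invariants mention only the arrays that vary. -/
lemma wp_frame {P : Cmd} : ∀ {Q : Store → Prop} {σ : Store}, wp Λ Z P Q σ →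
    wp Λ Z P (fun τ => Q τ ∧ ∀ b, P.keeps b → τ b = σ b) σ := by
  induction P with
  | skip => intro Q σ h; exact ⟨h, fun _ _ => rfl⟩
  | asg a i e =>
    intro Q σ h
    refine ⟨h.1, h.2, fun b hb => ?_⟩
    have : a ≠ b := by simpa [keeps] using hb
    simp [this.symm]
  | seq P R ihP ihR =>
    intro Q σ h
    refine wp_mono (P := P) (ihP h) ?_
    rintro τ ⟨hτ, hf⟩
    refine wp_mono (ihR hτ) ?_
    rintro ρ ⟨hρ, hg⟩
    refine ⟨hρ, fun b hb => ?_⟩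
    simp only [keeps, Bool.and_eq_true] at hb
    rw [hg b hb.2, hf b hb.1]
  | ite e P R ihP ihR =>
    intro Q σ h
    refine ⟨fun he => wp_mono (ihP (h.1 he)) ?_, fun he => wp_mono (ihR (h.2 he)) ?_⟩ <;>
    · rintro τ ⟨hτ, hf⟩
      refine ⟨hτ, fun b hb => ?_⟩
      simp only [keeps, Bool.and_eq_true] at hb
      first | exact hf b hb.1 | exact hf b hb.2
  | rep a e P ih =>
    intro Q σ h
    refine ⟨h.1, h.2.1, ?_⟩
    have key : ∀ r k τ, (∀ b, (rep a e P).keeps b → τ b = σ b) → iterWp a (wp Λ Z P) Q r k τ →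
        iterWp a (wp Λ Z P) (fun τ => Q τ ∧ ∀ b, (rep a e P).keeps b → τ b = σ b) r k τ := by
      intro r
      induction r with
      | zero => intro k τ hτ h; exact ⟨h, hτ⟩
      | succ r ihr =>
        intro k τ hτ h
        refine wp_mono (ih h) ?_
        rintro ρ ⟨hρ, hf⟩
        refine ihr _ _ (fun b hb => ?_) hρ
        have hb' := hb
        simp only [keeps, Bool.and_eq_true, bne_iff_ne] at hb'
        rw [Store.set_apply_of_ne _ hb'.1.symm, hf b hb'.2, hτ b hb]
    refine key _ _ _ (fun b hb => ?_) h.2.2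
    simp only [keeps, Bool.and_eq_true, bne_iff_ne] at hb
    simp [hb.1.symm]

/-- The loop rule. -/
lemma wp_rep {a : ℕ} {e : Exp} {P : Cmd} {Q : Store → Prop} {σ : Store} (n : ℕ)
    (he : e.val σ = n) (hn : (n : ℤ) ≤ Λ) (Inv : ℕ → Store → Prop)
    (h0 : Inv 0 ((σ.set a 1 n).set a 0 0))
    (hstep : ∀ (k : ℕ) (τ : Store), k < n → τ a 0 = (k : ℤ) →
      (∀ b, (rep a e P).keeps b → τ b = σ b) → Inv k τ →
      wp Λ Z P (fun ρ => Inv (k + 1) (ρ.set a 0 ((k : ℤ) + 1))) τ)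
    (hQ : ∀ τ, (∀ b, (rep a e P).keeps b → τ b = σ b) → Inv n τ → Q τ) :
    wp Λ Z (rep a e P) Q σ := by
  refine ⟨by omega, by omega, ?_⟩
  rw [he, Int.toNat_natCast]
  have key : ∀ (r k : ℕ) (τ : Store), k + r = n → τ a 0 = (k : ℤ) →
      (∀ b, (rep a e P).keeps b → τ b = σ b) →
      Inv k τ → iterWp a (wp Λ Z P) Q r k τ := by
    intro r
    induction r with
    | zero => intro k τ hk _ hf hI; exact hQ _ hf (by simpa [← hk] using hI)
    | succ r ihr =>
      intro k τ hk hc hf hI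
      refine wp_mono (wp_frame (hstep k τ (by omega) hc hf hI)) ?_
      rintro ρ ⟨hρ, hg⟩
      have := ihr (k + 1) (ρ.set a 0 ((k : ℤ) + 1)) (by omega) (by simp [Store.set_apply])
        (fun b hb => ?_) hρ
      · simpa using this
      · have hb' := hb
        simp only [keeps, Bool.and_eq_true, bne_iff_ne] at hb'
        rw [Store.set_apply_of_ne _ hb'.1.symm, hg b hb'.2, hf b hb]
  have := key n 0 ((σ.set a 1 n).set a 0 0) (by omega) (by simp [Store.set_apply])
    (fun b hb => ?_) h0
  · simpa using this
  · simp only [keeps, Bool.and_eq_true, bne_iff_ne] at hb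
    simp [hb.1.symm]

end Cmd

/-! ### Running times -/

lemma bitLen_pos (z : ℤ) : 1 ≤ bitLen z := by simp [bitLen]

lemma bitLen_le_of_abs_le {x y : ℤ} (h : |x| ≤ |y|) : bitLen x ≤ bitLen y := by
  unfold bitLen
  have : x.natAbs ≤ y.natAbs := by rw [Int.abs_eq_natAbs, Int.abs_eq_natAbs] at h; omega
  exact Nat.succ_le_succ (Nat.size_le_size this)

lemma bitLen_add_le (x y : ℤ) : bitLen (x + y) ≤ bitLen x + bitLen y := by
  unfold bitLen
  have h : (x + y).natAbs.size ≤ max x.natAbs.size y.natAbs.size + 1 := by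
    rw [Nat.size_le]
    have hx : x.natAbs < 2 ^ max x.natAbs.size y.natAbs.size :=
      (Nat.lt_size_self _).trans_le (Nat.pow_le_pow_right (by norm_num) (le_max_left _ _))
    have hy : y.natAbs < 2 ^ max x.natAbs.size y.natAbs.size :=
      (Nat.lt_size_self _).trans_le (Nat.pow_le_pow_right (by norm_num) (le_max_right _ _))
    rw [pow_succ]
    have := Int.natAbs_add_le x y
    omega
  omega

lemma bitLen_neg (x : ℤ) : bitLen (-x) = bitLen x := by simp [bitLen]

lemma bitLen_sub_le (x y : ℤ) : bitLen (x - y) ≤ bitLen x + bitLen y := by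
  rw [sub_eq_add_neg, ← bitLen_neg y]; exact bitLen_add_le _ _

lemma bitLen_mul_le (x y : ℤ) : bitLen (x * y) ≤ bitLen x + bitLen y := by
  unfold bitLen
  have h : (x * y).natAbs.size ≤ x.natAbs.size + y.natAbs.size := by
    rw [Nat.size_le, pow_add, Int.natAbs_mul]
    exact Nat.mul_lt_mul'' (Nat.lt_size_self _) (Nat.lt_size_self _)
  omega

lemma bitLen_div_le (x y : ℤ) : bitLen (x / y) ≤ bitLen x + bitLen y :=
  (bitLen_le_of_abs_le (Int.abs_ediv_le_abs x y)).trans (Nat.le_add_right _ _)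

/-- Factor bounding the bit length of the value of an expression. -/
def Exp.width : Exp → ℕ
  | .lit z => bitLen z
  | .read _ _ => 1
  | .add e f => e.width + f.width
  | .sub e f => e.width + f.width
  | .mul e f => e.width + f.width
  | .div e f => e.width + f.width

/-- Factor bounding the cost of an expression. -/
def Exp.weight : Exp → ℕ
  | .lit z => bitLen z
  | .read _ i => i.weight + 1
  | .add e f => e.weight + f.weight + (e.width + f.width)
  | .sub e f => e.weight + f.weight + (e.width + f.width)
  | .mul e f => e.weight + f.weight + (e.width + f.width)
  | .div e f => e.weight + f.weight + (e.width + f.width)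

lemma Exp.bitLen_val_le {σ : Store} {B : ℕ} (hB : 1 ≤ B) (hσ : ∀ a i, bitLen (σ a i) ≤ B) :
    ∀ e : Exp, bitLen (e.val σ) ≤ e.width * B
  | .lit z => Nat.le_mul_of_pos_right _ hB
  | .read a i => by simpa [Exp.val, Exp.width] using hσ a (i.val σ)
  | .add e f => by
    rw [Exp.width, add_mul]
    exact (bitLen_add_le _ _).trans
      (add_le_add (Exp.bitLen_val_le hB hσ e) (Exp.bitLen_val_le hB hσ f))
  | .sub e f => by
    rw [Exp.width, add_mul]
    exact (bitLen_sub_le _ _).trans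
      (add_le_add (Exp.bitLen_val_le hB hσ e) (Exp.bitLen_val_le hB hσ f))
  | .mul e f => by
    rw [Exp.width, add_mul]
    exact (bitLen_mul_le _ _).trans
      (add_le_add (Exp.bitLen_val_le hB hσ e) (Exp.bitLen_val_le hB hσ f))
  | .div e f => by
    rw [Exp.width, add_mul]
    exact (bitLen_div_le _ _).trans
      (add_le_add (Exp.bitLen_val_le hB hσ e) (Exp.bitLen_val_le hB hσ f))

lemma Exp.cost_le {σ : Store} {B : ℕ} (hB : 1 ≤ B) (hσ : ∀ a i, bitLen (σ a i) ≤ B) :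
    ∀ e : Exp, e.cost σ ≤ e.weight * B
  | .lit z => Nat.le_mul_of_pos_right _ hB
  | .read a i => by
    rw [Exp.cost, Exp.weight, add_mul, one_mul]
    exact add_le_add (Exp.cost_le hB hσ i) (hσ _ _)
  | .add e f => by
    rw [Exp.cost, Exp.weight, add_mul, add_mul]
    exact add_le_add (add_le_add (Exp.cost_le hB hσ e) (Exp.cost_le hB hσ f))
      (Exp.bitLen_val_le hB hσ (.add e f))
  | .sub e f => by
    rw [Exp.cost, Exp.weight, add_mul, add_mul]
    exact add_le_add (add_le_add (Exp.cost_le hB hσ e) (Exp.cost_le hB hσ f))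
      (Exp.bitLen_val_le hB hσ (.sub e f))
  | .mul e f => by
    rw [Exp.cost, Exp.weight, add_mul, add_mul]
    exact add_le_add (add_le_add (Exp.cost_le hB hσ e) (Exp.cost_le hB hσ f))
      (Exp.bitLen_val_le hB hσ (.mul e f))
  | .div e f => by
    rw [Exp.cost, Exp.weight, add_mul, add_mul]
    exact add_le_add (add_le_add (Exp.cost_le hB hσ e) (Exp.cost_le hB hσ f))
      (Exp.bitLen_val_le hB hσ (.div e f))

namespace Cmd

/-- Cost of one round of a loop, apart from its body. -/
def roundCost : ℕ :=
  Exp.weight (.sub (.read 0 (.lit 1)) (.read 0 (.lit 0))) +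
    (Exp.weight (.lit 0) + Exp.weight (.add (.read 0 (.lit 0)) (.lit 1)) + 1) + 1

/-- A bound for the running time, as a polynomial in the bound for the loops and up to a factor
for the bit length of the values. -/
noncomputable def time : Cmd → Polynomial ℕ
  | skip => 1
  | asg _ i e => Polynomial.C (i.weight + e.weight + 1)
  | seq P Q => P.time + Q.time
  | ite e P Q => P.time + Q.time + Polynomial.C (e.weight + 1)
  | rep _ e P => Polynomial.C (Exp.weight (.lit 1) + e.weight + 1) +
      (Polynomial.C (Exp.weight (.lit 0) + Exp.weight (.lit 0) + 1) +
        (Polynomial.X + 1) * (P.time + Polynomial.C roundCost))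

/-- All cells hold at most `B` bits throughout, so evaluating an expression costs at most its weight
times `B`, and each loop multiplies the number of steps by at most `Λ + 1`. The assumption `hΛ` is
needed because counters and loop bounds are themselves stored. -/
theorem exec_of_wp {Λ B : ℕ} {Z : ℤ} (hB : 1 ≤ B) (hZB : bitLen Z ≤ B) (hΛ : (Λ : ℤ) ≤ Z) :
    ∀ {P : Cmd}, P.wf → ∀ {Q : Store → Prop} {σ : Store}, (∀ a i, bitLen (σ a i) ≤ B) →
      wp Λ Z P Q σ → ∃ t τ, Exec P.toProg σ t τ ∧ t ≤ (P.time).eval Λ * B ∧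
        (∀ a i, bitLen (τ a i) ≤ B) ∧ Q τ := by
  have hset : ∀ {σ : Store} (a : ℕ) (i z : ℤ), (∀ a i, bitLen (σ a i) ≤ B) → |z| ≤ Z →
      ∀ b j, bitLen (σ.set a i z b j) ≤ B := by
    intro σ a i z hσ hz b j
    rw [Store.set_read]
    split_ifs
    · exact (bitLen_le_of_abs_le (hz.trans (le_abs_self Z))).trans hZB
    · exact hσ _ _
  intro P
  induction P with
  | skip =>
    intro _ Q σ hσ h
    exact ⟨1, σ, .skip σ, by simpa [time] using hB, hσ, h⟩
  | asg a i e =>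
    intro _ Q σ hσ h
    refine ⟨_, _, .assign σ a i e, ?_, hset a _ _ hσ h.1, h.2⟩
    have h1 := Exp.cost_le hB hσ i
    have h2 := Exp.cost_le hB hσ e
    simp only [time, Polynomial.eval_C, add_mul]
    omega
  | seq P R ihP ihR =>
    intro hw Q σ hσ h
    simp only [wf, Bool.and_eq_true] at hw
    obtain ⟨t, τ, hE, ht, hτ, hQ⟩ := ihP hw.1 hσ h
    obtain ⟨t', ρ, hE', ht', hρ, hQ'⟩ := ihR hw.2 hτ hQ
    refine ⟨_, _, .seq hE hE', ?_, hρ, hQ'⟩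
    simp only [time, Polynomial.eval_add, add_mul]
    omega
  | ite e P R ihP ihR =>
    intro hw Q σ hσ h
    simp only [wf, Bool.and_eq_true] at hw
    have h1 := Exp.cost_le hB hσ e
    by_cases he : 0 < e.val σ
    · obtain ⟨t, τ, hE, ht, hτ, hQ⟩ := ihP hw.1 hσ (h.1 he)
      refine ⟨_, _, .ite_pos he hE, ?_, hτ, hQ⟩
      simp only [time, Polynomial.eval_add, Polynomial.eval_C, add_mul]
      omega
    · obtain ⟨t, τ, hE, ht, hτ, hQ⟩ := ihR hw.2 hσ (h.2 he)
      refine ⟨_, _, .ite_neg he hE, ?_, hτ, hQ⟩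
      simp only [time, Polynomial.eval_add, Polynomial.eval_C, add_mul]
      omega
  | rep a e P ih =>
    intro hw Q σ hσ h
    simp only [wf, Bool.and_eq_true] at hw
    obtain ⟨h0, h1, h2⟩ := h
    set n := (e.val σ).toNat with hn
    have hne : e.val σ = n := by omega
    -- With `r` rounds to go the guard is evaluated `r + 1` times, hence the factor `r + 1`.
    have hloop : ∀ (r k : ℕ) (τ : Store), k + r = n → τ a 0 = (k : ℤ) → τ a 1 = (n : ℤ) →
        (∀ b j, bitLen (τ b j) ≤ B) →
        iterWp a (wp Λ Z P) Q r k τ → ∃ t ρ, Exec (loopProg a P.toProg) τ t ρ ∧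
          t ≤ (r + 1) * ((P.time.eval Λ + roundCost) * B) ∧ (∀ b j, bitLen (ρ b j) ≤ B) ∧
          Q ρ := by
      intro r
      induction r with
      | zero =>
        intro k τ hk hc0 hc1 hτ hQ
        have hc := Exp.cost_le hB hτ (.sub (.read a (.lit 1)) (.read a (.lit 0)))
        refine ⟨_, τ, Exec.loop_stop ?_, ?_, hτ, hQ⟩
        · simp only [Exp.val, hc0, hc1]; omega
        · refine (Nat.add_le_add_right hc 1).trans ?_
          have : (Exp.weight (.sub (.read a (.lit 1)) (.read a (.lit 0))) + 1) ≤ roundCost := by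
            simp only [roundCost, Exp.weight, Exp.width]; omega
          have := Nat.mul_le_mul_right B this
          simp only [add_mul] at *
          omega
      | succ r ihr =>
        intro k τ hk hc0 hc1 hτ hQ
        have hc := Exp.cost_le hB hτ (.sub (.read a (.lit 1)) (.read a (.lit 0)))
        -- Well-formedness says that the body keeps array `a`, so both the counter and the stored
        -- bound survive the round.
        obtain ⟨t, ρ, hE, ht, hρ, hQ', hf⟩ := ih hw.2 hτ (wp_frame hQ)
        have hfa := hf a hw.1
        have hval : (Exp.add (.read a (.lit 0)) (.lit 1)).val ρ = (k : ℤ) + 1 := by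
          simp [Exp.val, hfa, hc0]
        obtain ⟨t', π, hE', ht', hπ, hQπ⟩ := ihr (k + 1) (ρ.set a 0 ((k : ℤ) + 1)) (by omega)
          (by simp [Store.set_apply]) (by simp [Store.set_apply, hfa, hc1])
          (hset _ _ _ hρ (by rw [abs_of_nonneg (by omega)]; omega)) (by simpa using hQ')
        have hE2 := Exec.assign ρ a (.lit 0) (.add (.read a (.lit 0)) (.lit 1))
        rw [hval] at hE2
        have hc2 := Exp.cost_le hB hρ (.add (.read a (.lit 0)) (.lit 1))
        have hc3 := Exp.cost_le hB hρ (.lit 0)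
        refine ⟨_, π, .loop_step ?_ (.seq hE hE2) hE', ?_, hπ, hQπ⟩
        · simp only [Exp.val, hc0, hc1]; omega
        · have e1 : Exp.weight (.sub (.read a (.lit 1)) (.read a (.lit 0))) * B +
              (Exp.weight (.lit 0) * B + Exp.weight (.add (.read a (.lit 0)) (.lit 1)) * B + B) +
              B = roundCost * B := by
            simp only [roundCost, Exp.weight, Exp.width]; ring
          have e2 : (r + 1 + 1) * ((P.time.eval Λ + roundCost) * B) =
              (r + 1) * ((P.time.eval Λ + roundCost) * B) + P.time.eval Λ * B + roundCost * B := by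
            ring
          rw [e2]
          omega
    have hσ1 := hset a 1 (e.val σ) hσ (by rw [abs_of_nonneg h0]; omega)
    have hσ2 := hset a 0 0 hσ1 (by rw [abs_zero]; omega)
    obtain ⟨t, ρ, hE, ht, hρ, hQ⟩ := hloop n 0 _ (by omega) (by simp [Store.set_apply])
      (by simp [Store.set_apply, hne]) hσ2 (by simpa using h2)
    refine ⟨_, ρ, .seq (.assign σ a (.lit 1) e) (.seq (.assign _ a (.lit 0) (.lit 0)) hE), ?_,
      hρ, hQ⟩
    have hc1 := Exp.cost_le hB hσ (.lit 1)
    have hc2 := Exp.cost_le hB hσ e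
    have hc3 := Exp.cost_le hB hσ1 (.lit 0)
    have hnΛ : n ≤ Λ := by omega
    have : (n + 1) * ((P.time.eval Λ + roundCost) * B) ≤
        (Λ + 1) * ((P.time.eval Λ + roundCost) * B) := Nat.mul_le_mul_right _ (by omega)
    simp only [time, Polynomial.eval_add, Polynomial.eval_mul, Polynomial.eval_C,
      Polynomial.eval_X, Polynomial.eval_one]
    have e3 : (Exp.weight (.lit 1) + e.weight + 1 + (Exp.weight (.lit 0) + Exp.weight (.lit 0) + 1 +
        (Λ + 1) * (P.time.eval Λ + roundCost))) * B = Exp.weight (.lit 1) * B + e.weight * B + B +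
        (Exp.weight (.lit 0) * B + Exp.weight (.lit 0) * B + B +
          (Λ + 1) * ((P.time.eval Λ + roundCost) * B)) := by ring
    rw [e3]
    change Exp.cost σ (.lit 1) + _ + 1 + (Exp.cost (σ.set a 1 (e.val σ)) (.lit 0) +
      Exp.cost (σ.set a 1 (e.val σ)) (.lit 0) + 1 + t) ≤ _
    omega

end Cmd

/-! ### Bounds in terms of the input size, and the criterion for polynomial time -/

lemma bitLen_le_inputSize {xs : List ℤ} {x : ℤ} (hx : x ∈ xs) : bitLen x ≤ inputSize xs :=
  List.single_le_sum (by simp) _ (List.mem_map_of_mem hx)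

lemma length_le_inputSize (xs : List ℤ) : xs.length ≤ inputSize xs := by
  induction xs with
  | nil => simp
  | cons x xs ih =>
    have := bitLen_pos x
    simp only [inputSize, List.map_cons, List.sum_cons, List.length_cons] at *
    omega

lemma abs_lt_two_pow_bitLen (x : ℤ) : |x| < 2 ^ bitLen x := by
  have h := Nat.lt_size_self x.natAbs
  have h2 : (x.natAbs : ℤ) < 2 ^ x.natAbs.size := by exact_mod_cast h
  rw [Int.abs_eq_natAbs, bitLen, pow_succ]
  omega

lemma bitLen_le_of_abs_le_pow {x : ℤ} {k : ℕ} (h : |x| ≤ 2 ^ k) : bitLen x ≤ k + 2 := by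
  unfold bitLen
  have : x.natAbs.size ≤ k + 1 := by
    rw [Nat.size_le, pow_succ]
    have h3 : (x.natAbs : ℤ) ≤ (2 ^ k : ℕ) := by rw [Int.abs_eq_natAbs] at h; exact_mod_cast h
    have := Nat.two_pow_pos k
    omega
  omega

lemma abs_initStore_le (xs : List ℤ) (a : ℕ) (i : ℤ) :
    |initStore xs a i| ≤ 2 ^ inputSize xs := by
  unfold initStore
  split_ifs with h
  · rw [List.getD_eq_getElem?_getD]
    rcases Nat.lt_or_ge i.toNat (((xs.length : ℤ) :: xs).length) with hi | hi
    · rw [List.getElem?_eq_getElem hi, Option.getD_some]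
      rcases List.mem_cons.1 (List.getElem_mem hi) with h1 | h1
      · rw [h1, abs_of_nonneg (by positivity)]
        have h2 := length_le_inputSize xs
        have h3 := Nat.lt_two_pow_self (n := inputSize xs)
        exact_mod_cast (h2.trans h3.le)
      · refine (abs_lt_two_pow_bitLen _).le.trans ?_
        exact pow_le_pow_right₀ (by norm_num) (bitLen_le_inputSize h1)
    · rw [List.getElem?_eq_none hi]; simp
  · simp

/-- A criterion for polynomial time solvability. -/
theorem polyTimeSolvable_of_wp {I : Type*} {encode : I → List ℤ} {correct : I → List ℤ → Prop}
    (P : Cmd) (hP : P.wf) (pΛ pZ : Polynomial ℕ)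
    (h : ∀ x, ∀ Λ Z : ℤ, ((pΛ.eval (inputSize (encode x)) : ℕ) : ℤ) ≤ Λ →
      2 ^ pZ.eval (inputSize (encode x)) ≤ Z →
      Cmd.wp Λ Z P (fun τ => ∃ ys, HasOutput τ ys ∧ correct x ys) (initStore (encode x))) :
    PolyTimeSolvable encode correct := by
  refine ⟨P.toProg, (P.time.comp pΛ) * (pZ + pΛ + Polynomial.X + 2), fun x => ?_⟩
  set S := inputSize (encode x) with hS
  -- `2 ^ z` has to dominate three things at once: the values that the program stores, the loop
  -- bounds, and the contents of the initial store.
  set z := pZ.eval S + pΛ.eval S + S with hz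
  have hΛZ : ((pΛ.eval S : ℕ) : ℤ) ≤ 2 ^ z := by
    have h3 := (Nat.lt_two_pow_self (n := pΛ.eval S)).le
    have h4 : 2 ^ pΛ.eval S ≤ 2 ^ z := Nat.pow_le_pow_right (by norm_num) (by omega)
    exact_mod_cast h3.trans h4
  have hw := h x ((pΛ.eval S : ℕ) : ℤ) (2 ^ z) le_rfl
    (pow_le_pow_right₀ (by norm_num) (by rw [← hS]; omega))
  obtain ⟨t, τ, hE, ht, -, ys, hO, hc⟩ := Cmd.exec_of_wp (B := z + 2) (by omega)
    (bitLen_le_of_abs_le_pow (by rw [abs_of_nonneg (by positivity)])) hΛZ hP (fun a i =>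
      bitLen_le_of_abs_le_pow ((abs_initStore_le _ a i).trans
        (pow_le_pow_right₀ (by norm_num) (by rw [← hS]; omega)))) hw
  refine ⟨t, τ, ys, hE, ht.trans (le_of_eq ?_), hO, hc⟩
  simp [hz, Polynomial.eval_comp]

end RAM

namespace MinHOM

/-! ### Min-max orderings -/

/-- A numbering of the vertices such that with any two arcs `xy`, `x'y'` the pairs
`min(x,x')min(y,y')` and `max(x,x')max(y,y')` are arcs. -/
def IsMinMax {V : Type*} {m : ℕ} (H : Digraph V) (ρ : V ≃ Fin m) : Prop :=
  ∀ x y x' y', H.Adj x y → H.Adj x' y' → ρ x < ρ x' → ρ y' < ρ y → H.Adj x y' ∧ H.Adj x' y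

/-- An interval representation of `B(H)` with white intervals `[a v, b v]` and black intervals
`[c v, d v]`, in which the endpoints of the intervals are ordered in the same way, and vertices with
the same neighbourhood have the same interval. -/
structure IntervalRep {V : Type*} (H : Digraph V) where
  a : V → ℝ
  b : V → ℝ
  c : V → ℝ
  d : V → ℝ
  hab : ∀ v, a v ≤ b v
  hcd : ∀ v, c v ≤ d v
  mono_white : ∀ u v, a u < a v ↔ b u < b v
  mono_black : ∀ u v, c u < c v ↔ d u < d v
  adj : ∀ u v, H.Adj u v ↔ a u ≤ d v ∧ c v ≤ b u
  twin_white : ∀ u v, (∀ w, H.Adj u w ↔ H.Adj v w) → a u = a v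
  twin_black : ∀ u v, (∀ w, H.Adj w u ↔ H.Adj w v) → c u = c v

/-- If one pair of endpoints were ordered strictly and the other not in the same way, one interval
would contain the other properly. -/
lemma lt_iff_of_inclusionFree {X : Type*} {I : X → NonemptyInterval ℝ} (hI : InclusionFree I)
    (u v : X) : (I u).fst < (I v).fst ↔ (I u).snd < (I v).snd := by
  have key : ∀ u v, (I u).fst < (I v).fst → (I u).snd < (I v).snd := by
    intro u v h
    by_contra h'
    refine hI v u ⟨?_, fun hs => ?_⟩
    · intro x hx
      simp only [SetLike.mem_coe, NonemptyInterval.mem_def] at hx ⊢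
      exact ⟨h.le.trans hx.1, hx.2.trans (not_lt.1 h')⟩
    · have : (I u).fst ∈ (I v : Set ℝ) := hs (by simp [NonemptyInterval.mem_def, (I u).2])
      simp only [SetLike.mem_coe, NonemptyInterval.mem_def] at this
      linarith [this.1]
  refine ⟨key u v, fun h => ?_⟩
  by_contra h'
  rcases (not_lt.1 h').lt_or_eq with h1 | h1
  · linarith [key v u h1]
  · refine hI u v ⟨?_, fun hs => ?_⟩
    · intro x hx
      simp only [SetLike.mem_coe, NonemptyInterval.mem_def] at hx ⊢
      exact ⟨h1 ▸ hx.1, hx.2.trans h.le⟩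
    · have : (I v).snd ∈ (I u : Set ℝ) := hs (by simp [NonemptyInterval.mem_def, (I v).2])
      simp only [SetLike.mem_coe, NonemptyInterval.mem_def] at this
      linarith [this.2]

lemma inter_nonempty_iff (I J : NonemptyInterval ℝ) :
    ((I : Set ℝ) ∩ (J : Set ℝ)).Nonempty ↔ I.fst ≤ J.snd ∧ J.fst ≤ I.snd := by
  constructor
  · rintro ⟨x, hx, hy⟩
    simp only [SetLike.mem_coe, NonemptyInterval.mem_def] at hx hy
    exact ⟨hx.1.trans hy.2, hy.1.trans hx.2⟩
  · rintro ⟨h1, h2⟩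
    refine ⟨max I.fst J.fst, ?_, ?_⟩ <;>
    simp only [SetLike.mem_coe, NonemptyInterval.mem_def]
    · exact ⟨le_max_left _ _, max_le I.2 h2⟩
    · exact ⟨le_max_right _ _, max_le h1 J.2⟩

/-- Every vertex takes over the white interval of a chosen representative of its white twin class,
and likewise for black, which does not affect adjacency. After this, a strict inequality between
endpoints guarantees that the neighbourhoods differ. -/
lemma exists_intervalRep {V : Type*} {H : Digraph V} (h : IsProperIntervalBigraph (bip H)) :
    Nonempty (IntervalRep H) := by
  obtain ⟨-, I, J, hI, hJ, hadj⟩ := h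
  have hadj' : ∀ v w, H.Adj v w ↔ (I v).fst ≤ (J w).snd ∧ (J w).fst ≤ (I v).snd := fun v w => by
    rw [← inter_nonempty_iff, ← hadj]; rfl
  obtain ⟨r, hr1, hr2⟩ : ∃ r : V → V, (∀ u w, H.Adj (r u) w ↔ H.Adj u w) ∧
      ∀ u v, (∀ w, H.Adj u w ↔ H.Adj v w) → r u = r v := by
    classical
    -- Twins define the same predicate, so the choice operator picks the same representative for
    -- both.
    refine ⟨fun u => Classical.epsilon (h := ⟨u⟩) fun v => ∀ w, H.Adj v w ↔ H.Adj u w,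
      fun u => Classical.epsilon_spec (p := fun v => ∀ w, H.Adj v w ↔ H.Adj u w)
        ⟨u, fun _ => Iff.rfl⟩, fun u v huv => ?_⟩
    have : (fun x => ∀ w, H.Adj x w ↔ H.Adj u w) = (fun x => ∀ w, H.Adj x w ↔ H.Adj v w) := by
      funext x; simp [huv]
    simp only [this]
  obtain ⟨s, hs1, hs2⟩ : ∃ s : V → V, (∀ u w, H.Adj w (s u) ↔ H.Adj w u) ∧
      ∀ u v, (∀ w, H.Adj w u ↔ H.Adj w v) → s u = s v := by
    classical
    refine ⟨fun u => Classical.epsilon (h := ⟨u⟩) fun v => ∀ w, H.Adj w v ↔ H.Adj w u,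
      fun u => Classical.epsilon_spec (p := fun v => ∀ w, H.Adj w v ↔ H.Adj w u)
        ⟨u, fun _ => Iff.rfl⟩, fun u v huv => ?_⟩
    have : (fun x => ∀ w, H.Adj w x ↔ H.Adj w u) = (fun x => ∀ w, H.Adj w x ↔ H.Adj w v) := by
      funext x; simp [huv]
    simp only [this]
  exact ⟨{
    a := fun v => (I (r v)).fst
    b := fun v => (I (r v)).snd
    c := fun v => (J (s v)).fst
    d := fun v => (J (s v)).snd
    hab := fun v => (I (r v)).2
    hcd := fun v => (J (s v)).2
    mono_white := fun u v => lt_iff_of_inclusionFree hI _ _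
    mono_black := fun u v => lt_iff_of_inclusionFree hJ _ _
    adj := fun u v => by rw [← hadj', hr1, hs1]
    twin_white := fun u v h => by rw [hr2 u v h]
    twin_black := fun u v h => by rw [hs2 u v h] }⟩

/-- The mirror image of a representation. -/
def IntervalRep.reflect {V : Type*} {H : Digraph V} (R : IntervalRep H) : IntervalRep H where
  a v := -R.b v
  b v := -R.a v
  c v := -R.d v
  d v := -R.c v
  hab v := neg_le_neg (R.hab v)
  hcd v := neg_le_neg (R.hcd v)
  mono_white u v := by simp [R.mono_white]
  mono_black u v := by simp [R.mono_black]
  adj u v := by rw [R.adj]; constructor <;> rintro ⟨h1, h2⟩ <;> constructor <;> linarith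
  twin_white u v h := by
    have h1 := R.twin_white u v h
    have h2 := R.mono_white u v
    have h3 := R.mono_white v u
    rw [h1] at h2 h3
    simp only [lt_self_iff_false, false_iff, not_lt] at h2 h3
    linarith
  twin_black u v h := by
    have h1 := R.twin_black u v h
    have h2 := R.mono_black u v
    have h3 := R.mono_black v u
    rw [h1] at h2 h3
    simp only [lt_self_iff_false, false_iff, not_lt] at h2 h3
    linarith

/-! ### Consistency of the two interval orders, and the obstructions -/

section

variable {V : Type*} {H : Digraph V}

/-- The vertices `p, q, u, v, s, t` play the roles of `1, …, 6`. Transitivity supplies the remaining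
arcs and, with irreflexivity, forbids all others except `pq` and `st`. These two are free and
determine the two Boolean parameters. -/
lemma containsInduced_obstruction (hirr : ∀ v, ¬ H.Adj v v)
    (htr : ∀ x y z, H.Adj x y → H.Adj y z → H.Adj x z)
    {p q u v s t : V} (hpu : H.Adj p u) (hut : H.Adj u t) (hpv : H.Adj p v) (hvt : H.Adj v t)
    (hqv : H.Adj q v) (hqu : ¬ H.Adj q u) (hvs : H.Adj v s) (hus : ¬ H.Adj u s) :
    ∃ a b : Bool, ContainsInduced H (obstruction a b) := by
  classical
  have has : ∀ x y, H.Adj x y → ¬ H.Adj y x := fun x y h h' => hirr x (htr _ _ _ h h')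
  have hps := htr _ _ _ hpv hvs
  have hpt := htr _ _ _ hpu hut
  have hqs := htr _ _ _ hqv hvs
  have hqt := htr _ _ _ hqv hvt
  have huv : ¬ H.Adj u v := fun h => hus (htr _ _ _ h hvs)
  have hvu : ¬ H.Adj v u := fun h => hqu (htr _ _ _ hqv h)
  have hsu : ¬ H.Adj s u := fun h => hvu (htr _ _ _ hvs h)
  have huq : ¬ H.Adj u q := fun h => huv (htr _ _ _ h hqv)
  have hqp : ¬ H.Adj q p := fun h => hqu (htr _ _ _ h hpu)
  have hts : ¬ H.Adj t s := fun h => hus (htr _ _ _ hut h)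
  have ne : ∀ {x y}, H.Adj x y → x ≠ y := fun {x y} h h' => hirr y (h' ▸ h)
  have n1 : p ≠ q := fun h => hqu (h ▸ hpu)
  have n2 : s ≠ t := fun h => hus (h ▸ hut)
  have n3 : u ≠ v := fun h => hqu (h ▸ hqv)
  have n4 : q ≠ u := fun h => huv (h ▸ hqv)
  have n5 : u ≠ s := fun h => hvu (h ▸ hvs)
  have hinj : ∀ i j, i < j → ![p, q, u, v, s, t] i ≠ ![p, q, u, v, s, t] j := by
    simp only [Fin.forall_fin_succ, Matrix.cons_val_zero, Matrix.cons_val_succ, IsEmpty.forall_iff,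
      Fin.lt_def, Fin.val_succ, Fin.val_zero]
    simp [n1, n2, n3, n4, n5, ne hpu, ne hpv, ne hps, ne hpt, ne hqv, ne hqs, ne hqt, ne hut,
      ne hvs, ne hvt]
  have hiff : ∀ i j, H.Adj (![p, q, u, v, s, t] i) (![p, q, u, v, s, t] j) ↔
      (obstruction (decide (H.Adj p q)) (decide (H.Adj s t))).Adj i j := by
    intro i j
    fin_cases i <;> fin_cases j <;>
      simp [obstruction, has _ _ hpu, has _ _ hut, has _ _ hpv, has _ _ hvt, has _ _ hqv,
        has _ _ hvs, has _ _ hps, has _ _ hpt, has _ _ hqs, has _ _ hqt, *]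
  refine ⟨_, _, ⟨⟨⟨![p, q, u, v, s, t], fun i j hij => ?_⟩, fun {i j} => hiff i j⟩⟩⟩
  rcases lt_trichotomy i j with h | h | h
  · exact absurd hij (hinj i j h)
  · exact h
  · exact absurd hij.symm (hinj j i h)

/-- Interior vertices whose white intervals lie to the left of their black ones are ordered
consistently by both. -/
lemma IntervalRep.not_crossing_same (R : IntervalRep H) (hirr : ∀ v, ¬ H.Adj v v)
    (htr : ∀ x y z, H.Adj x y → H.Adj y z → H.Adj x z)
    (hO : ∀ a b : Bool, ¬ ContainsInduced H (obstruction a b))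
    {u v x z : V} (hxu : H.Adj x u) (huz : H.Adj u z) (hv : R.b v < R.c v)
    (h1 : R.a u < R.a v) (h2 : R.c v < R.c u) : False := by
  have hb := (R.mono_white u v).1 h1
  have hd := (R.mono_black v u).1 h2
  -- Write `I` for white and `J` for black intervals. Here `I u` and `I v` lie to the left of `J v`
  -- and `J u`. An arc `uz` makes `J z` start before `J v`, so it ends no later than `J v`; by
  -- transitivity `I x` meets `J z`, so `I x` starts early enough to meet `J v`.
  have hin : ∀ x, H.Adj x u → H.Adj x v := by
    intro x hxu
    have hxz := htr _ _ _ hxu huz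
    rw [R.adj] at hxu huz hxz ⊢
    have : ¬ R.d v < R.d z := fun h => by linarith [(R.mono_black v z).2 h]
    constructor <;> linarith
  have hout : ∀ z, H.Adj u z → H.Adj v z := by
    intro z huz
    have hxz := htr _ _ _ hxu huz
    rw [R.adj] at hxu huz hxz ⊢
    have : ¬ R.a x < R.a v := fun h => by linarith [(R.mono_white x v).1 h]
    constructor <;> linarith
  -- Both neighbourhoods of `u` are contained in those of `v`. Equality would make `u` and `v` twins
  -- with equal left endpoints, so both inclusions are strict.
  obtain ⟨s, hvs, hus⟩ : ∃ s, H.Adj v s ∧ ¬ H.Adj u s := by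
    by_contra! h
    exact h1.ne (R.twin_white u v fun w => ⟨hout w, h w⟩)
  obtain ⟨q, hqv, hqu⟩ : ∃ q, H.Adj q v ∧ ¬ H.Adj q u := by
    by_contra! h
    exact h2.ne' (R.twin_black u v fun w => ⟨hin w, h w⟩)
  obtain ⟨a, b, h⟩ := containsInduced_obstruction hirr htr hxu huz (hin x hxu) (hout z huz)
    hqv hqu hvs hus
  exact hO a b h

/-- If the white interval of `v` reaches the black one of `u`, then `vu` is also an arc, giving a
directed 2-cycle. Otherwise the white interval of `x`, which does reach it, starts to the right of
that of `v`, hence to the right of the whole black interval of `v`, contrary to the arc `xv`. -/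
lemma IntervalRep.not_adj_mixed (R : IntervalRep H) (hirr : ∀ v, ¬ H.Adj v v)
    (htr : ∀ x y z, H.Adj x y → H.Adj y z → H.Adj x z)
    {u v x w : V} (hxu : H.Adj x u) (hvw : H.Adj v w)
    (hu : R.b u < R.c u) (hv : R.d v < R.a v) : ¬ H.Adj u v := by
  intro huv
  have hxv := htr _ _ _ hxu huv
  have hxw := htr _ _ _ hxv hvw
  have huw := htr _ _ _ huv hvw
  by_cases hJI : R.c u ≤ R.b v
  · refine hirr _ (htr _ _ _ huv ((R.adj _ _).2 ⟨?_, hJI⟩))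
    rw [R.adj] at *
    have : ¬ R.d u < R.d w := fun h => by linarith [(R.mono_black _ _).2 h]
    linarith
  · rw [R.adj] at *
    have := (R.mono_white v x).2 (by linarith)
    linarith

/-- The white interval of `x` starts after that of `v`, and the black interval of `z` ends before
that of `v`. Since the black interval of `v` is to the left of its white one, `x` and `z` cannot be
adjacent, against transitivity. -/
lemma IntervalRep.not_nested_mixed (R : IntervalRep H)
    (htr : ∀ x y z, H.Adj x y → H.Adj y z → H.Adj x z)
    {u v x z : V} (hxu : H.Adj x u) (huz : H.Adj u z) (hv : R.d v < R.a v)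
    (h1 : R.b u < R.c v) (h2 : R.b v < R.c u) : False := by
  have hxz := htr _ _ _ hxu huz
  rw [R.adj] at *
  have := (R.mono_white v x).2 (by linarith)
  have := (R.mono_black z v).1 (by linarith)
  linarith

/-- No obstruction is needed here. Neither `uv` nor `vu` is an arc, and each of these facts can come
about in two ways. -/
lemma IntervalRep.not_crossing_mixed (R : IntervalRep H) (hirr : ∀ v, ¬ H.Adj v v)
    (htr : ∀ x y z, H.Adj x y → H.Adj y z → H.Adj x z)
    {u v x z y w : V} (hxu : H.Adj x u) (huz : H.Adj u z) (hyv : H.Adj y v) (hvw : H.Adj v w)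
    (hu : R.b u < R.c u) (hv : R.d v < R.a v)
    (h1 : R.a u < R.a v) (h2 : R.c v < R.c u) : False := by
  have hb := (R.mono_white u v).1 h1
  have hd := (R.mono_black v u).1 h2
  have huv := R.not_adj_mixed hirr htr hxu hvw hu hv
  have hvu := R.reflect.not_adj_mixed (u := v) (v := u) hirr htr hyv huz (neg_lt_neg hv)
    (neg_lt_neg hu)
  rw [R.adj, not_and_or, not_le, not_le] at huv hvu
  -- The two outer combinations are the nested configuration and its mirror image. In the two inner
  -- ones `u` and `v` turn out to be white twins or black twins, which contradicts the strict
  -- inequality `h1` or `h2`.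
  rcases huv with huv | huv <;> rcases hvu with hvu | hvu
  · exact R.reflect.not_nested_mixed (u := v) (v := u) htr hyv hvw (neg_lt_neg hu)
      (neg_lt_neg hvu) (neg_lt_neg huv)
  · refine h1.ne (R.twin_white u v fun s => ⟨fun hus => ?_, fun hvs => ?_⟩)
    · have hxs := htr _ _ _ hxu hus
      rw [R.adj] at *
      have := (R.mono_white v x).2 (by linarith)
      constructor <;> linarith
    · have hys := htr _ _ _ hyv hvs
      rw [R.adj] at *
      have := (R.mono_white y u).1 (by linarith)
      constructor <;> linarith
  · refine h2.ne' (R.twin_black u v fun s => ⟨fun hsu => ?_, fun hsv => ?_⟩)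
    · have hsz := htr _ _ _ hsu huz
      rw [R.adj] at *
      have := (R.mono_black z v).1 (by linarith)
      constructor <;> linarith
    · have hsw := htr _ _ _ hsv hvw
      rw [R.adj] at *
      have := (R.mono_black u w).2 (by linarith)
      constructor <;> linarith
  · exact R.not_nested_mixed htr hxu huz hv huv hvu

/-- As there are no loops, the two intervals of a vertex are disjoint, so one lies to the left of
the other. The cases are distinguished by this side for `u` and for `v`, and reflection halves the
work. -/
lemma IntervalRep.not_crossing (R : IntervalRep H) (hirr : ∀ v, ¬ H.Adj v v)
    (htr : ∀ x y z, H.Adj x y → H.Adj y z → H.Adj x z)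
    (hO : ∀ a b : Bool, ¬ ContainsInduced H (obstruction a b))
    {u v x z y w : V} (hxu : H.Adj x u) (huz : H.Adj u z) (hyv : H.Adj y v) (hvw : H.Adj v w)
    (h1 : R.a u < R.a v) (h2 : R.c v < R.c u) : False := by
  have hb := (R.mono_white u v).1 h1
  have hd := (R.mono_black v u).1 h2
  have key : ∀ t, R.b t < R.c t ∨ R.d t < R.a t := fun t => by
    have := hirr t
    rw [R.adj, not_and_or, not_le, not_le] at this
    exact this.symm
  rcases key u with hu | hu <;> rcases key v with hv | hv
  · exact R.not_crossing_same hirr htr hO hxu huz hv h1 h2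
  · exact R.not_crossing_mixed hirr htr hxu huz hyv hvw hu hv h1 h2
  · linarith [R.hab u, R.hab v, R.hcd u, R.hcd v]
  · exact R.reflect.not_crossing_same (u := v) (v := u) hirr htr hO hyv hvw (neg_lt_neg hu)
      (neg_lt_neg hb) (neg_lt_neg hd)

/-- The order constraints imposed by a representation. -/
def IntervalRep.Below (R : IntervalRep H) (u v : V) : Prop :=
  ((∃ z, H.Adj u z) ∧ (∃ z, H.Adj v z) ∧ R.a u < R.a v) ∨
    ((∃ z, H.Adj z u) ∧ (∃ z, H.Adj z v) ∧ R.c u < R.c v)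

/-- Only interior vertices, those with both in- and out-neighbours, are subject to both orders, and
there the orders never conflict. Every other vertex is constrained by at most one of them, so
minimal elements can be found directly. -/
lemma IntervalRep.wellFounded_below [Finite V] (R : IntervalRep H) (hirr : ∀ v, ¬ H.Adj v v)
    (htr : ∀ x y z, H.Adj x y → H.Adj y z → H.Adj x z)
    (hO : ∀ a b : Bool, ¬ ContainsInduced H (obstruction a b)) : WellFounded R.Below := by
  rw [WellFounded.wellFounded_iff_has_min]
  intro S hS
  by_cases hint : ∃ u ∈ S, (∃ z, H.Adj u z) ∧ ∃ z, H.Adj z u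
  · obtain ⟨u, ⟨huS, hu1, hu2⟩, humin⟩ := Set.exists_min_image
      {u | u ∈ S ∧ (∃ z, H.Adj u z) ∧ ∃ z, H.Adj z u} (fun u => R.a u + R.c u)
      (Set.toFinite _) hint
    -- A minimizer of the sum `a + c` minimizes both summands: a smaller value of one would force a
    -- larger value of the other, which is a crossing.
    have hu : ∀ v ∈ S, (∃ z, H.Adj v z) → (∃ z, H.Adj z v) → R.a u ≤ R.a v ∧ R.c u ≤ R.c v := by
      rintro v hvS ⟨z1, hz1⟩ ⟨z2, hz2⟩
      have := humin v ⟨hvS, ⟨z1, hz1⟩, ⟨z2, hz2⟩⟩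
      obtain ⟨w1, hw1⟩ := hu1
      obtain ⟨w2, hw2⟩ := hu2
      have n1 := fun h1 => R.not_crossing hirr htr hO hw2 hw1 hz2 hz1 h1
      have n2 := fun h1 => R.not_crossing hirr htr hO hz2 hz1 hw2 hw1 h1
      constructor <;> by_contra h
      · exact n2 (not_le.1 h) (by linarith)
      · exact n1 (by linarith) (not_le.1 h)
    -- A vertex that precedes `u` in the white order cannot be interior, so it has no in-neighbour
    -- and only the white order can place anything below it.
    by_cases h1 : ∃ v ∈ S, (∃ z, H.Adj v z) ∧ R.a v < R.a u
    · obtain ⟨v, ⟨hvS, hv1, hv2⟩, hvmin⟩ := Set.exists_min_image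
        {v | v ∈ S ∧ (∃ z, H.Adj v z) ∧ R.a v < R.a u} R.a (Set.toFinite _) h1
      refine ⟨v, hvS, fun w hwS hw => ?_⟩
      rcases hw with ⟨hw1, -, hw3⟩ | ⟨-, hv3, -⟩
      · exact absurd (hvmin w ⟨hwS, hw1, hw3.trans hv2⟩) (not_le.2 hw3)
      · linarith [(hu v hvS hv1 hv3).1]
    by_cases h2 : ∃ v ∈ S, (∃ z, H.Adj z v) ∧ R.c v < R.c u
    · obtain ⟨v, ⟨hvS, hv1, hv2⟩, hvmin⟩ := Set.exists_min_image
        {v | v ∈ S ∧ (∃ z, H.Adj z v) ∧ R.c v < R.c u} R.c (Set.toFinite _) h2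
      refine ⟨v, hvS, fun w hwS hw => ?_⟩
      rcases hw with ⟨-, hv3, -⟩ | ⟨hw1, -, hw3⟩
      · linarith [(hu v hvS hv3 hv1).2]
      · exact absurd (hvmin w ⟨hwS, hw1, hw3.trans hv2⟩) (not_le.2 hw3)
    refine ⟨u, huS, fun w hwS hw => ?_⟩
    rcases hw with ⟨hw1, -, hw3⟩ | ⟨hw1, -, hw3⟩
    · exact h1 ⟨w, hwS, hw1, hw3⟩
    · exact h2 ⟨w, hwS, hw1, hw3⟩
  · by_cases h1 : ∃ v ∈ S, ∃ z, H.Adj v z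
    · obtain ⟨v, ⟨hvS, hv1⟩, hvmin⟩ := Set.exists_min_image
        {v | v ∈ S ∧ ∃ z, H.Adj v z} R.a (Set.toFinite _) h1
      refine ⟨v, hvS, fun w hwS hw => ?_⟩
      rcases hw with ⟨hw1, -, hw3⟩ | ⟨-, hv3, -⟩
      · exact absurd (hvmin w ⟨hwS, hw1⟩) (not_le.2 hw3)
      · exact hint ⟨v, hvS, hv1, hv3⟩
    · obtain ⟨v, hvS, hvmin⟩ := Set.exists_min_image S R.c (Set.toFinite _) hS
      refine ⟨v, hvS, fun w hwS hw => ?_⟩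
      rcases hw with ⟨hw1, -, -⟩ | ⟨-, -, hw3⟩
      · exact h1 ⟨w, hwS, hw1⟩
      · exact absurd (hvmin w hwS) (not_le.2 hw3)

/-- Sorting by the ordinal rank of a well-founded relation gives a linear extension. -/
lemma exists_equiv_fin_of_wellFounded {m : ℕ} (e : V ≃ Fin m) {r : V → V → Prop}
    (hr : WellFounded r) : ∃ ρ : V ≃ Fin m, ∀ u v, r u v → ρ u < ρ v := by
  have : IsWellFounded V r := ⟨hr⟩
  let g : Fin m → Ordinal := fun i => IsWellFounded.rank r (e.symm i)
  refine ⟨e.trans (Tuple.sort g).symm, fun u v huv => ?_⟩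
  by_contra h
  have h1 := Tuple.monotone_sort g (not_lt.1 h)
  simp [g] at h1
  exact absurd (IsWellFounded.rank_lt_of_rel (r := r) huv) (not_lt.2 h1)

/-- Tails of arcs have out-neighbours and heads have in-neighbours, so a linear extension of `Below`
orders tails by white and heads by black intervals. Exchanging the heads of two crossing arcs then
preserves the interval inequalities. -/
lemma exists_isMinMax {m : ℕ} (e : V ≃ Fin m) (hacyc : Acyclic H) (hquasi : QuasiTransitive H)
    (hB : IsProperIntervalBigraph (bip H))
    (hO : ∀ a b : Bool, ¬ ContainsInduced H (obstruction a b)) :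
    ∃ ρ : V ≃ Fin m, IsMinMax H ρ := by
  have hfin : Finite V := Finite.of_equiv _ e.symm
  have hirr : ∀ v, ¬ H.Adj v v := fun v h => hacyc v (.single h)
  -- The alternative arc `zx` offered by quasi-transitivity would close a directed cycle.
  have htr : ∀ x y z, H.Adj x y → H.Adj y z → H.Adj x z := by
    intro x y z hxy hyz
    have h1 : Relation.TransGen H.Adj x z := .tail (.single hxy) hyz
    have hxz : x ≠ z := fun h => hacyc x (h ▸ h1)
    refine (hquasi x y z (fun h => hirr y (h ▸ hxy)) (fun h => hirr y (h ▸ hyz)) hxz hxy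
      hyz).resolve_right fun h => hacyc x (h1.tail h)
  obtain ⟨R⟩ := exists_intervalRep hB
  obtain ⟨ρ, hρ⟩ := exists_equiv_fin_of_wellFounded e (R.wellFounded_below hirr htr hO)
  refine ⟨ρ, fun x y x' y' h h' hx hy => ?_⟩
  have ha : R.a x ≤ R.a x' := by
    by_contra hlt
    exact (hρ x' x (.inl ⟨⟨_, h'⟩, ⟨_, h⟩, not_le.1 hlt⟩)).not_gt hx
  have hc : R.c y' ≤ R.c y := by
    by_contra hlt
    exact (hρ y y' (.inr ⟨⟨_, h⟩, ⟨_, h'⟩, not_le.1 hlt⟩)).not_gt hy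
  have hb : R.b x ≤ R.b x' := by
    by_contra hlt; exact ha.not_gt ((R.mono_white _ _).2 (not_le.1 hlt))
  have hd : R.d y' ≤ R.d y := by
    by_contra hlt; exact hc.not_gt ((R.mono_black _ _).2 (not_le.1 hlt))
  rw [R.adj] at h h' ⊢
  rw [R.adj]
  refine ⟨⟨?_, ?_⟩, ?_, ?_⟩ <;> linarith

end

end MinHOM

/-! ### Preflows -/

namespace Flow

open Finset

/-- A preflow in a network on the nodes `0, …, N + 1` with source `N` and sink `N + 1`, given by its
residual capacities `r`, excesses `e` and a valid labelling `h`. -/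
structure Preflow (N : ℕ) (cap r : ℕ → ℕ → ℤ) (e h : ℕ → ℤ) : Prop where
  r_nonneg : ∀ x < N + 2, ∀ y < N + 2, 0 ≤ r x y
  r_add : ∀ x < N + 2, ∀ y < N + 2, r x y + r y x = cap x y + cap y x
  e_eq : ∀ y < N + 2, y ≠ N → e y = ∑ x ∈ range (N + 2), (cap x y - r x y)
  e_nonneg : ∀ y < N + 2, y ≠ N → 0 ≤ e y
  valid : ∀ x < N + 2, ∀ y < N + 2, 0 < r x y → h x ≤ h y + 1
  h_nonneg : ∀ x < N + 2, 0 ≤ h x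
  h_le : ∀ x < N + 2, h x ≤ N + 2
  h_source : h N = N + 2
  h_sink : h (N + 1) = 0

/-- The residual capacities after a push of `d` from `u` to `v`. -/
def pushR (r : ℕ → ℕ → ℤ) (u v : ℕ) (d : ℤ) (x y : ℕ) : ℤ :=
  if x = u ∧ y = v then r x y - d else if x = v ∧ y = u then r x y + d else r x y

/-- The excesses after a push of `d` from `u` to `v`. -/
def pushE (e : ℕ → ℤ) (u v : ℕ) (d : ℤ) (x : ℕ) : ℤ :=
  if x = u then e x - d else if x = v then e x + d else e x

variable {N : ℕ} {cap r : ℕ → ℕ → ℤ} {e h : ℕ → ℤ}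

lemma Preflow.r_le (hp : Preflow N cap r e h) {x y : ℕ} (hx : x < N + 2) (hy : y < N + 2) :
    r x y ≤ cap x y + cap y x := by
  have := hp.r_add x hx y hy
  have := hp.r_nonneg y hy x hx
  linarith

lemma Preflow.e_le (hp : Preflow N cap r e h) {y : ℕ} (hy : y < N + 2) (hyN : y ≠ N) :
    e y ≤ ∑ x ∈ range (N + 2), cap x y := by
  rw [hp.e_eq y hy hyN]
  refine sum_le_sum fun x hx => ?_
  linarith [hp.r_nonneg x (mem_range.1 hx) y hy]

/-- The only new residual arc is the reverse arc, which goes up by one label and is harmless. A push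
never enters the source, whose label `N + 2` is too high. -/
lemma Preflow.push (hp : Preflow N cap r e h) {u v : ℕ} (hu : u < N) (hv : v < N + 2)
    (hh : h u = h v + 1) {d : ℤ} (hd : 0 ≤ d) (hde : d ≤ e u) (hdr : d ≤ r u v) :
    Preflow N cap (pushR r u v d) (pushE e u v d) h := by
  have huv : u ≠ v := by rintro rfl; linarith
  have hvN : v ≠ N := by
    rintro rfl
    have h1 := hp.h_le u (by omega)
    have h2 := hp.h_source
    linarith
  refine ⟨?_, ?_, ?_, ?_, ?_, hp.h_nonneg, hp.h_le, hp.h_source, hp.h_sink⟩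
  · intro x hx y hy
    have := hp.r_nonneg x hx y hy
    unfold pushR
    split_ifs with h1 h2
    · obtain ⟨rfl, rfl⟩ := h1; linarith
    · linarith
    · exact this
  · intro x hx y hy
    have := hp.r_add x hx y hy
    unfold pushR
    split_ifs <;> omega
  · intro y hy hyN
    have := hp.e_eq y hy hyN
    have hs : ∀ x, cap x y - pushR r u v d x y = (cap x y - r x y) +
        ((if x = u then (if y = v then d else 0) else 0) -
          (if x = v then (if y = u then d else 0) else 0)) := by
      intro x
      unfold pushR
      split_ifs <;> omega
    rw [sum_congr rfl fun x _ => hs x, sum_add_distrib, ← this, sum_sub_distrib, sum_ite_eq',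
      sum_ite_eq', if_pos (mem_range.2 (by omega)), if_pos (mem_range.2 hv)]
    unfold pushE
    split_ifs <;> omega
  · intro y hy hyN
    have := hp.e_nonneg y hy hyN
    unfold pushE
    split_ifs with h1 h2
    · subst h1; linarith
    · linarith
    · exact this
  · intro x hx y hy
    unfold pushR
    split_ifs with h1 h2
    · intro h3; exact hp.valid x hx y hy (by linarith)
    · obtain ⟨rfl, rfl⟩ := h2; intro; linarith
    · exact hp.valid x hx y hy

/-- Labels are raised by one unit only. This is valid as soon as no residual arc out of `u` leads
downwards, and no minimum over the neighbours has to be computed. -/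
lemma Preflow.relabel (hp : Preflow N cap r e h) {u : ℕ} (hu : u < N) (hlt : h u < N + 2)
    (hr : ∀ y < N + 2, 0 < r u y → h u ≤ h y) :
    Preflow N cap r e (Function.update h u (h u + 1)) := by
  refine ⟨hp.r_nonneg, hp.r_add, hp.e_eq, hp.e_nonneg, ?_, ?_, ?_, ?_, ?_⟩
  · intro x hx y hy hxy
    have h1 := hp.valid x hx y hy hxy
    simp only [Function.update_apply]
    split_ifs with h2 h3 h4
    · linarith
    · subst h2; linarith [hr y hy hxy]
    · subst h4; linarith
    · exact h1
  · intro x hx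
    have := hp.h_nonneg x hx
    have := hp.h_nonneg u (by omega)
    simp only [Function.update_apply]
    split_ifs <;> omega
  · intro x hx
    have := hp.h_le x hx
    simp only [Function.update_apply]
    split_ifs <;> omega
  · rw [Function.update_of_ne (by omega), hp.h_source]
  · rw [Function.update_of_ne (by omega), hp.h_sink]

/-! ### Termination of the push-relabel sweeps -/

/-- The progress made within a sweep over the nodes, up to (excluding) node `u`: either some label
has been raised, or the active nodes that were processed have smaller labels than before. -/
def Progress (N : ℕ) (h₀ : ℕ → ℤ) (b : ℤ) (u : ℕ) (e h : ℕ → ℤ) : Prop :=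
  (0 < b ∧ ∑ x ∈ range N, h₀ x + 1 ≤ ∑ x ∈ range N, h x) ∨
    (∑ x ∈ range N, h x = ∑ x ∈ range N, h₀ x ∧
      ∀ x < N, 0 < e x → h x < N + 2 → h x < b ∧ (x < u → h x < b - 1))

/-- The receiving node may become active although it was already processed, but its label is one
less than that of `u`, hence below `b - 1`. -/
lemma Progress.push {h₀ : ℕ → ℤ} {b : ℤ} {u v : ℕ} (hP : Progress N h₀ b u e h) (hu : u < N)
    (hlt : h u < N + 2) (he : 0 < e u) (hh : h u = h v + 1) (d : ℤ) :
    Progress N h₀ b u (pushE e u v d) h := by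
  rcases hP with hP | ⟨h1, h2⟩
  · exact .inl hP
  · refine .inr ⟨h1, fun x hx hex hhx => ?_⟩
    have := h2 u hu he hlt
    unfold pushE at hex
    split_ifs at hex with h3 h4
    · subst h3; exact h2 x hx he hhx
    · subst h4; exact ⟨by omega, fun _ => by omega⟩
    · exact h2 x hx hex hhx

lemma Progress.skip {h₀ : ℕ → ℤ} {b : ℤ} {u : ℕ} (hP : Progress N h₀ b u e h)
    (hu : ¬ (0 < e u ∧ h u < N + 2)) : Progress N h₀ b (u + 1) e h := by
  rcases hP with hP | ⟨h1, h2⟩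
  · exact .inl hP
  · refine .inr ⟨h1, fun x hx hex hhx => ⟨(h2 x hx hex hhx).1, fun hxu => ?_⟩⟩
    rcases Nat.lt_succ_iff_lt_or_eq.1 hxu with h3 | rfl
    · exact (h2 x hx hex hhx).2 h3
    · exact absurd ⟨hex, hhx⟩ hu

lemma Progress.relabel {h₀ : ℕ → ℤ} {b : ℤ} {u : ℕ} (hP : Progress N h₀ b u e h) (hu : u < N)
    (hlt : h u < N + 2) (he : 0 < e u) (h0 : 0 ≤ h u) :
    Progress N h₀ b (u + 1) e (Function.update h u (h u + 1)) := by
  have hs : ∑ x ∈ range N, Function.update h u (h u + 1) x = ∑ x ∈ range N, h x + 1 := by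
    rw [sum_update_of_mem (mem_range.2 hu),
      sum_eq_add_sum_sdiff_singleton_of_mem (mem_range.2 hu) h]
    ring
  refine .inl ⟨?_, ?_⟩
  · rcases hP with hP | ⟨h1, h2⟩
    · exact hP.1
    · have := h2 u hu he hlt; omega
  · rcases hP with hP | ⟨h1, h2⟩ <;> rw [hs] <;> linarith

/-- The number of sweeps that are certain to suffice. -/
def numSweeps (N : ℕ) : ℕ := (N + 3) * (N * (N + 2)) + (N + 2) + 1

/-- Either no node is active, or `w` sweeps have decreased the potential by `w`. -/
def Sweeps (N w : ℕ) (e h : ℕ → ℤ) : Prop :=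
  ∃ b : ℤ, 0 ≤ b ∧ (∀ x < N, 0 < e x → h x < N + 2 → h x < b) ∧
    (b = 0 ∨ ((N : ℤ) + 3) * (N * (N + 2) - ∑ x ∈ range N, h x) + b + w ≤
      (N + 3) * (N * (N + 2)) + (N + 2))

lemma sweeps_zero (h0 : ∀ x < N, 0 ≤ h x) : Sweeps N 0 e h := by
  refine ⟨N + 2, by omega, fun _ _ _ h => h, .inr ?_⟩
  have : 0 ≤ ∑ x ∈ range N, h x := sum_nonneg fun x hx => h0 x (mem_range.1 hx)
  push_cast
  nlinarith

/-- A raised label lowers the weighted term of the potential by at least `N + 3`, which pays for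
resetting `b` to `N + 2`. Without a raised label, `b` itself drops by one unless it is already zero.
-/
lemma Sweeps.start {w : ℕ} (hS : Sweeps N w e h) : ∃ b : ℤ, Progress N h b 0 e h ∧
    ∀ e' h', Progress N h b N e' h' → (∀ x < N, 0 ≤ h' x) → Sweeps N (w + 1) e' h' := by
  obtain ⟨b, hb, hact, hpot⟩ := hS
  refine ⟨b, .inr ⟨rfl, fun x hx h1 h2 => ⟨hact x hx h1 h2, fun h => absurd h (by omega)⟩⟩, ?_⟩
  intro e' h' hP h0'
  rcases hP with ⟨hb0, hsum⟩ | ⟨hsum, hact'⟩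
  · refine ⟨N + 2, by omega, fun _ _ _ h => h, .inr ?_⟩
    have := hpot.resolve_left (by omega)
    push_cast
    nlinarith
  · by_cases hb0 : b = 0
    · refine ⟨0, le_rfl, fun x hx h1 h2 => ?_, .inl rfl⟩
      have := (hact' x hx h1 h2).1
      omega
    · refine ⟨b - 1, by omega, fun x hx h1 h2 => (hact' x hx h1 h2).2 hx, .inr ?_⟩
      have := hpot.resolve_left hb0
      rw [hsum]
      push_cast
      linarith

/-- The potential is nonnegative because labels are at most `N + 2`, and `numSweeps` exceeds its
initial value by one. So the bound `b` has reached zero. -/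
lemma Sweeps.not_active (hS : Sweeps N (numSweeps N) e h) (h0 : ∀ x < N, 0 ≤ h x)
    (hle : ∀ x < N, h x ≤ N + 2) : ∀ x < N, h x < N + 2 → e x ≤ 0 := by
  obtain ⟨b, hb, hact, hpot⟩ := hS
  have hb0 : b = 0 := by
    refine hpot.resolve_right fun hpot => ?_
    have : ∑ x ∈ range N, h x ≤ ∑ x ∈ range N, ((N : ℤ) + 2) :=
      sum_le_sum fun x hx => hle x (mem_range.1 hx)
    rw [sum_const, card_range, nsmul_eq_mul] at this
    have h1 : 0 ≤ ((N : ℤ) + 3) * (N * (N + 2) - ∑ x ∈ range N, h x) :=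
      mul_nonneg (by positivity) (by linarith)
    simp only [numSweeps] at hpot
    push_cast at hpot
    linarith
  intro x hx h1
  by_contra h2
  have := hact x hx (not_le.1 h2) h1
  have := h0 x hx
  omega

/-! ### Cuts, weak duality and gaps in the labelling -/

/-- The capacity of a cut. -/
def cutCap (N : ℕ) (cap : ℕ → ℕ → ℤ) (Y : Finset ℕ) : ℤ :=
  ∑ y ∈ range (N + 2) \ Y, ∑ x ∈ Y, cap x y

/-- The total excess on the sink side is the net flow across the cut. -/
lemma Preflow.sum_excess (hp : Preflow N cap r e h) {Y : Finset ℕ} (hY : Y ⊆ range (N + 2))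
    (hs : N ∈ Y) : ∑ y ∈ range (N + 2) \ Y, e y = cutCap N cap Y - cutCap N r Y := by
  have h1 : ∑ y ∈ range (N + 2) \ Y, e y =
      ∑ y ∈ range (N + 2) \ Y, ∑ x ∈ range (N + 2), (cap x y - r x y) := by
    refine sum_congr rfl fun y hy => ?_
    rw [mem_sdiff, mem_range] at hy
    exact hp.e_eq y hy.1 fun h => hy.2 (h ▸ hs)
  -- The flow `cap - r` is antisymmetric, so what stays on the sink side cancels.
  have h2 : ∑ y ∈ range (N + 2) \ Y, ∑ x ∈ range (N + 2) \ Y, (cap x y - r x y) = 0 := by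
    have h3 : ∑ y ∈ range (N + 2) \ Y, ∑ x ∈ range (N + 2) \ Y, (cap x y - r x y) =
        - ∑ y ∈ range (N + 2) \ Y, ∑ x ∈ range (N + 2) \ Y, (cap x y - r x y) := by
      conv_lhs => rw [sum_comm]
      rw [← sum_neg_distrib]
      refine sum_congr rfl fun x hx => ?_
      rw [← sum_neg_distrib]
      refine sum_congr rfl fun y hy => ?_
      rw [mem_sdiff, mem_range] at hx hy
      linarith [hp.r_add x hx.1 y hy.1]
    linarith
  rw [h1, cutCap, cutCap, ← sum_sub_distrib]
  have h4 : ∀ y, ∑ x ∈ range (N + 2), (cap x y - r x y) =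
      ∑ x ∈ range (N + 2) \ Y, (cap x y - r x y) + ∑ x ∈ Y, (cap x y - r x y) := fun y =>
    (sum_sdiff hY).symm
  simp only [h4, sum_add_distrib]
  rw [h2, zero_add]
  exact sum_congr rfl fun y _ => by rw [sum_sub_distrib]

lemma Preflow.excess_le_cutCap (hp : Preflow N cap r e h) {Y : Finset ℕ}
    (hY : Y ⊆ range (N + 2)) (hs : N ∈ Y) (ht : N + 1 ∉ Y) : e (N + 1) ≤ cutCap N cap Y := by
  have h1 := hp.sum_excess hY hs
  have h2 : 0 ≤ cutCap N r Y := by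
    refine sum_nonneg fun y hy => sum_nonneg fun x hx => ?_
    exact hp.r_nonneg x (mem_range.1 (hY hx)) y (mem_range.1 (mem_sdiff.1 hy).1)
  have h3 : e (N + 1) ≤ ∑ y ∈ range (N + 2) \ Y, e y := by
    refine single_le_sum (f := e) (fun y hy => ?_) (mem_sdiff.2 ⟨mem_range.2 (by omega), ht⟩)
    rw [mem_sdiff, mem_range] at hy
    exact hp.e_nonneg y hy.1 fun h => hy.2 (h ▸ hs)
  linarith

/-- The source side of the cut found by the algorithm. -/
def above (N : ℕ) (h : ℕ → ℤ) (g : ℤ) : Finset ℕ := (range (N + 2)).filter fun x => g < h x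

/-- A residual arc descends by at most one label, so none leads from above the gap `g` to below it:
the cut is saturated. The nodes below the gap have labels under `N + 2` and are inactive, so the
sink holds all the excess on its side. -/
lemma Preflow.excess_eq_cutCap (hp : Preflow N cap r e h)
    (hact : ∀ x < N, h x < N + 2 → e x ≤ 0) {g : ℤ} (hg0 : 0 < g) (hgN : g < N + 2)
    (hg : ∀ x < N + 2, h x ≠ g) : e (N + 1) = cutCap N cap (above N h g) := by
  have hs : N ∈ above N h g := by simp [above, hp.h_source, hgN]
  have h1 := hp.sum_excess (Y := above N h g) (filter_subset _ _) hs
  have h2 : cutCap N r (above N h g) = 0 := by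
    refine sum_eq_zero fun y hy => sum_eq_zero fun x hx => ?_
    simp only [above, mem_sdiff, mem_range, mem_filter, not_and, not_lt] at hx hy
    by_contra hne
    have h3 := hp.valid x hx.1 y hy.1
      (lt_of_le_of_ne (hp.r_nonneg x hx.1 y hy.1) (Ne.symm hne))
    have h4 := hy.2 hy.1
    have := hg y hy.1
    omega
  have ht : N + 1 ∉ above N h g := by
    simp only [above, mem_filter, hp.h_sink]
    omega
  rw [sum_eq_single_of_mem (N + 1) (mem_sdiff.2 ⟨mem_range.2 (by omega), ht⟩)] at h1
  · linarith
  · intro y hy hyt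
    simp only [above, mem_sdiff, mem_range, mem_filter, not_and, not_lt] at hy
    have h3 := hy.2 hy.1
    have hyN : y ≠ N := by rintro rfl; rw [hp.h_source] at h3; omega
    exact le_antisymm (hact y (by omega) (by omega)) (hp.e_nonneg y hy.1 hyN)

/-- Pigeonhole: source and sink carry the labels `N + 2` and `0`, and the `N` other nodes cannot
take all the `N + 1` values in between. -/
lemma Preflow.exists_gap (hp : Preflow N cap r e h) :
    ∃ g : ℕ, 0 < g ∧ g < N + 2 ∧ ∀ x < N + 2, h x ≠ g := by
  by_contra! hc
  have hsub : (Finset.Icc 1 (N + 1)) ⊆ (range N).image fun x => (h x).toNat := by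
    intro g hg
    rw [Finset.mem_Icc] at hg
    obtain ⟨x, hx, hxg⟩ := hc g (by omega) (by omega)
    refine mem_image.2 ⟨x, ?_, by omega⟩
    rw [mem_range]
    by_contra hxN
    rcases (show x = N ∨ x = N + 1 by omega) with rfl | rfl
    · rw [hp.h_source] at hxg; omega
    · rw [hp.h_sink] at hxg; omega
  have h1 := card_le_card hsub
  have h2 := h1.trans card_image_le
  simp at h2

end Flow

/-! ### The network of a minimum cost homomorphism problem -/

namespace MinHOM

open Finset Flow

/-- The indicator of a proposition. -/
noncomputable def ind (p : Prop) : ℤ := by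
  classical exact if p then 1 else 0

lemma ind_of_true {p : Prop} (h : p) : ind p = 1 := by simp [ind, h]
lemma ind_of_false {p : Prop} (h : ¬ p) : ind p = 0 := by simp [ind, h]
lemma ind_nonneg (p : Prop) : 0 ≤ ind p := by unfold ind; split_ifs <;> simp
lemma ind_le_one (p : Prop) : ind p ≤ 1 := by unfold ind; split_ifs <;> simp

/-- The data of the problem: a relation `E` on `{0, …, m - 1}` that is closed under minima and
maxima, a digraph `A` on `{0, …, n - 1}` and costs `C`, together with bounds `L` and `M`. -/
structure Data where
  m : ℕ
  E : ℕ → ℕ → Prop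
  cross : ∀ a b a' b', E a b → E a' b' → a < a' → b' < b → E a b' ∧ E a' b
  n : ℕ
  A : ℕ → ℕ → Prop
  A_lt : ∀ u v, A u v → u < n ∧ v < n
  C : ℕ → ℕ → ℤ
  L : ℤ
  M : ℤ
  abs_C_le : ∀ u < n, ∀ i < m, |C u i| ≤ L
  L_nonneg : 0 ≤ L
  M_gt : 2 * n * L < M

namespace Data

variable (D : Data)

lemma min_mem {a b a' b' : ℕ} (h : D.E a b) (h' : D.E a' b') : D.E (min a a') (min b b') := by
  rcases lt_or_ge a a' with h1 | h1 <;> rcases lt_or_ge b b' with h2 | h2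
  · rwa [min_eq_left h1.le, min_eq_left h2.le]
  · rw [min_eq_left h1.le, min_eq_right h2]
    rcases h2.eq_or_lt with rfl | h2
    · exact h
    · exact (D.cross _ _ _ _ h h' h1 h2).1
  · rw [min_eq_right h1, min_eq_left h2.le]
    rcases h1.eq_or_lt with rfl | h1
    · exact h
    · exact (D.cross _ _ _ _ h' h h1 h2).1
  · rwa [min_eq_right h1, min_eq_right h2]

lemma max_mem {a b a' b' : ℕ} (h : D.E a b) (h' : D.E a' b') : D.E (max a a') (max b b') := by
  rcases lt_or_ge a a' with h1 | h1 <;> rcases lt_or_ge b b' with h2 | h2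
  · rwa [max_eq_right h1.le, max_eq_right h2.le]
  · rw [max_eq_right h1.le, max_eq_left h2]
    rcases h2.eq_or_lt with rfl | h2
    · exact h'
    · exact (D.cross _ _ _ _ h h' h1 h2).2
  · rw [max_eq_left h1, max_eq_right h2.le]
    rcases h1.eq_or_lt with rfl | h1
    · exact h'
    · exact (D.cross _ _ _ _ h' h h1 h2).2
  · rwa [max_eq_left h1, max_eq_left h2]

/-- For an arc `uv`, a value of at least `i` at `u` forces one of at least `j` at `v`. -/
def Fwd (i j : ℕ) : Prop := ∀ a b, D.E a b → i ≤ a → j ≤ b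
/-- For an arc `vu`, a value of at least `i` at `u` forces one of at least `j` at `v`. -/
def Bwd (i j : ℕ) : Prop := ∀ a b, D.E a b → i ≤ b → j ≤ a
/-- A value of at least `i` at a vertex with an out-neighbour is at least `j`. -/
def Tail (i j : ℕ) : Prop := ∀ a b, D.E a b → i ≤ a → j ≤ a
/-- A value of at least `i` at a vertex with an in-neighbour is at least `j`. -/
def Head (i j : ℕ) : Prop := ∀ a b, D.E a b → i ≤ b → j ≤ b

/-- This is where closure under minima and maxima is used. `Tail` and `Head` are needed in addition
to `Fwd` and `Bwd` because `a` need not a priori occur as a tail, nor `b` as a head. -/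
lemma mem_of_thresholds {a b : ℕ} (h1 : ∀ j ≤ b + 1, D.Fwd a j → j ≤ b)
    (h2 : ∀ j ≤ a + 1, D.Bwd b j → j ≤ a) (h3 : ∀ j ≤ a + 1, D.Tail a j → j ≤ a)
    (h4 : ∀ j ≤ b + 1, D.Head b j → j ≤ b) : D.E a b := by
  have g1 : ¬ D.Fwd a (b + 1) := fun h => by have := h1 _ le_rfl h; omega
  have g2 : ¬ D.Bwd b (a + 1) := fun h => by have := h2 _ le_rfl h; omega
  have g3 : ¬ D.Tail a (a + 1) := fun h => by have := h3 _ le_rfl h; omega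
  have g4 : ¬ D.Head b (b + 1) := fun h => by have := h4 _ le_rfl h; omega
  simp only [Fwd, Bwd, Tail, Head, not_forall] at g1 g2 g3 g4
  obtain ⟨a1, b1, e1, l1, l1'⟩ := g1
  obtain ⟨a2, b2, e2, l2, l2'⟩ := g2
  obtain ⟨a3, b3, e3, l3, l3'⟩ := g3
  obtain ⟨a4, b4, e4, l4, l4'⟩ := g4
  -- Here `a3 = a` and `b4 = b`. The first minimum is a pair with first entry `a` and second entry
  -- at most `b`; the second has second entry `b` and first entry at most `a`.
  have := D.max_mem (D.min_mem e3 e1) (D.min_mem e2 e4)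
  convert this using 1 <;> omega

/-- The weight of the implication from node `(u, i)` to node `(v, j)`. -/
noncomputable def count (u i v j : ℕ) : ℤ :=
  ind (D.A u v) * ind (D.Fwd i j) + ind (D.A v u) * ind (D.Bwd i j) +
    ind (u = v) * (ind (j ≤ i) + ind (∃ w, D.A u w) * ind (D.Tail i j) +
      ind (∃ w, D.A w u) * ind (D.Head i j))

lemma count_nonneg (u i v j : ℕ) : 0 ≤ D.count u i v j := by
  unfold count
  have := ind_nonneg
  have h : ∀ p q, 0 ≤ ind p * ind q := fun p q => mul_nonneg (this p) (this q)
  exact add_nonneg (add_nonneg (h _ _) (h _ _))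
    (mul_nonneg (this _) (add_nonneg (add_nonneg (this _) (h _ _)) (h _ _)))

lemma count_le (u i v j : ℕ) : D.count u i v j ≤ 5 := by
  unfold count
  have h0 := ind_nonneg
  have h1 := ind_le_one
  have h : ∀ p q, ind p * ind q ≤ 1 := fun p q => mul_le_one₀ (h1 p) (h0 q) (h1 q)
  have h3 : ind (j ≤ i) + ind (∃ w, D.A u w) * ind (D.Tail i j) +
      ind (∃ w, D.A w u) * ind (D.Head i j) ≤ 3 := by
    linarith [h1 (j ≤ i), h (∃ w, D.A u w) (D.Tail i j), h (∃ w, D.A w u) (D.Head i j)]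
  have h2 := mul_le_mul (h1 (u = v)) h3 (add_nonneg (add_nonneg (h0 _)
    (mul_nonneg (h0 _) (h0 _))) (mul_nonneg (h0 _) (h0 _))) zero_le_one
  linarith [h (D.A u v) (D.Fwd i j), h (D.A v u) (D.Bwd i j)]

lemma one_le_count {u i v j : ℕ} (h : (D.A u v ∧ D.Fwd i j) ∨ (D.A v u ∧ D.Bwd i j) ∨
    (u = v ∧ (j ≤ i ∨ ((∃ w, D.A u w) ∧ D.Tail i j) ∨ (∃ w, D.A w u) ∧ D.Head i j))) :
    1 ≤ D.count u i v j := by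
  have h0 := ind_nonneg
  have h1 : ∀ p q, 0 ≤ ind p * ind q := fun p q => mul_nonneg (h0 p) (h0 q)
  have h2 : 0 ≤ ind (j ≤ i) + ind (∃ w, D.A u w) * ind (D.Tail i j) +
      ind (∃ w, D.A w u) * ind (D.Head i j) := add_nonneg (add_nonneg (h0 _) (h1 _ _)) (h1 _ _)
  have h3 := mul_nonneg (h0 (u = v)) h2
  have i1 := h1 (D.A u v) (D.Fwd i j)
  have i2 := h1 (D.A v u) (D.Bwd i j)
  unfold count
  rcases h with ⟨g1, g2⟩ | ⟨g1, g2⟩ | ⟨g1, g2⟩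
  · rw [ind_of_true g1, ind_of_true g2]; linarith
  · rw [ind_of_true g1, ind_of_true g2]; linarith
  · rw [ind_of_true g1, one_mul]
    have i3 := h0 (j ≤ i)
    have i4 := h1 (∃ w, D.A u w) (D.Tail i j)
    have i5 := h1 (∃ w, D.A w u) (D.Head i j)
    rcases g2 with g2 | ⟨g2, g3⟩ | ⟨g2, g3⟩
    · rw [ind_of_true g2]; linarith
    · rw [ind_of_true g2, ind_of_true g3]; linarith
    · rw [ind_of_true g2, ind_of_true g3]; linarith

/-- Number of nodes other than source and sink. -/
def N : ℕ := D.n * (D.m + 1)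

/-- The capacities between nodes other than source and sink. -/
noncomputable def inner (x y : ℕ) : ℤ :=
  D.M * D.count (x / (D.m + 1)) (x % (D.m + 1)) (y / (D.m + 1)) (y % (D.m + 1)) +
    ind (y = x + 1 ∧ x % (D.m + 1) < D.m) * (D.C (x / (D.m + 1)) (x % (D.m + 1)) + D.L)

/-- The capacities. -/
noncomputable def cap (x y : ℕ) : ℤ :=
  if x < D.N ∧ y < D.N then D.inner x y
  else if x = D.N ∧ y < D.N ∧ y % (D.m + 1) = 0 then D.M
  else if y = D.N + 1 ∧ x < D.N ∧ x % (D.m + 1) = D.m then D.M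
  else 0

/-- The residual capacities after saturation of the arcs out of the source. -/
noncomputable def res₀ (x y : ℕ) : ℤ :=
  if x < D.N ∧ y < D.N then D.inner x y
  else if y = D.N ∧ x < D.N ∧ x % (D.m + 1) = 0 then D.M
  else if y = D.N + 1 ∧ x < D.N ∧ x % (D.m + 1) = D.m then D.M
  else 0

noncomputable def exc₀ (x : ℕ) : ℤ := if x < D.N ∧ x % (D.m + 1) = 0 then D.M else 0

def label₀ (x : ℕ) : ℤ := if x = D.N then D.N + 2 else 0

lemma M_pos : 0 < D.M := by
  have := D.M_gt
  have : 0 ≤ 2 * (D.n : ℤ) * D.L := mul_nonneg (by positivity) D.L_nonneg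
  linarith

lemma div_lt {x : ℕ} (hx : x < D.N) : x / (D.m + 1) < D.n :=
  Nat.div_lt_of_lt_mul (by rwa [mul_comm])

lemma C_add_nonneg {u i : ℕ} (hu : u < D.n) (hi : i < D.m) : 0 ≤ D.C u i + D.L := by
  have := (abs_le.1 (D.abs_C_le u hu i hi)).1
  linarith

lemma C_add_le {u i : ℕ} (hu : u < D.n) (hi : i < D.m) : D.C u i + D.L ≤ 2 * D.L := by
  have := (abs_le.1 (D.abs_C_le u hu i hi)).2
  linarith

lemma inner_nonneg {x y : ℕ} (hx : x < D.N) : 0 ≤ D.inner x y := by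
  refine add_nonneg (mul_nonneg D.M_pos.le (D.count_nonneg _ _ _ _)) ?_
  by_cases h : y = x + 1 ∧ x % (D.m + 1) < D.m
  · rw [ind_of_true h, one_mul]; exact D.C_add_nonneg (D.div_lt hx) h.2
  · rw [ind_of_false h, zero_mul]

lemma inner_le {x y : ℕ} (hx : x < D.N) : D.inner x y ≤ 5 * D.M + 2 * D.L := by
  have h1 := mul_le_mul_of_nonneg_left
    (D.count_le (x / (D.m + 1)) (x % (D.m + 1)) (y / (D.m + 1)) (y % (D.m + 1))) D.M_pos.le
  have : ind (y = x + 1 ∧ x % (D.m + 1) < D.m) * (D.C (x / (D.m + 1)) (x % (D.m + 1)) + D.L) ≤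
      2 * D.L := by
    by_cases h : y = x + 1 ∧ x % (D.m + 1) < D.m
    · rw [ind_of_true h, one_mul]; exact D.C_add_le (D.div_lt hx) h.2
    · rw [ind_of_false h, zero_mul]; linarith [D.L_nonneg]
  unfold inner
  linarith

lemma cap_nonneg (x y : ℕ) : 0 ≤ D.cap x y := by
  have := D.M_pos
  unfold cap
  split_ifs with h
  · exact D.inner_nonneg h.1
  · exact this.le
  · exact this.le
  · exact le_rfl

lemma cap_le (x y : ℕ) : D.cap x y ≤ 5 * D.M + 2 * D.L := by
  have := D.M_pos
  have := D.L_nonneg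
  unfold cap
  split_ifs with h
  · exact D.inner_le h.1
  all_goals linarith

/-- Once the arcs out of the source are saturated no residual arc leaves it, so its label `N + 2` is
compatible with label `0` everywhere else. -/
lemma preflow₀ : Preflow D.N D.cap D.res₀ D.exc₀ D.label₀ := by
  have hM := D.M_pos
  have hres : ∀ x y, 0 ≤ D.res₀ x y := by
    intro x y
    unfold res₀
    split_ifs with h
    · exact D.inner_nonneg h.1
    · exact hM.le
    · exact hM.le
    · exact le_rfl
  refine ⟨fun x _ y _ => hres x y, ?_, ?_, ?_, ?_, ?_, ?_, ?_, ?_⟩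
  · intro x hx y hy
    by_cases hxy : x < D.N ∧ y < D.N
    · simp [res₀, cap, hxy]
    · unfold res₀ cap
      have hxy' : ¬ (y < D.N ∧ x < D.N) := fun h => hxy h.symm
      simp only [if_neg hxy, if_neg hxy']
      split_ifs <;> omega
  · intro y hy hyN
    have : ∀ x, D.cap x y - D.res₀ x y = if x = D.N then D.exc₀ y else 0 := by
      intro x
      unfold cap res₀ exc₀
      split_ifs <;> omega
    rw [sum_congr rfl fun x _ => this x, sum_ite_eq', if_pos (mem_range.2 (by omega))]
  · intro y hy hyN
    unfold exc₀
    split_ifs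
    · exact hM.le
    · exact le_rfl
  · intro x hx y hy hxy
    unfold label₀
    split_ifs with h1 h2 h3
    · omega
    · subst h1; simp [res₀] at hxy
    · omega
    · omega
  all_goals intros; unfold label₀; split_ifs <;> omega

/-! ### Cuts of small capacity and homomorphisms -/

/-- The number of levels of `u` that belong to a set of nodes, minus one. -/
def level (X : Finset ℕ) (u : ℕ) : ℕ :=
  ((range (D.m + 1)).filter fun i => u * (D.m + 1) + i ∈ X).card - 1

def IsHom (f : ℕ → ℕ) : Prop :=
  (∀ u < D.n, f u < D.m) ∧ ∀ u v, D.A u v → D.E (f u) (f v)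

lemma node_lt {u i : ℕ} (hu : u < D.n) (hi : i < D.m + 1) : u * (D.m + 1) + i < D.N := by
  unfold N
  calc u * (D.m + 1) + i < u * (D.m + 1) + (D.m + 1) := by omega
    _ = (u + 1) * (D.m + 1) := by ring
    _ ≤ _ := Nat.mul_le_mul_right _ hu

lemma node_div {u i : ℕ} (hi : i < D.m + 1) : (u * (D.m + 1) + i) / (D.m + 1) = u := by
  rw [mul_comm, Nat.mul_add_div (by omega), Nat.div_eq_of_lt hi, add_zero]

lemma node_mod {u i : ℕ} (hi : i < D.m + 1) : (u * (D.m + 1) + i) % (D.m + 1) = i := by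
  rw [mul_comm, Nat.mul_add_mod, Nat.mod_eq_of_lt hi]

lemma cutCap_eq_sum_product (N : ℕ) (cap : ℕ → ℕ → ℤ) (X : Finset ℕ) :
    cutCap N cap X = ∑ p ∈ (range (N + 2) \ X) ×ˢ X, cap p.2 p.1 := by
  rw [cutCap, sum_product]

lemma chain_injOn (f : ℕ → ℕ) (hf : ∀ u < D.n, f u < D.m) : Set.InjOn
    (fun u => (u * (D.m + 1) + f u + 1, u * (D.m + 1) + f u)) (range D.n) := by
  intro u hu v hv huv
  simp only [coe_range, Set.mem_Iio, Prod.mk.injEq] at hu hv huv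
  rw [← D.node_div (u := u) (i := f u) (by have := hf u hu; omega), huv.2,
    D.node_div (by have := hf v hv; omega)]

/-- A cut of small capacity defines a homomorphism. -/
lemma isHom_level {X : Finset ℕ} (hs : D.N ∈ X) (ht : D.N + 1 ∉ X)
    (hcut : cutCap D.N D.cap X < D.M) : D.IsHom (D.level X) ∧
      ∑ u ∈ range D.n, (D.C u (D.level X u) + D.L) ≤ cutCap D.N D.cap X := by
  -- A single arc of capacity `M` would already exceed the whole cut, so `X` is closed under such
  -- arcs.
  have hsmall : ∀ x ∈ X, ∀ y < D.N + 2, D.M ≤ D.cap x y → y ∈ X := by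
    intro x hx y hy hM
    by_contra hyX
    rw [cutCap_eq_sum_product] at hcut
    have := single_le_sum (f := fun p : ℕ × ℕ => D.cap p.2 p.1) (fun p _ => D.cap_nonneg p.2 p.1)
      (show (y, x) ∈ (range (D.N + 2) \ X) ×ˢ X from
        mem_product.2 ⟨mem_sdiff.2 ⟨mem_range.2 hy, hyX⟩, hx⟩)
    simp only at this
    linarith
  have himp : ∀ u < D.n, ∀ i < D.m + 1, ∀ v < D.n, ∀ j < D.m + 1, 1 ≤ D.count u i v j →
      u * (D.m + 1) + i ∈ X → v * (D.m + 1) + j ∈ X := by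
    intro u hu i hi v hv j hj hc hx
    have h1 := D.node_lt hu hi
    have h2 := D.node_lt hv hj
    refine hsmall _ hx _ (by omega) ?_
    rw [cap, if_pos ⟨h1, h2⟩, inner, D.node_div hi, D.node_mod hi, D.node_div hj, D.node_mod hj]
    have h3 : 0 ≤ ind (v * (D.m + 1) + j = u * (D.m + 1) + i + 1 ∧ i < D.m) *
        (D.C u i + D.L) := by
      by_cases h : v * (D.m + 1) + j = u * (D.m + 1) + i + 1 ∧ i < D.m
      · rw [ind_of_true h, one_mul]; exact D.C_add_nonneg hu h.2
      · rw [ind_of_false h, zero_mul]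
    have := D.M_pos
    nlinarith
  have hzero : ∀ u < D.n, u * (D.m + 1) + 0 ∈ X := by
    intro u hu
    have h1 := D.node_lt hu (i := 0) (by omega)
    refine hsmall _ hs _ (by omega) ?_
    rw [cap, if_neg (by omega), if_pos ⟨rfl, h1, D.node_mod (by omega)⟩]
  have htop : ∀ u < D.n, u * (D.m + 1) + D.m ∉ X := by
    intro u hu hx
    have h1 := D.node_lt hu (i := D.m) (by omega)
    refine ht (hsmall _ hx _ (by omega) ?_)
    rw [cap, if_neg (by omega), if_neg (by omega), if_pos ⟨rfl, h1, D.node_mod (by omega)⟩]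
  -- The heavy arcs from each level to all lower ones make `X` meet the chain of `u` in an initial
  -- segment, so membership can be read off from a cardinality.
  have hcard : ∀ u < D.n, ∀ i < D.m + 1, u * (D.m + 1) + i ∈ X ↔
      i < ((range (D.m + 1)).filter fun i => u * (D.m + 1) + i ∈ X).card := by
    intro u hu i hi
    constructor
    · intro hx
      have : range (i + 1) ⊆ (range (D.m + 1)).filter fun i => u * (D.m + 1) + i ∈ X := by
        intro j hj
        rw [mem_range] at hj
        refine mem_filter.2 ⟨mem_range.2 (by omega), himp u hu i hi u hu j (by omega)
          (D.one_le_count (.inr (.inr ⟨rfl, .inl (by omega)⟩))) hx⟩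
      simpa using card_le_card this
    · intro hlt
      by_contra hx
      have : ((range (D.m + 1)).filter fun i => u * (D.m + 1) + i ∈ X) ⊆ range i := by
        intro j hj
        rw [mem_filter, mem_range] at hj
        rw [mem_range]
        by_contra hji
        exact hx (himp u hu j hj.1 u hu i hi
          (D.one_le_count (.inr (.inr ⟨rfl, .inl (by omega)⟩))) hj.2)
      have := card_le_card this
      rw [card_range] at this
      omega
  have hlev : ∀ u < D.n, ∀ i < D.m + 1, u * (D.m + 1) + i ∈ X ↔ i ≤ D.level X u := by
    intro u hu i hi
    have h0 := (hcard u hu 0 (by omega)).1 (hzero u hu)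
    rw [hcard u hu i hi, level]
    omega
  have hlt : ∀ u < D.n, D.level X u < D.m := by
    intro u hu
    have := mt (hlev u hu D.m (by omega)).2 (htop u hu)
    omega
  refine ⟨⟨hlt, fun u v huv => ?_⟩, ?_⟩
  · obtain ⟨hu, hv⟩ := D.A_lt u v huv
    have hu' := hlt u hu
    have hv' := hlt v hv
    have memu := (hlev u hu _ (by omega)).2 le_rfl
    have memv := (hlev v hv _ (by omega)).2 le_rfl
    refine D.mem_of_thresholds (fun j hj h => ?_) (fun j hj h => ?_) (fun j hj h => ?_)
      (fun j hj h => ?_)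
    · exact (hlev v hv j (by omega)).1 (himp u hu _ (by omega) v hv j (by omega)
        (D.one_le_count (.inl ⟨huv, h⟩)) memu)
    · exact (hlev u hu j (by omega)).1 (himp v hv _ (by omega) u hu j (by omega)
        (D.one_le_count (.inr (.inl ⟨huv, h⟩))) memv)
    · exact (hlev u hu j (by omega)).1 (himp u hu _ (by omega) u hu j (by omega)
        (D.one_le_count (.inr (.inr ⟨rfl, .inr (.inl ⟨⟨v, huv⟩, h⟩)⟩))) memu)
    · exact (hlev v hv j (by omega)).1 (himp v hv _ (by omega) v hv j (by omega)
        (D.one_le_count (.inr (.inr ⟨rfl, .inr (.inr ⟨⟨u, huv⟩, h⟩)⟩))) memv)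
  · rw [cutCap_eq_sum_product]
    -- The chain of every vertex is cut just above its highest level in `X`; these arcs are distinct
    -- and all other capacities are nonnegative.
    have hsub : (range D.n).image (fun u => (u * (D.m + 1) + D.level X u + 1,
        u * (D.m + 1) + D.level X u)) ⊆ (range (D.N + 2) \ X) ×ˢ X := by
      intro p hp
      obtain ⟨u, hu, rfl⟩ := mem_image.1 hp
      rw [mem_range] at hu
      have hu' := hlt u hu
      have h1 := D.node_lt hu (i := D.level X u + 1) (by omega)
      refine mem_product.2 ⟨mem_sdiff.2 ⟨mem_range.2 (by simp only; omega), fun h => ?_⟩,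
        (hlev u hu _ (by omega)).2 le_rfl⟩
      have := (hlev u hu (D.level X u + 1) (by omega)).1 (by simpa [add_assoc] using h)
      omega
    refine le_trans ?_ (sum_le_sum_of_subset_of_nonneg hsub fun p _ _ => D.cap_nonneg _ _)
    rw [sum_image (D.chain_injOn _ hlt)]
    refine sum_le_sum fun u hu => ?_
    rw [mem_range] at hu
    have hu' := hlt u hu
    have h1 := D.node_lt hu (i := D.level X u + 1) (by omega)
    have h2 := D.node_lt hu (i := D.level X u) (by omega)
    simp only
    rw [cap, if_pos ⟨h2, by omega⟩, inner, D.node_div (by omega), D.node_mod (by omega),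
      ind_of_true ⟨rfl, hu'⟩, one_mul]
    have := mul_nonneg D.M_pos.le (D.count_nonneg u (D.level X u)
      ((u * (D.m + 1) + D.level X u + 1) / (D.m + 1))
      ((u * (D.m + 1) + D.level X u + 1) % (D.m + 1)))
    linarith

/-- The cut that corresponds to a mapping. -/
def cutOf (f : ℕ → ℕ) : Finset ℕ :=
  (range (D.N + 2)).filter fun x => x = D.N ∨ (x < D.N ∧ x % (D.m + 1) ≤ f (x / (D.m + 1)))

/-- A homomorphism satisfies all threshold implications, so no heavy arc leaves its cut. The only
contributions come from one chain arc per vertex, from level `f u` to level `f u + 1`. -/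
lemma cutCap_cutOf_le {f : ℕ → ℕ} (hf : D.IsHom f) :
    cutCap D.N D.cap (D.cutOf f) ≤ ∑ u ∈ range D.n, (D.C u (f u) + D.L) := by
  have hcap : ∀ x ∈ D.cutOf f, ∀ y < D.N + 2, y ∉ D.cutOf f → D.cap x y =
      if x < D.N ∧ x % (D.m + 1) = f (x / (D.m + 1)) ∧ y = x + 1 then
        D.C (x / (D.m + 1)) (f (x / (D.m + 1))) + D.L else 0 := by
    intro x hx y hy hyX
    simp only [cutOf, mem_filter, mem_range, not_and, not_or, not_le] at hx hyX
    have hyX := hyX hy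
    have hxm := Nat.mod_lt x (show 0 < D.m + 1 by omega)
    have hym := Nat.mod_lt y (show 0 < D.m + 1 by omega)
    rcases hx.2 with rfl | ⟨hxN, hxf⟩
    · rw [if_neg (by omega), cap, if_neg (by omega), if_neg (by omega), if_neg (by omega)]
    have hu := D.div_lt hxN
    have hfu := hf.1 _ hu
    by_cases hyN : y < D.N
    · have hyf := hyX.2 hyN
      have hv := D.div_lt hyN
      have hfv := hf.1 _ hv
      -- Each summand of `count` would be an implication whose premise holds for `f` at `x` while
      -- its conclusion fails at `y`.
      have hcount : D.count (x / (D.m + 1)) (x % (D.m + 1)) (y / (D.m + 1)) (y % (D.m + 1)) =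
          0 := by
        have z : ∀ p q : Prop, ¬ (p ∧ q) → ind p * ind q = 0 := by
          intro p q h
          by_cases hp : p
          · rw [ind_of_false fun hq => h ⟨hp, hq⟩, mul_zero]
          · rw [ind_of_false hp, zero_mul]
        unfold count
        rw [z (D.A (x / (D.m + 1)) (y / (D.m + 1))) _ fun h => by
          have := h.2 _ _ (hf.2 _ _ h.1) hxf; omega,
          z (D.A (y / (D.m + 1)) (x / (D.m + 1))) _ fun h => by
          have := h.2 _ _ (hf.2 _ _ h.1) hxf; omega]
        by_cases huv : x / (D.m + 1) = y / (D.m + 1)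
        · rw [← huv] at hyf
          rw [ind_of_false (p := _ ≤ _) (by omega),
            z (∃ w, D.A (x / (D.m + 1)) w) _ fun h => by
              obtain ⟨w, hw⟩ := h.1; have := h.2 _ _ (hf.2 _ _ hw) hxf; omega,
            z (∃ w, D.A w (x / (D.m + 1))) _ fun h => by
              obtain ⟨w, hw⟩ := h.1; have := h.2 _ _ (hf.2 _ _ hw) hxf; omega]
          simp
        · rw [ind_of_false huv]; simp
      rw [cap, if_pos ⟨hxN, hyN⟩, inner, hcount, mul_zero, zero_add]
      by_cases hyx : y = x + 1 ∧ x % (D.m + 1) < D.m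
      · obtain ⟨rfl, hxm'⟩ := hyx
        have hx1 : (x + 1) / (D.m + 1) = x / (D.m + 1) ∧
            (x + 1) % (D.m + 1) = x % (D.m + 1) + 1 := by
          have e : x + 1 = (x / (D.m + 1)) * (D.m + 1) + (x % (D.m + 1) + 1) := by
            have := Nat.div_add_mod x (D.m + 1)
            rw [mul_comm] at this
            omega
          constructor
          · conv_lhs => rw [e]
            exact D.node_div (by omega)
          · conv_lhs => rw [e]
            exact D.node_mod (by omega)
        rw [hx1.1, hx1.2] at hyf
        have hxe : x % (D.m + 1) = f (x / (D.m + 1)) := by omega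
        rw [ind_of_true ⟨rfl, hxm'⟩, if_pos ⟨hxN, hxe, rfl⟩, one_mul, hxe]
      · rw [ind_of_false hyx, if_neg (fun h => hyx ⟨h.2.2, by omega⟩), zero_mul]
    · rw [cap, if_neg (by omega), if_neg (by omega), if_neg (by omega), if_neg]
      rintro ⟨h1, h2, h3⟩
      apply hyX.1
      omega
  rw [cutCap_eq_sum_product]
  have h1 : ∑ p ∈ (range (D.N + 2) \ D.cutOf f) ×ˢ D.cutOf f, D.cap p.2 p.1 =
      ∑ p ∈ ((range (D.N + 2) \ D.cutOf f) ×ˢ D.cutOf f).filter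
        (fun p => p.2 < D.N ∧ p.2 % (D.m + 1) = f (p.2 / (D.m + 1)) ∧ p.1 = p.2 + 1),
        (D.C (p.2 / (D.m + 1)) (f (p.2 / (D.m + 1))) + D.L) := by
    rw [sum_filter]
    refine sum_congr rfl fun p hp => ?_
    obtain ⟨h1, h2⟩ := mem_product.1 hp
    rw [mem_sdiff, mem_range] at h1
    rw [hcap _ h2 _ h1.1 h1.2]
  have h2 : ∑ u ∈ range D.n, (D.C u (f u) + D.L) = ∑ p ∈ (range D.n).image
      (fun u => (u * (D.m + 1) + f u + 1, u * (D.m + 1) + f u)),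
        (D.C (p.2 / (D.m + 1)) (f (p.2 / (D.m + 1))) + D.L) := by
    rw [sum_image (D.chain_injOn _ hf.1)]
    refine sum_congr rfl fun u hu => ?_
    have := hf.1 u (mem_range.1 hu)
    simp only [D.node_div (show f u < D.m + 1 by omega)]
  rw [h1, h2]
  refine sum_le_sum_of_subset_of_nonneg ?_ fun p hp _ => ?_
  · intro p hp
    obtain ⟨-, h3, h4, h5⟩ := mem_filter.1 hp
    have := Nat.div_add_mod p.2 (D.m + 1)
    rw [mul_comm] at this
    exact mem_image.2 ⟨p.2 / (D.m + 1), mem_range.2 (D.div_lt h3),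
      Prod.ext (by simp only; omega) (by simp only; omega)⟩
  · obtain ⟨u, hu, rfl⟩ := mem_image.1 hp
    have hu := mem_range.1 hu
    have := hf.1 u hu
    simp only [D.node_div (show f u < D.m + 1 by omega)]
    exact D.C_add_nonneg hu this

/-- The outcome of a maximum flow computation. -/
theorem of_preflow {r : ℕ → ℕ → ℤ} {e h : ℕ → ℤ} (hp : Preflow D.N D.cap r e h)
    (hact : ∀ x < D.N, h x < D.N + 2 → e x ≤ 0) {g : ℕ} (hg0 : 0 < g) (hgN : g < D.N + 2)
    (hg : ∀ x < D.N + 2, h x ≠ g) :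
    (D.M ≤ e (D.N + 1) → ¬ ∃ f, D.IsHom f) ∧
    (e (D.N + 1) < D.M → D.IsHom (D.level (above D.N h g)) ∧ ∀ f, D.IsHom f →
      ∑ u ∈ range D.n, D.C u (D.level (above D.N h g) u) ≤ ∑ u ∈ range D.n, D.C u (f u)) := by
  have hle : ∀ f, D.IsHom f → e (D.N + 1) ≤ ∑ u ∈ range D.n, (D.C u (f u) + D.L) := by
    intro f hf
    refine (hp.excess_le_cutCap (filter_subset _ _) ?_ ?_).trans (D.cutCap_cutOf_le hf)
    · exact mem_filter.2 ⟨mem_range.2 (by omega), .inl rfl⟩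
    · simp
  constructor
  · rintro hM ⟨f, hf⟩
    have h1 := hle f hf
    -- Any homomorphism gives a cut of capacity at most `2 * n * L`, which is less than `M`.
    have h2 : ∑ u ∈ range D.n, (D.C u (f u) + D.L) ≤ ∑ u ∈ range D.n, 2 * D.L :=
      sum_le_sum fun u hu => D.C_add_le (mem_range.1 hu) (hf.1 u (mem_range.1 hu))
    rw [sum_const, card_range, nsmul_eq_mul] at h2
    have := D.M_gt
    linarith
  · intro hM
    -- The gap cut attains the lower bound that `hle` imposes on every homomorphism. The shift by
    -- `L` contributes the same amount to all of them and cancels.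
    have heq := hp.excess_eq_cutCap hact (g := g) (by omega) (by omega) hg
    obtain ⟨h1, h2⟩ := D.isHom_level (X := above D.N h g)
      (by simp [above, hp.h_source]; omega) (by simp [above, hp.h_sink]) (by omega)
    refine ⟨h1, fun f hf => ?_⟩
    have h3 := hle f hf
    rw [sum_add_distrib] at h2 h3
    linarith

end Data

end MinHOM

namespace RAM

open Finset

/-! ### Derived expressions -/

namespace Exp

/-- The content of cell `0` of an array. -/
abbrev var (a : ℕ) : Exp := .read a (.lit 0)

/-- `1` if the value is `0`, and `0` otherwise. -/
def isZero (e : Exp) : Exp := .div (.lit 1) (.add (.lit 1) (.mul e e))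

def eq (e f : Exp) : Exp := isZero (.sub e f)

def mod (e f : Exp) : Exp := .sub e (.mul f (.div e f))

def sum (f : ℕ → Exp) : ℕ → Exp
  | 0 => .lit 0
  | n + 1 => .add (sum f n) (f n)

/-- Table lookup. -/
def tab (n : ℕ) (F : ℕ → ℤ) (e : Exp) : Exp := sum (fun i => .mul (.lit (F i)) (eq e (.lit i))) n

variable {σ : Store}

@[simp] lemma val_lit (z : ℤ) : (lit z).val σ = z := rfl
@[simp] lemma val_read (a : ℕ) (e : Exp) : (read a e).val σ = σ a (e.val σ) := rfl
@[simp] lemma val_add (e f : Exp) : (add e f).val σ = e.val σ + f.val σ := rfl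
@[simp] lemma val_sub (e f : Exp) : (sub e f).val σ = e.val σ - f.val σ := rfl
@[simp] lemma val_mul (e f : Exp) : (mul e f).val σ = e.val σ * f.val σ := rfl
@[simp] lemma val_div (e f : Exp) : (div e f).val σ = e.val σ / f.val σ := rfl

@[simp] lemma val_isZero (e : Exp) : (isZero e).val σ = if e.val σ = 0 then 1 else 0 := by
  simp only [isZero, val_div, val_lit, val_add, val_mul]
  split_ifs with h
  · simp [h]
  · have : 0 < e.val σ * e.val σ := mul_self_pos.2 h
    exact Int.ediv_eq_zero_of_lt (by norm_num) (by linarith)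

@[simp] lemma val_eq (e f : Exp) : (eq e f).val σ = if e.val σ = f.val σ then 1 else 0 := by
  simp [eq, sub_eq_zero]

@[simp] lemma val_mod (e f : Exp) : (mod e f).val σ = e.val σ % f.val σ := by
  simp only [mod, val_sub, val_mul, val_div]
  rw [Int.emod_def]

lemma val_sum (f : ℕ → Exp) (n : ℕ) : (sum f n).val σ = ∑ i ∈ range n, (f i).val σ := by
  induction n with
  | zero => simp [sum]
  | succ n ih => rw [sum_range_succ, ← ih]; rfl

lemma val_tab {n : ℕ} {F : ℕ → ℤ} {e : Exp} {x : ℕ} (hx : x < n) (he : e.val σ = x) :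
    (tab n F e).val σ = F x := by
  rw [tab, val_sum, sum_eq_single_of_mem x (mem_range.2 hx)]
  · simp [he]
  · intro i _ hi
    simp only [val_mul, val_eq, he, val_lit, Nat.cast_inj]
    rw [if_neg (Ne.symm hi), mul_zero]

end Exp

/-! ### Simple loops -/

namespace Cmd

variable {Λ Z : ℤ}

/-- Fill an array with the values of an expression in the loop counter. -/
def fill (x a : ℕ) (c : ℤ) (e f : Exp) : Cmd :=
  rep x e (asg a (.add (.lit c) (.var x)) f)

lemma wp_fill {x a : ℕ} {c : ℤ} {e f : Exp} {Q : Store → Prop} {σ : Store} (hxa : a ≠ x) (n : ℕ)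
    (F : ℕ → ℤ) (he : e.val σ = n) (hn : (n : ℤ) ≤ Λ) (hF : ∀ k < n, |F k| ≤ Z)
    (hf : ∀ k < n, ∀ τ : Store, (∀ b, b ≠ x → b ≠ a → τ b = σ b) → τ x 0 = (k : ℤ) →
      f.val τ = F k)
    (hQ : ∀ τ : Store, (∀ b, b ≠ x → b ≠ a → τ b = σ b) → (∀ k < n, τ a (c + k) = F k) →
      (∀ j, (∀ k < n, j ≠ c + k) → τ a j = σ a j) → Q τ) :
    wp Λ Z (fill x a c e f) Q σ := by
  have hk : ∀ b, b ≠ x → b ≠ a → (rep x e (asg a (.add (.lit c) (.var x)) f)).keeps b := by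
    intro b h1 h2; simp [keeps, h1.symm, h2.symm]
  refine wp_rep n he hn (fun k τ => (∀ j < k, τ a (c + (j : ℕ)) = F j) ∧
    ∀ j, (∀ i < n, j ≠ c + (i : ℕ)) → τ a j = σ a j) ?_ ?_ ?_
  · simp [hxa]
  · rintro k τ hkn hx hfr ⟨h1, h2⟩
    have hv := hf k hkn τ (fun b hb hb' => hfr b (hk b hb hb')) hx
    refine ⟨by rw [hv]; exact hF k hkn, fun j hj => ?_, fun j hj => ?_⟩
    · rw [Store.set_apply_of_ne _ hxa, Store.set_apply, hv]
      simp only [Exp.val_add, Exp.val_lit, Exp.val_read, hx, add_right_inj, Nat.cast_inj]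
      split_ifs with h
      · rw [h]
      · exact h1 j (by omega)
    · rw [Store.set_apply_of_ne _ hxa, Store.set_apply, if_neg, h2 j hj]
      simpa [hx] using hj k hkn
  · rintro τ hfr ⟨h1, h2⟩
    exact hQ τ (fun b hb hb' => hfr b (hk b hb hb')) h1 h2

/-- Repeatedly update a variable. -/
def scan (x a : ℕ) (e f : Exp) : Cmd := rep x e (asg a (.lit 0) f)

lemma wp_scan {x a : ℕ} {e f : Exp} {Q : Store → Prop} {σ : Store} (hxa : a ≠ x) (n : ℕ)
    (s : ℕ → ℤ) (he : e.val σ = n) (hn : (n : ℤ) ≤ Λ) (h0 : σ a 0 = s 0)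
    (hs : ∀ k < n, |s (k + 1)| ≤ Z)
    (hf : ∀ k < n, ∀ τ : Store, (∀ b, b ≠ x → b ≠ a → τ b = σ b) → τ x 0 = (k : ℤ) →
      τ a 0 = s k → f.val τ = s (k + 1))
    (hQ : ∀ τ : Store, (∀ b, b ≠ x → b ≠ a → τ b = σ b) → τ a 0 = s n → Q τ) :
    wp Λ Z (scan x a e f) Q σ := by
  have hk : ∀ b, b ≠ x → b ≠ a → (rep x e (asg a (.lit 0) f)).keeps b := by
    intro b h1 h2; simp [keeps, h1.symm, h2.symm]
  refine wp_rep n he hn (fun k τ => τ a 0 = s k) ?_ ?_ ?_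
  · simp [hxa, h0]
  · intro k τ hkn hx hfr hI
    have hv := hf k hkn τ (fun b hb hb' => hfr b (hk b hb hb')) hx hI
    refine ⟨by rw [hv]; exact hs k hkn, ?_⟩
    beta_reduce
    rw [Store.set_apply_of_ne _ hxa, Store.set_apply, hv]
    simp
  · exact fun τ hfr hI => hQ τ (fun b hb hb' => hfr b (hk b hb hb')) hI

lemma wp_asg {a : ℕ} {i e : Exp} {Q : Store → Prop} {σ : Store} (he : |e.val σ| ≤ Z)
    (hQ : Q (σ.set a (i.val σ) (e.val σ))) : wp Λ Z (asg a i e) Q σ := ⟨he, hQ⟩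

lemma wp_seq {P R : Cmd} {Q : Store → Prop} {σ : Store} (h : wp Λ Z P (wp Λ Z R Q) σ) :
    wp Λ Z (seq P R) Q σ := h

end Cmd

end RAM

namespace MinHOM

open RAM Finset

/-! ### Reading the input -/

namespace Instance

variable {V : Type*} {m : ℕ} (e : V ≃ Fin m) (I : Instance V)

/-- The arcs, with vertices regarded as natural numbers. -/
def arc (u v : ℕ) : Prop := ∃ (hu : u < I.n) (hv : v < I.n), I.graph.Adj ⟨u, hu⟩ ⟨v, hv⟩

/-- The costs, with vertices regarded as natural numbers. -/
def costAt (u i : ℕ) : ℚ :=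
  if h : u < I.n ∧ i < m then I.cost ⟨u, h.1⟩ (e.symm ⟨i, h.2⟩) else 0

lemma getD_encode (k : ℕ) : initStore (I.encode e) 0 k =
    (((I.encode e).length : ℤ) :: I.encode e).getD k 0 := by
  simp [initStore]

lemma initStore_of_ne {xs : List ℤ} {a : ℕ} (ha : a ≠ 0) (i : ℤ) : initStore xs a i = 0 := by
  simp [initStore, ha]

lemma input_n : initStore (I.encode e) 0 1 = I.n := by
  have := I.getD_encode e 1
  simpa [encode] using this

/-- Cell `0` holds the length of the input and cell `1` the number of vertices, so the adjacency
matrix starts at cell `2`. -/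
lemma input_arc {k : ℕ} (hk : k < I.n * I.n) :
    initStore (I.encode e) 0 (2 + k) = ind (I.arc (k / I.n) (k % I.n)) := by
  have := I.getD_encode e (2 + k)
  push_cast at this
  rw [this, encode, add_comm, List.getD_cons_succ, List.getD_cons_succ,
    List.getD_eq_getElem?_getD, List.append_assoc, List.getElem?_append_left (by simpa using hk),
    List.getElem?_ofFn, dif_pos hk, Option.getD_some]
  have h1 : k / I.n < I.n := Nat.div_lt_of_lt_mul hk
  have h2 : k % I.n < I.n := Nat.mod_lt _ (Nat.zero_lt_of_lt h1)
  have : I.graph.Adj (Fin.divNat ⟨k, hk⟩) (Fin.modNat ⟨k, hk⟩) ↔ I.arc (k / I.n) (k % I.n) := by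
    constructor
    · exact fun h => ⟨h1, h2, h⟩
    · rintro ⟨_, _, h⟩; exact h
  by_cases h : I.arc (k / I.n) (k % I.n)
  · rw [if_pos (this.2 h), ind_of_true h]
  · rw [if_neg (mt this.1 h), ind_of_false h]

lemma input_num {k : ℕ} (hk : k < I.n * m) :
    initStore (I.encode e) 0 (2 + I.n * I.n + k) = (I.costAt e (k / m) (k % m)).num := by
  have := I.getD_encode e (2 + I.n * I.n + k)
  push_cast at this
  have hm : 0 < m := Nat.pos_of_ne_zero fun h => by simp [h] at hk
  rw [this, encode, show 2 + I.n * I.n + k = I.n * I.n + k + 2 by ring, List.getD_cons_succ,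
    List.getD_cons_succ, List.getD_eq_getElem?_getD, List.append_assoc,
    List.getElem?_append_right (by simp),
    List.getElem?_append_left (by simpa using hk), List.length_ofFn, Nat.add_sub_cancel_left,
    List.getElem?_ofFn, dif_pos hk, Option.getD_some, costAt,
    dif_pos ⟨Nat.div_lt_of_lt_mul (by rwa [mul_comm]), Nat.mod_lt _ hm⟩]
  rfl

lemma input_den {k : ℕ} (hk : k < I.n * m) :
    initStore (I.encode e) 0 (2 + I.n * I.n + I.n * m + k) =
      ((I.costAt e (k / m) (k % m)).den : ℤ) := by
  have := I.getD_encode e (2 + I.n * I.n + I.n * m + k)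
  push_cast at this
  have hm : 0 < m := Nat.pos_of_ne_zero fun h => by simp [h] at hk
  rw [this, encode, show 2 + I.n * I.n + I.n * m + k = I.n * I.n + I.n * m + k + 2 by ring,
    List.getD_cons_succ, List.getD_cons_succ, List.getD_eq_getElem?_getD,
    List.getElem?_append_right (by simp), List.getElem?_ofFn, List.length_append, List.length_ofFn,
    List.length_ofFn, Nat.add_sub_cancel_left, dif_pos hk, Option.getD_some, costAt,
    dif_pos ⟨Nat.div_lt_of_lt_mul (by rwa [mul_comm]), Nat.mod_lt _ hm⟩]
  rfl

lemma sq_le_inputSize : I.n * I.n + I.n * m ≤ inputSize (I.encode e) := by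
  refine le_trans ?_ (length_le_inputSize _)
  simp [encode]
  omega

lemma n_le_inputSize : I.n ≤ inputSize (I.encode e) :=
  (Nat.le_mul_self _).trans ((Nat.le_add_right _ _).trans (I.sq_le_inputSize e))

/-- Base-two logarithm of a bound for the numbers that occur in the computation. -/
noncomputable def logBound : ℕ := (inputSize (I.encode e) + m + 1) ^ 2

/-- The common denominator of the first `k` costs. -/
def denom (k : ℕ) : ℤ := ∏ j ∈ range k, ((I.costAt e (j / m) (j % m)).den : ℤ)

lemma denom_pos (k : ℕ) : 0 < I.denom e k :=
  prod_pos fun j _ => by exact_mod_cast (I.costAt e (j / m) (j % m)).den_pos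

/-- The costs multiplied by the common denominator. -/
def intCost (u i : ℕ) : ℤ :=
  (I.costAt e u i).num * (I.denom e (I.n * m) / (I.costAt e u i).den)

/-- Every denominator is a factor of the common one, so the integer division is exact. All costs are
scaled by the same positive number, so minimizers do not change. -/
lemma intCost_eq {u i : ℕ} (hu : u < I.n) (hi : i < m) :
    (I.intCost e u i : ℚ) = I.costAt e u i * I.denom e (I.n * m) := by
  have hk : u * m + i < I.n * m := calc
    u * m + i < u * m + m := by omega
    _ = (u + 1) * m := by ring
    _ ≤ _ := Nat.mul_le_mul_right _ hu
  have h1 : (u * m + i) / m = u := by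
    rw [mul_comm, Nat.mul_add_div (by omega), Nat.div_eq_of_lt hi, add_zero]
  have h2 : (u * m + i) % m = i := by rw [mul_comm, Nat.mul_add_mod, Nat.mod_eq_of_lt hi]
  have hdvd : ((I.costAt e u i).den : ℤ) ∣ I.denom e (I.n * m) := by
    have := dvd_prod_of_mem (fun j => ((I.costAt e (j / m) (j % m)).den : ℤ)) (mem_range.2 hk)
    rw [h1, h2] at this
    exact this
  obtain ⟨c, hc⟩ := hdvd
  have hd : ((I.costAt e u i).den : ℤ) ≠ 0 := by exact_mod_cast (I.costAt e u i).den_nz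
  rw [intCost, hc, Int.mul_ediv_cancel_left _ hd]
  push_cast
  rw [← mul_assoc, Rat.mul_den_eq_num]

lemma logBound_pos : 1 ≤ I.logBound e := Nat.one_le_pow _ _ (by omega)

lemma le_logBound : inputSize (I.encode e) + m + 1 ≤ I.logBound e := by
  unfold logBound; nlinarith

lemma abs_input_le (a : ℕ) (i : ℤ) : |initStore (I.encode e) a i| ≤ 2 ^ I.logBound e :=
  (abs_initStore_le _ a i).trans (pow_le_pow_right₀ (by norm_num) (by
    have := I.le_logBound e; omega))

/-- There are at most as many factors as the input size, each an input number with at most that many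
bits. This explains the square in `logBound`. -/
lemma denom_le {k : ℕ} (hk : k ≤ I.n * m) : I.denom e k ≤ 2 ^ I.logBound e := by
  have h1 : I.denom e k ≤ ∏ j ∈ range k, (2 : ℤ) ^ inputSize (I.encode e) := by
    refine prod_le_prod (fun j _ => by positivity) fun j hj => ?_
    rw [← I.input_den e (by have := mem_range.1 hj; omega)]
    exact (le_abs_self _).trans (abs_initStore_le _ _ _)
  refine h1.trans ?_
  rw [prod_const, card_range, ← pow_mul]
  refine pow_le_pow_right₀ (by norm_num) ?_
  have := I.sq_le_inputSize e
  unfold logBound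
  nlinarith

lemma abs_intCost_le {u i : ℕ} (hu : u < I.n) (hi : i < m) :
    |I.intCost e u i| ≤ 2 ^ (2 * I.logBound e) := by
  have hk : u * m + i < I.n * m := calc
    u * m + i < u * m + m := by omega
    _ = (u + 1) * m := by ring
    _ ≤ _ := Nat.mul_le_mul_right _ hu
  have h1 : (u * m + i) / m = u := by
    rw [mul_comm, Nat.mul_add_div (by omega), Nat.div_eq_of_lt hi, add_zero]
  have h2 : (u * m + i) % m = i := by rw [mul_comm, Nat.mul_add_mod, Nat.mod_eq_of_lt hi]
  have h3 := I.input_num e hk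
  rw [h1, h2] at h3
  rw [intCost, abs_mul, two_mul, pow_add, ← h3]
  refine mul_le_mul (I.abs_input_le e _ _) ?_ (abs_nonneg _) (by positivity)
  refine (Int.abs_ediv_le_abs _ _).trans ?_
  rw [abs_of_pos (I.denom_pos e _)]
  exact I.denom_le e le_rfl

/-! ### Clearing denominators -/

/-- The number of vertices of the input digraph. -/
abbrev nE : Exp := .read 0 (.lit 1)

/-- The common denominator is computed in array `10`, the integral costs in array `20`; column `i`
of the costs is the column `π i` of the input. -/
def prelude (m : ℕ) (π : ℕ → ℕ) : Cmd :=
  .seq (.asg 10 (.lit 0) (.lit 1)) <|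
  .seq (.scan 2 10 (.mul nE (.lit m)) (.mul (.var 10)
    (.read 0 (.add (.add (.add (.lit 2) (.mul nE nE)) (.mul nE (.lit m))) (.var 2))))) <|
  .fill 2 20 0 (.mul nE (.lit m))
    (.mul (.read 0 (.add (.add (.lit 2) (.mul nE nE))
        (.add (.mul (.div (.var 2) (.lit m)) (.lit m))
          (.tab m (fun i => π i) (.mod (.var 2) (.lit m))))))
      (.div (.var 10) (.read 0 (.add (.add (.add (.lit 2) (.mul nE nE)) (.mul nE (.lit m)))
        (.add (.mul (.div (.var 2) (.lit m)) (.lit m))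
          (.tab m (fun i => π i) (.mod (.var 2) (.lit m))))))))

lemma wp_prelude {Λ Z : ℤ} {π : ℕ → ℕ} (hπ : ∀ i < m, π i < m) {Q : Store → Prop}
    (hΛ : ((I.n * m : ℕ) : ℤ) ≤ Λ) (hZ : 2 ^ (2 * I.logBound e) ≤ Z)
    (hQ : ∀ τ : Store, (∀ b, b ≠ 2 → b ≠ 10 → b ≠ 20 → τ b = initStore (I.encode e) b) →
      (∀ u < I.n, ∀ i < m, τ 20 ((u * m + i : ℕ) : ℤ) = I.intCost e u (π i)) → Q τ) :
    Cmd.wp Λ Z (prelude m π) Q (initStore (I.encode e)) := by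
  set σ := initStore (I.encode e) with hσ
  have hb : (2 : ℤ) ^ I.logBound e ≤ 2 ^ (2 * I.logBound e) :=
    pow_le_pow_right₀ (by norm_num) (by omega)
  have hb1 : (1 : ℤ) ≤ 2 ^ I.logBound e := one_le_pow₀ (by norm_num)
  have hn : σ 0 1 = I.n := I.input_n e
  refine Cmd.wp_seq (Cmd.wp_asg (by simp; linarith) ?_)
  refine Cmd.wp_seq (Cmd.wp_scan (by norm_num) (I.n * m) (I.denom e) (by simp [hn]) hΛ
    (by simp [Store.set_apply, denom]) ?_ ?_ ?_)
  · intro k hk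
    rw [abs_of_pos (I.denom_pos e _)]
    exact (I.denom_le e hk).trans (hb.trans hZ)
  · intro k hk τ hfr hx ha
    have h0 : τ 0 = σ 0 := by rw [hfr 0 (by norm_num) (by norm_num)]; simp
    have i2 : σ 0 (2 + I.n * I.n + I.n * m + k) = _ := I.input_den e hk
    simp only [Exp.val_mul, Exp.val_read, Exp.val_add, Exp.val_lit, h0, ha, hx, hn, i2]
    rw [denom, denom, prod_range_succ]
  · intro τ hfr ha
    have h0 : τ 0 = σ 0 := by rw [hfr 0 (by norm_num) (by norm_num)]; simp
    refine Cmd.wp_fill (by norm_num) (I.n * m)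
      (fun k => I.intCost e (k / m) (π (k % m))) (by simp [h0, hn]) hΛ ?_ ?_ ?_
    · intro k hk
      have hm : 0 < m := Nat.pos_of_ne_zero fun h => by simp [h] at hk
      exact (I.abs_intCost_le e (Nat.div_lt_of_lt_mul (by rwa [mul_comm]))
        (hπ _ (Nat.mod_lt _ hm))).trans hZ
    · intro k hk ρ hfr' hx
      have hm : 0 < m := Nat.pos_of_ne_zero fun h => by simp [h] at hk
      have h0' : ρ 0 = σ 0 := by rw [hfr' 0 (by norm_num) (by norm_num), h0]
      have ha' : ρ 10 0 = I.denom e (I.n * m) := by rw [hfr' 10 (by norm_num) (by norm_num), ha]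
      have hk' : k / m < I.n := Nat.div_lt_of_lt_mul (by rwa [mul_comm])
      have hkm := hπ _ (Nat.mod_lt k hm)
      have ht : (Exp.tab m (fun i => (π i : ℤ)) (.mod (.var 2) (.lit m))).val ρ =
          (π (k % m) : ℕ) := Exp.val_tab (Nat.mod_lt k hm) (by simp [hx])
      have hidx : k / m * m + π (k % m) < I.n * m := calc
        k / m * m + π (k % m) < k / m * m + m := by omega
        _ = (k / m + 1) * m := by ring
        _ ≤ _ := Nat.mul_le_mul_right _ hk'
      have e1 : (k / m * m + π (k % m)) / m = k / m := by
        rw [mul_comm, Nat.mul_add_div (by omega), Nat.div_eq_of_lt hkm, add_zero]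
      have e2 : (k / m * m + π (k % m)) % m = π (k % m) := by
        rw [mul_comm, Nat.mul_add_mod, Nat.mod_eq_of_lt hkm]
      have i1 : σ 0 (2 + I.n * I.n + (k / m * m + π (k % m) : ℕ)) = _ := I.input_num e hidx
      have i2 : σ 0 (2 + I.n * I.n + I.n * m + (k / m * m + π (k % m) : ℕ)) = _ :=
        I.input_den e hidx
      rw [e1, e2] at i1 i2
      push_cast at i1 i2
      simp only [Exp.val_mul, Exp.val_read, Exp.val_add, Exp.val_lit, Exp.val_div, h0', ha', hx,
        hn, ht, i1, i2, intCost]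
    · intro ρ hfr' hF _
      refine hQ ρ (fun b h1 h2 h3 => ?_) fun u hu i hi => ?_
      · rw [hfr' b h1 h3, hfr b h1 h2, Store.set_apply_of_ne _ h2]
      · have hk : u * m + i < I.n * m := calc
          u * m + i < u * m + m := by omega
          _ = (u + 1) * m := by ring
          _ ≤ _ := Nat.mul_le_mul_right _ hu
        have h1 : (u * m + i) / m = u := by
          rw [mul_comm, Nat.mul_add_div (by omega), Nat.div_eq_of_lt hi, add_zero]
        have h2 : (u * m + i) % m = i := by
          rw [mul_comm, Nat.mul_add_mod, Nat.mod_eq_of_lt hi]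
        have := hF _ hk
        rwa [h1, h2, zero_add] at this

end Instance

end MinHOM

/-! ### The maximum flow program -/

namespace Flow

open RAM Finset

variable {N : ℕ}

lemma Preflow.congr {cap r r' : ℕ → ℕ → ℤ} {e e' h h' : ℕ → ℤ} (hp : Preflow N cap r e h)
    (hr : ∀ x < N + 2, ∀ y < N + 2, r' x y = r x y) (he : ∀ x < N + 2, e' x = e x)
    (hh : ∀ x < N + 2, h' x = h x) : Preflow N cap r' e' h' where
  r_nonneg x hx y hy := by rw [hr x hx y hy]; exact hp.r_nonneg x hx y hy
  r_add x hx y hy := by rw [hr x hx y hy, hr y hy x hx]; exact hp.r_add x hx y hy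
  e_eq y hy hyN := by
    rw [he y hy, hp.e_eq y hy hyN]
    exact sum_congr rfl fun x hx => by rw [hr x (mem_range.1 hx) y hy]
  e_nonneg y hy hyN := by rw [he y hy]; exact hp.e_nonneg y hy hyN
  valid x hx y hy := by rw [hr x hx y hy, hh x hx, hh y hy]; exact hp.valid x hx y hy
  h_nonneg x hx := by rw [hh x hx]; exact hp.h_nonneg x hx
  h_le x hx := by rw [hh x hx]; exact hp.h_le x hx
  h_source := by rw [hh N (by omega)]; exact hp.h_source
  h_sink := by rw [hh (N + 1) (by omega)]; exact hp.h_sink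

lemma Progress.congr {h₀ e e' h h' : ℕ → ℤ} {b : ℤ} {u : ℕ} (hP : Progress N h₀ b u e h)
    (he : ∀ x < N, e' x = e x) (hh : ∀ x < N, h' x = h x) : Progress N h₀ b u e' h' := by
  have hs : ∑ x ∈ range N, h' x = ∑ x ∈ range N, h x :=
    sum_congr rfl fun x hx => hh x (mem_range.1 hx)
  rcases hP with hP | ⟨h1, h2⟩
  · exact .inl ⟨hP.1, by rw [hs]; exact hP.2⟩
  · exact .inr ⟨by rw [hs, h1], fun x hx => by rw [he x hx, hh x hx]; exact h2 x hx⟩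

/-- Residual capacities, excesses and labels are kept in the arrays `21`, `22` and `23`. -/
def resOf (N : ℕ) (τ : Store) (x y : ℕ) : ℤ := τ 21 ((x : ℤ) * (N + 2) + y)
def excOf (τ : Store) (x : ℕ) : ℤ := τ 22 x
def labOf (τ : Store) (x : ℕ) : ℤ := τ 23 x

lemma node_pair_inj {x y u v : ℕ} (hy : y < N + 2) (hv : v < N + 2) :
    (x : ℤ) * (N + 2) + y = u * (N + 2) + v ↔ x = u ∧ y = v := by
  constructor
  · intro h
    have h' : x * (N + 2) + y = u * (N + 2) + v := by exact_mod_cast h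
    have h1 : (x * (N + 2) + y) / (N + 2) = x := by
      rw [mul_comm, Nat.mul_add_div (by omega), Nat.div_eq_of_lt hy, add_zero]
    have h2 : (u * (N + 2) + v) / (N + 2) = u := by
      rw [mul_comm, Nat.mul_add_div (by omega), Nat.div_eq_of_lt hv, add_zero]
    have h3 : x = u := by rw [← h1, h', h2]
    subst h3
    exact ⟨rfl, by omega⟩
  · rintro ⟨rfl, rfl⟩; rfl

open Exp Cmd

/-- Index of the residual capacity of a pair of nodes. -/
def pairE (NE x y : Exp) : Exp := .add (.mul x (.add NE (.lit 2))) y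

/-- Push from the node in array `3` to the node in array `4`. -/
def pushCmd (NE : Exp) : Cmd :=
  .seq (.ite (.sub (.read 22 (.var 3)) (.read 21 (pairE NE (.var 3) (.var 4))))
      (.asg 15 (.lit 0) (.read 21 (pairE NE (.var 3) (.var 4))))
      (.asg 15 (.lit 0) (.read 22 (.var 3)))) <|
  .seq (.asg 22 (.var 3) (.sub (.read 22 (.var 3)) (.var 15))) <|
  .seq (.asg 22 (.var 4) (.add (.read 22 (.var 4)) (.var 15))) <|
  .seq (.asg 21 (pairE NE (.var 3) (.var 4))
      (.sub (.read 21 (pairE NE (.var 3) (.var 4))) (.var 15))) <|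
  .asg 21 (pairE NE (.var 4) (.var 3))
      (.add (.read 21 (pairE NE (.var 4) (.var 3))) (.var 15))

def tryPush (NE : Exp) : Cmd :=
  .ite (.read 22 (.var 3))
    (.ite (.read 21 (pairE NE (.var 3) (.var 4)))
      (.ite (.eq (.read 23 (.var 3)) (.add (.read 23 (.var 4)) (.lit 1))) (pushCmd NE) .skip)
      .skip) .skip

/-- A node whose label has reached `N + 2` is left alone: only a minimum cut is wanted, so its
excess need not be returned to the source. -/
def discharge (NE : Exp) : Cmd :=
  .ite (.sub (.add NE (.lit 2)) (.read 23 (.var 3)))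
    (.seq (.rep 4 (.add NE (.lit 2)) (tryPush NE))
      (.ite (.read 22 (.var 3)) (.asg 23 (.var 3) (.add (.read 23 (.var 3)) (.lit 1))) .skip))
    .skip

def sweep (NE : Exp) : Cmd := .rep 3 NE (discharge NE)

def sweeps (NE : Exp) : Cmd :=
  .rep 2 (.add (.add (.mul (.add NE (.lit 3)) (.mul NE (.add NE (.lit 2)))) (.add NE (.lit 2)))
    (.lit 1)) (sweep NE)

variable {cap : ℕ → ℕ → ℤ} {NE : Exp} {Λ Z : ℤ} {α : ℤ → ℤ}

/-- Bounds that make the computation safe. -/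
structure Safe (N : ℕ) (cap : ℕ → ℕ → ℤ) (Λ Z : ℤ) : Prop where
  res : ∀ x < N + 2, ∀ y < N + 2, cap x y + cap y x ≤ Z
  exc : ∀ y < N + 2, ∑ x ∈ range (N + 2), cap x y ≤ Z
  lab : (N : ℤ) + 2 ≤ Z
  loop : (numSweeps N : ℤ) ≤ Λ

lemma Safe.loop_node (hS : Safe N cap Λ Z) : (N : ℤ) + 2 ≤ Λ := by
  refine le_trans ?_ hS.loop
  have : (0 : ℤ) ≤ (N + 3) * (N * (N + 2)) := by positivity
  simp only [numSweeps]
  push_cast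
  linarith

lemma wp_pushCmd (hS : Safe N cap Λ Z) (hNE : ∀ τ : Store, τ 0 = α → NE.val τ = N) {τ : Store}
    (h0 : τ 0 = α) {u v : ℕ} (hu : u < N) (hv : v < N + 2) (h3 : τ 3 0 = u) (h4 : τ 4 0 = v)
    (hp : Preflow N cap (resOf N τ) (excOf τ) (labOf τ)) (he : 0 < excOf τ u)
    (hr : 0 < resOf N τ u v) (hh : labOf τ u = labOf τ v + 1) {Q : Store → Prop}
    (hQ : ∀ ρ : Store, ∀ d : ℤ, d = min (excOf τ u) (resOf N τ u v) → ρ 23 = τ 23 →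
      (∀ x < N + 2, ∀ y < N + 2, resOf N ρ x y = pushR (resOf N τ) u v d x y) →
      (∀ x, excOf ρ x = pushE (excOf τ) u v d x) → Q ρ) :
    wp Λ Z (pushCmd NE) Q τ := by
  have huv : u ≠ v := by rintro rfl; linarith
  have hvN : v ≠ N := by
    rintro rfl
    have h1 := hp.h_le u (by omega)
    have h2 := hp.h_source
    linarith
  set d := min (excOf τ u) (resOf N τ u v) with hd
  have hd0 : 0 ≤ d := le_min he.le hr.le
  have hp' := hp.push hu hv hh hd0 (min_le_left _ _) (min_le_right _ _)
  have hEu := hp.e_le (y := u) (by omega) (by omega)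
  have hZe := hS.exc u (by omega)
  have hdZ : |d| ≤ Z := by
    rw [abs_of_nonneg hd0]
    exact (min_le_left _ _).trans (hEu.trans hZe)
  -- The stores in the middle of a push are not preflows, but every number written is an entry of
  -- the final preflow, whose invariants bound it.
  have he' : ∀ y < N + 2, y ≠ N → |pushE (excOf τ) u v d y| ≤ Z := fun y hy hyN => by
    rw [abs_of_nonneg (hp'.e_nonneg y hy hyN)]
    exact (hp'.e_le hy hyN).trans (hS.exc y hy)
  have hr' : ∀ x < N + 2, ∀ y < N + 2, |pushR (resOf N τ) u v d x y| ≤ Z := fun x hx y hy => by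
    rw [abs_of_nonneg (hp'.r_nonneg x hx y hy)]
    exact (hp'.r_le hx hy).trans (hS.res x hx y hy)
  have eu := he' u (by omega) (by omega)
  have ev := he' v hv hvN
  have ruv := hr' u (by omega) v hv
  have rvu := hr' v hv u (by omega)
  simp only [pushE, pushR, if_true, huv, huv.symm, if_false, and_self]
    at eu ev ruv rvu
  have hcast : ((v : ℤ) = u) ↔ False := by simp [huv.symm]
  have hne := (node_pair_inj (x := v) (y := u) (u := u) (v := v) (N := N) (by omega) hv)
  have hval : ∀ ρ : Store, ρ 0 = α → NE.val ρ = N := hNE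
  have key : wp Λ Z (.seq (.asg 22 (.var 3) (.sub (.read 22 (.var 3)) (.var 15))) <|
      .seq (.asg 22 (.var 4) (.add (.read 22 (.var 4)) (.var 15))) <|
      .seq (.asg 21 (pairE NE (.var 3) (.var 4))
        (.sub (.read 21 (pairE NE (.var 3) (.var 4))) (.var 15))) <|
      .asg 21 (pairE NE (.var 4) (.var 3))
        (.add (.read 21 (pairE NE (.var 4) (.var 3))) (.var 15))) Q (τ.set 15 0 d) := by
    have n1 : ((v : ℤ) * (N + 2) + u = u * (N + 2) + v) = False := by
      simp [hne, huv.symm]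
    refine wp_seq (wp_asg ?_ (wp_seq (wp_asg ?_ (wp_seq (wp_asg ?_ (wp_asg ?_ ?_))))))
    · simpa [Store.set_apply, h3, excOf] using eu
    · simpa [Store.set_apply, h3, h4, hcast, excOf] using ev
    · simpa [Store.set_apply, h3, h4, hcast, pairE, hNE, h0, resOf] using ruv
    · simpa [Store.set_apply, h3, h4, hcast, pairE, hNE, h0, n1, resOf] using rvu
    · refine hQ _ d rfl ?_ ?_ ?_
      · simp
      · intro x hx y hy
        have i1 := node_pair_inj (x := x) (u := v) hy (show u < N + 2 by omega)
        have i2 := node_pair_inj (x := x) (u := u) hy hv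
        simp only [resOf, pushR, Exp.val_add, Exp.val_read, Exp.val_lit, Exp.val_sub, pairE,
          Exp.val_mul]
        simp [Store.set_apply, h3, h4, hcast, hNE, h0, n1, i1, i2]
        by_cases a1 : x = v ∧ y = u
        · obtain ⟨rfl, rfl⟩ := a1; simp [huv, huv.symm]
        by_cases a2 : x = u ∧ y = v
        · obtain ⟨rfl, rfl⟩ := a2; simp [huv]
        · simp [a1, a2]
      · intro x
        simp [Store.set_apply, h3, h4, hcast, excOf, pushE]
        by_cases a1 : x = v
        · subst a1; simp [huv.symm]
        · by_cases a2 : x = u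
          · subst a2; simp [huv]
          · simp [a1, a2]
  have v1 : (Exp.read 22 (.var 3)).val τ = excOf τ u := by simp [h3, excOf]
  have v2 : (Exp.read 21 (pairE NE (.var 3) (.var 4))).val τ = resOf N τ u v := by
    simp [h3, h4, pairE, hNE, h0, resOf]
  refine wp_seq ⟨fun hlt => wp_asg ?_ ?_, fun hlt => wp_asg ?_ ?_⟩ <;>
    rw [Exp.val_sub, v1, v2] at hlt
  · rw [v2, ← min_eq_right (show resOf N τ u v ≤ excOf τ u by linarith)]; exact hdZ
  · rw [v2, ← min_eq_right (show resOf N τ u v ≤ excOf τ u by linarith)]; exact key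
  · rw [v1, ← min_eq_left (show excOf τ u ≤ resOf N τ u v by linarith)]; exact hdZ
  · rw [v1, ← min_eq_left (show excOf τ u ≤ resOf N τ u v by linarith)]; exact key

/-- The hypothesis `hadm` is the invariant of the scan: while `u` has excess, none of the targets
already tried admits a push. Later pushes out of `u` do not increase any residual capacity out of
`u`, so it persists. -/
lemma wp_tryPush (hS : Safe N cap Λ Z) (hNE : ∀ τ : Store, τ 0 = α → NE.val τ = N) {τ : Store}
    (h0 : τ 0 = α) {u v : ℕ} (hu : u < N) (hv : v < N + 2) (h3 : τ 3 0 = u) (h4 : τ 4 0 = v)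
    (hlt : labOf τ u < N + 2) {h₀ : ℕ → ℤ} {b : ℤ}
    (hp : Preflow N cap (resOf N τ) (excOf τ) (labOf τ))
    (hP : Progress N h₀ b u (excOf τ) (labOf τ))
    (hadm : 0 < excOf τ u → ∀ y < v, 0 < resOf N τ u y → labOf τ u ≤ labOf τ y)
    {Q : Store → Prop}
    (hQ : ∀ ρ : Store, labOf ρ = labOf τ → Preflow N cap (resOf N ρ) (excOf ρ) (labOf τ) →
      Progress N h₀ b u (excOf ρ) (labOf τ) →
      (0 < excOf ρ u → ∀ y < v + 1, 0 < resOf N ρ u y → labOf τ u ≤ labOf τ y) → Q ρ) :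
    wp Λ Z (tryPush NE) Q τ := by
  have v1 : (Exp.read 22 (.var 3)).val τ = excOf τ u := by simp [h3, excOf]
  have v2 : (Exp.read 21 (pairE NE (.var 3) (.var 4))).val τ = resOf N τ u v := by
    simp [h3, h4, pairE, hNE, h0, resOf]
  have hskip : (0 < excOf τ u → 0 < resOf N τ u v → labOf τ u ≤ labOf τ v) → Q τ := by
    intro h
    refine hQ τ rfl hp hP fun he y hy hr => ?_
    rcases Nat.lt_succ_iff_lt_or_eq.1 hy with hy | rfl
    · exact hadm he y hy hr
    · exact h he hr
  unfold tryPush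
  refine ⟨fun he => ⟨fun hr => ⟨fun hh => ?_, fun hh => ?_⟩, fun hr => ?_⟩, fun he => ?_⟩
  · rw [v1] at he
    rw [v2] at hr
    have hh : labOf τ u = labOf τ v + 1 := by
      by_contra hne
      simp only [labOf] at hne
      simp [h3, h4, hne] at hh
    have huv : u ≠ v := by rintro rfl; linarith
    refine wp_pushCmd hS hNE h0 hu hv h3 h4 hp he hr hh fun ρ d hd hlab hres hexc => ?_
    have hlab' : labOf ρ = labOf τ := by funext x; simp [labOf, hlab]
    have hd0 : 0 ≤ d := hd ▸ le_min he.le hr.le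
    have hde : d ≤ excOf τ u := hd ▸ min_le_left _ _
    have hdr : d ≤ resOf N τ u v := hd ▸ min_le_right _ _
    refine hQ ρ hlab' ((hp.push hu hv hh hd0 hde hdr).congr hres (fun x _ => hexc x)
      fun _ _ => rfl) ((hP.push hu hlt he hh d).congr (fun x _ => hexc x) fun _ _ => rfl) ?_
    intro he' y hy hr'
    rw [hexc, pushE, if_pos rfl] at he'
    rw [hres u (by omega) y (by omega), pushR] at hr'
    rcases Nat.lt_succ_iff_lt_or_eq.1 hy with hy | rfl
    · rw [if_neg (by omega), if_neg (by omega)] at hr'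
      exact hadm he y hy hr'
    -- The amount pushed is the minimum of excess and residual capacity, so these cannot both remain
    -- positive.
    · rw [if_pos ⟨rfl, rfl⟩] at hr'
      rcases min_choice (excOf τ u) (resOf N τ u y) with h | h <;> rw [h] at hd <;> omega
  · refine hskip fun he hr => ?_
    have h1 := hp.valid u (by omega) v hv hr
    have hne : labOf τ u ≠ labOf τ v + 1 := by
      intro h
      apply hh
      simp only [labOf] at h
      simp [h3, h4, h]
    omega
  · rw [v2] at hr
    exact hskip fun _ h => absurd h hr
  · rw [v1] at he
    exact hskip fun h => absurd h he

/-- If `u` still has excess after all targets have been tried, no residual arc leads downwards from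
it, which is exactly the condition for a unit relabel. -/
lemma wp_discharge (hS : Safe N cap Λ Z) (hNE : ∀ τ : Store, τ 0 = α → NE.val τ = N) {τ : Store}
    (h0 : τ 0 = α) {u : ℕ} (hu : u < N) (h3 : τ 3 0 = u) {h₀ : ℕ → ℤ} {b : ℤ}
    (hp : Preflow N cap (resOf N τ) (excOf τ) (labOf τ))
    (hP : Progress N h₀ b u (excOf τ) (labOf τ)) {Q : Store → Prop}
    (hQ : ∀ ρ : Store, Preflow N cap (resOf N ρ) (excOf ρ) (labOf ρ) →
      Progress N h₀ b (u + 1) (excOf ρ) (labOf ρ) → Q ρ) :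
    wp Λ Z (discharge NE) Q τ := by
  unfold discharge
  have vl : (Exp.sub (.add NE (.lit 2)) (.read 23 (.var 3))).val τ = N + 2 - labOf τ u := by
    simp [h3, labOf, hNE, h0]
  refine ⟨fun hlt => ?_, fun hlt => ?_⟩
  · rw [vl] at hlt
    refine wp_seq (wp_rep (N + 2) (by simp [hNE, h0]) (by exact_mod_cast hS.loop_node)
      (fun k ρ => Preflow N cap (resOf N ρ) (excOf ρ) (labOf ρ) ∧
        Progress N h₀ b u (excOf ρ) (labOf ρ) ∧
        (0 < excOf ρ u → ∀ y < k, 0 < resOf N ρ u y → labOf ρ u ≤ labOf ρ y)) ?_ ?_ ?_)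
    · exact ⟨hp, hP, fun _ y hy => absurd hy (by omega)⟩
    · rintro k ρ hk h4 hfr ⟨i1, i2, i3⟩
      have f0 : ρ 0 = α := by rw [hfr 0 rfl, h0]
      have f3 : ρ 3 0 = u := by rw [hfr 3 rfl, h3]
      have f23 : labOf ρ u = labOf τ u := by simp only [labOf, hfr 23 rfl]
      refine wp_tryPush hS hNE f0 hu hk f3 h4 (by rw [f23]; linarith) i1 i2 i3 ?_
      intro π hl j1 j2 j3
      change Preflow N cap (resOf N π) (excOf π) (labOf π) ∧
        Progress N h₀ b u (excOf π) (labOf π) ∧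
        (0 < excOf π u → ∀ y < k + 1, 0 < resOf N π u y → labOf π u ≤ labOf π y)
      rw [hl]
      exact ⟨j1, j2, j3⟩
    · rintro ρ hfr ⟨i1, i2, i3⟩
      have f0 : ρ 0 = α := by rw [hfr 0 rfl, h0]
      have f3 : ρ 3 0 = u := by rw [hfr 3 rfl, h3]
      have f23 : labOf ρ u = labOf τ u := by simp only [labOf, hfr 23 rfl]
      have ve : (Exp.read 22 (.var 3)).val ρ = excOf ρ u := by simp [f3, excOf]
      have vh : (Exp.add (.read 23 (.var 3)) (.lit 1)).val ρ = labOf ρ u + 1 := by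
        simp [f3, labOf]
      refine ⟨fun he => ?_, fun he => ?_⟩
      · rw [ve] at he
        have hnn := i1.h_nonneg u (by omega)
        refine wp_asg ?_ ?_
        · rw [vh, abs_of_nonneg (by omega)]
          have := hS.lab
          omega
        · have hl : labOf (ρ.set 23 ((Exp.var 3).val ρ) ((Exp.add (.read 23 (.var 3))
              (.lit 1)).val ρ)) = Function.update (labOf ρ) u (labOf ρ u + 1) := by
            funext x
            simp [labOf, Store.set_apply, f3, Function.update_apply]
          have hlt' : labOf ρ u < N + 2 := by omega
          refine hQ _ ?_ ?_
          · rw [hl]; exact i1.relabel hu hlt' (i3 he)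
          · rw [hl]; exact i2.relabel hu hlt' he hnn
      · rw [ve] at he
        exact hQ ρ i1 (i2.skip fun h => he h.1)
  · rw [vl] at hlt
    exact hQ τ hp (hP.skip fun h => by omega)

lemma wp_sweeps (hS : Safe N cap Λ Z) (hNE : ∀ τ : Store, τ 0 = α → NE.val τ = N) {τ : Store}
    (h0 : τ 0 = α) (hp : Preflow N cap (resOf N τ) (excOf τ) (labOf τ)) {Q : Store → Prop}
    (hQ : ∀ ρ : Store, (∀ b, (sweeps NE).keeps b → ρ b = τ b) →
      Preflow N cap (resOf N ρ) (excOf ρ) (labOf ρ) →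
      (∀ x < N, labOf ρ x < N + 2 → excOf ρ x ≤ 0) → Q ρ) :
    wp Λ Z (sweeps NE) Q τ := by
  refine wp_rep (numSweeps N) (by simp [hNE, h0, numSweeps]) hS.loop
    (fun k ρ => Preflow N cap (resOf N ρ) (excOf ρ) (labOf ρ) ∧
      Sweeps N k (excOf ρ) (labOf ρ)) ?_ ?_ ?_
  · exact ⟨hp, sweeps_zero fun x hx => hp.h_nonneg x (by omega)⟩
  · rintro k ρ hk h2 hfr ⟨i1, i2⟩
    have f0 : ρ 0 = α := by rw [hfr 0 rfl, h0]
    obtain ⟨b, hstart, hend⟩ := i2.start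
    refine wp_rep N (by simp [hNE, f0]) (by have := hS.loop_node; omega)
      (fun k π => Preflow N cap (resOf N π) (excOf π) (labOf π) ∧
        Progress N (labOf ρ) b k (excOf π) (labOf π)) ⟨i1, hstart⟩ ?_ ?_
    · rintro u π hu h3 hfr' ⟨j1, j2⟩
      have g0 : π 0 = α := by rw [hfr' 0 rfl, f0]
      exact wp_discharge hS hNE g0 hu h3 j1 j2 fun _ l1 l2 => ⟨l1, l2⟩
    · rintro π hfr' ⟨j1, j2⟩
      exact ⟨j1, hend _ _ j2 fun x hx => j1.h_nonneg x (by omega)⟩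
  · rintro ρ hfr ⟨i1, i2⟩
    exact hQ ρ hfr i1 (i2.not_active (fun x hx => i1.h_nonneg x (by omega))
      fun x hx => i1.h_le x (by omega))

/-- Find a number that is not a label. -/
def findGap (NE : Exp) : Cmd :=
  .rep 2 (.add NE (.lit 2)) <|
    .seq (.asg 14 (.lit 0) (.lit 0)) <|
    .seq (.scan 3 14 (.add NE (.lit 2)) (.add (.var 14) (.eq (.read 23 (.var 3)) (.var 2)))) <|
    .ite (.isZero (.var 14)) (.asg 13 (.lit 0) (.var 2)) .skip

lemma wp_findGap (hS : Safe N cap Λ Z) (hNE : ∀ τ : Store, τ 0 = α → NE.val τ = N) {τ : Store}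
    (h0 : τ 0 = α) {r : ℕ → ℕ → ℤ} {e : ℕ → ℤ} (hp : Preflow N cap r e (labOf τ))
    {Q : Store → Prop}
    (hQ : ∀ ρ : Store, (∀ b, (findGap NE).keeps b → ρ b = τ b) → ∀ g : ℕ, 0 < g → g < N + 2 →
      (∀ x < N + 2, labOf τ x ≠ g) → ρ 13 0 = g → Q ρ) :
    wp Λ Z (findGap NE) Q τ := by
  obtain ⟨g₀, hg1, hg2, hg3⟩ := hp.exists_gap
  have hZ := hS.lab
  -- The invariant only claims that some gap is recorded once the known gap `g₀` has been passed,
  -- since a later gap overwrites an earlier one.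
  refine wp_rep (N + 2) (by simp [hNE, h0]) (by exact_mod_cast hS.loop_node)
    (fun k ρ => g₀ < k → ∃ g : ℕ, 0 < g ∧ g < N + 2 ∧ (∀ x < N + 2, labOf τ x ≠ g) ∧
      ρ 13 0 = g) ?_ ?_ ?_
  · exact fun h => absurd h (by omega)
  · intro k ρ hk h2 hfr hI
    have f0 : ρ 0 = α := by rw [hfr 0 rfl, h0]
    have f23 : ∀ x : ℕ, ρ 23 x = labOf τ x := fun x => by simp only [labOf, hfr 23 rfl]
    refine wp_seq (wp_asg (by simp; omega) (wp_seq (wp_scan (by norm_num) (N + 2)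
      (fun j => ∑ x ∈ range j, if labOf τ x = k then 1 else 0) (by simp [hNE, f0])
      (by exact_mod_cast hS.loop_node) (by simp [Store.set_apply]) ?_ ?_ ?_)))
    · intro j hj
      have h1 : (0 : ℤ) ≤ ∑ x ∈ range (j + 1), if labOf τ x = k then 1 else 0 :=
        sum_nonneg fun x _ => by split_ifs <;> simp
      have h2 : ∑ x ∈ range (j + 1), (if labOf τ x = k then 1 else 0 : ℤ) ≤
          ∑ x ∈ range (j + 1), 1 := sum_le_sum fun x _ => by split_ifs <;> simp
      rw [abs_of_nonneg h1]
      rw [sum_const, card_range, nsmul_one] at h2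
      push_cast at h2
      omega
    · intro j hj π hfr' h3 hs
      have g23 : π 23 j = labOf τ j := by
        rw [hfr' 23 (by norm_num) (by norm_num), Store.set_apply_of_ne _ (by norm_num), f23]
      have g2 : π 2 0 = k := by
        rw [hfr' 2 (by norm_num) (by norm_num), Store.set_apply_of_ne _ (by norm_num), h2]
      simp only [Exp.val_add, Exp.val_read, Exp.val_lit, Exp.val_eq, h3, hs, g23, g2,
        sum_range_succ]
    · intro π hfr' hs
      have g2 : π 2 0 = k := by
        rw [hfr' 2 (by norm_num) (by norm_num), Store.set_apply_of_ne _ (by norm_num), h2]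
      have hzero : π 14 0 = 0 ↔ ∀ x < N + 2, labOf τ x ≠ k := by
        rw [hs, sum_eq_zero_iff_of_nonneg fun x _ => by split_ifs <;> simp]
        simp
      refine ⟨fun hz => wp_asg ?_ fun _ => ?_, fun hz hgk => ?_⟩
      · simp [g2]; omega
      · have hz' : π 14 0 = 0 := by
          by_contra h
          simp [h] at hz
        refine ⟨k, Nat.pos_of_ne_zero ?_, hk, hzero.1 hz', ?_⟩
        -- The value `0` is never a gap, as it is the label of the sink.
        · rintro rfl
          exact hzero.1 hz' (N + 1) (by omega) (by exact_mod_cast hp.h_sink)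
        · simp [Store.set_apply, g2]
      · have hz' : π 14 0 ≠ 0 := by
          intro h
          simp [h] at hz
        have hne : g₀ ≠ k := by
          rintro rfl
          exact hz' (hzero.2 hg3)
        obtain ⟨g, a1, a2, a3, a4⟩ := hI (by omega)
        refine ⟨g, a1, a2, a3, ?_⟩
        rw [Store.set_apply_of_ne _ (by norm_num), hfr' 13 (by norm_num) (by norm_num),
          Store.set_apply_of_ne _ (by norm_num), a4]
  · intro ρ hfr hI
    obtain ⟨g, a1, a2, a3, a4⟩ := hI hg2
    exact hQ ρ hfr g a1 a2 a3 a4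

end Flow

/-! ### Minimum cost homomorphisms by minimum cuts -/

namespace MinHOM

open RAM Finset Flow

namespace Instance

variable {V : Type*} {m : ℕ} (e : V ≃ Fin m) (I : Instance V)

lemma sum_intCost (f : Fin I.n → V) (g : ℕ → ℕ) (hg : ∀ u : Fin I.n, g u = e (f u)) :
    ((∑ u ∈ range I.n, I.intCost e u (g u) : ℤ) : ℚ) = I.totalCost f * I.denom e (I.n * m) := by
  rw [totalCost, sum_mul, ← Fin.sum_univ_eq_sum_range (fun u => I.intCost e u (g u))]
  push_cast
  refine sum_congr rfl fun u _ => ?_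
  rw [hg u, I.intCost_eq e u.2 (e (f u)).2, costAt, dif_pos ⟨u.2, (e (f u)).2⟩]
  simp

lemma totalCost_le_of_sum_le {f f' : Fin I.n → V} {g g' : ℕ → ℕ} (hg : ∀ u : Fin I.n, g u = e (f u))
    (hg' : ∀ u : Fin I.n, g' u = e (f' u))
    (h : ∑ u ∈ range I.n, I.intCost e u (g u) ≤ ∑ u ∈ range I.n, I.intCost e u (g' u)) :
    I.totalCost f ≤ I.totalCost f' := by
  have h1 : ((∑ u ∈ range I.n, I.intCost e u (g u) : ℤ) : ℚ) ≤
      ((∑ u ∈ range I.n, I.intCost e u (g' u) : ℤ) : ℚ) := by exact_mod_cast h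
  rw [I.sum_intCost e f g hg, I.sum_intCost e f' g' hg'] at h1
  exact le_of_mul_le_mul_right h1 (by exact_mod_cast I.denom_pos e _)

lemma hasOutput_cons {τ : Store} {n : ℕ} {g : Fin n → ℤ} (h0 : τ 1 0 = n + 1) (h1 : τ 1 1 = 1)
    (h : ∀ k : Fin n, τ 1 (2 + (k : ℕ)) = g k) : HasOutput τ (1 :: List.ofFn g) := by
  refine ⟨by simp [h0], fun k => ?_⟩
  obtain ⟨k, hk⟩ := k
  rcases k with _ | k
  · simpa using h1
  · have hk' : k < n := by simpa using hk
    have := h ⟨k, hk'⟩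
    simp only [List.get_eq_getElem, List.getElem_cons_succ, List.getElem_ofFn]
    rw [← this]
    push_cast
    ring_nf

end Instance

/-! ### From instances with a min-max ordering to network data -/

section

variable {V : Type*} {m : ℕ} {H : Digraph V}

/-- The arcs of `H` in terms of the numbers of the vertices. -/
def rel (H : Digraph V) (ρ : V ≃ Fin m) (a b : ℕ) : Prop :=
  ∃ (ha : a < m) (hb : b < m), H.Adj (ρ.symm ⟨a, ha⟩) (ρ.symm ⟨b, hb⟩)

/-- Translation from one numbering to another one. -/
def trans (e ρ : V ≃ Fin m) (i : ℕ) : ℕ := if h : i < m then e (ρ.symm ⟨i, h⟩) else 0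

lemma trans_lt (e ρ : V ≃ Fin m) {i : ℕ} (hi : i < m) : trans e ρ i < m := by
  rw [trans, dif_pos hi]; exact Fin.is_lt _

/-- The network data of an instance. -/
noncomputable def dataOf {ρ : V ≃ Fin m} (hρ : IsMinMax H ρ) (e : V ≃ Fin m) (I : Instance V) :
    Data where
  m := m
  E := rel H ρ
  cross a b a' b' := by
    rintro ⟨ha, hb, h⟩ ⟨ha', hb', h'⟩ h1 h2
    have := hρ _ _ _ _ h h' (by simpa using h1) (by simpa using h2)
    exact ⟨⟨ha, hb', this.1⟩, ⟨ha', hb, this.2⟩⟩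
  n := I.n
  A := I.arc
  A_lt _ _ h := ⟨h.1, h.2.1⟩
  C u i := I.intCost e u (trans e ρ i)
  -- The square of an integer is at least its absolute value, so this sum bounds all costs without
  -- computing a maximum or absolute values.
  L := 1 + ∑ k ∈ range (I.n * m), I.intCost e (k / m) (trans e ρ (k % m)) ^ 2
  M := 2 * I.n * (1 + ∑ k ∈ range (I.n * m), I.intCost e (k / m) (trans e ρ (k % m)) ^ 2) + 1
  abs_C_le u hu i hi := by
    have hk : u * m + i < I.n * m := calc
      u * m + i < u * m + m := by omega
      _ = (u + 1) * m := by ring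
      _ ≤ _ := Nat.mul_le_mul_right _ hu
    have h1 : (u * m + i) / m = u := by
      rw [mul_comm, Nat.mul_add_div (by omega), Nat.div_eq_of_lt hi, add_zero]
    have h2 : (u * m + i) % m = i := by rw [mul_comm, Nat.mul_add_mod, Nat.mod_eq_of_lt hi]
    have h3 := single_le_sum (f := fun k => I.intCost e (k / m) (trans e ρ (k % m)) ^ 2)
      (fun k _ => sq_nonneg _) (mem_range.2 hk)
    simp only [h1, h2] at h3
    have h4 : |I.intCost e u (trans e ρ i)| ≤ I.intCost e u (trans e ρ i) ^ 2 := by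
      rw [← sq_abs]
      have := abs_nonneg (I.intCost e u (trans e ρ i))
      nlinarith
    linarith
  L_nonneg := add_nonneg zero_le_one (sum_nonneg fun _ _ => sq_nonneg _)
  M_gt := by linarith

variable {ρ : V ≃ Fin m} (hρ : IsMinMax H ρ) (e : V ≃ Fin m) (I : Instance V)

lemma correct_of_isHom {f : ℕ → ℕ} (hf : (dataOf hρ e I).IsHom f)
    (hmin : ∀ g, (dataOf hρ e I).IsHom g → ∑ u ∈ range I.n, (dataOf hρ e I).C u (f u) ≤
      ∑ u ∈ range I.n, (dataOf hρ e I).C u (g u)) :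
    I.Correct H e (1 :: List.ofFn fun u : Fin I.n => (trans e ρ (f u) : ℤ)) := by
  have hlt : ∀ u : Fin I.n, f u < m := fun u => hf.1 u u.2
  have htr : ∀ u : Fin I.n, trans e ρ (f u) = e (ρ.symm ⟨f u, hlt u⟩) := fun u => by
    rw [trans, dif_pos]
  refine .inr ⟨fun u => ρ.symm ⟨f u, hlt u⟩, ⟨fun u v huv => ?_, fun g hg => ?_⟩, ?_⟩
  · obtain ⟨_, _, h⟩ := hf.2 u v ⟨u.2, v.2, huv⟩
    exact h
  · set g' : ℕ → ℕ := fun u => if h : u < I.n then ρ (g ⟨u, h⟩) else 0 with hg'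
    have hgu : ∀ u : Fin I.n, g' u = ρ (g u) := fun u => by simp [hg']
    refine I.totalCost_le_of_sum_le e (g := fun u => trans e ρ (f u))
      (g' := fun u => trans e ρ (g' u)) htr (fun u => ?_) (hmin g' ⟨fun u hu => ?_, ?_⟩)
    · rw [hgu, trans, dif_pos (Fin.is_lt _)]; simp
    · have := hgu ⟨u, hu⟩
      simp only at this
      rw [this]; exact Fin.is_lt _
    · rintro u v ⟨hu, hv, huv⟩
      have h1 := hgu ⟨u, hu⟩
      have h2 := hgu ⟨v, hv⟩
      simp only at h1 h2
      rw [h1, h2]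
      exact ⟨Fin.is_lt _, Fin.is_lt _, by simpa using hg _ _ huv⟩
  · simp only [htr]

lemma correct_of_not_isHom (h : ¬ ∃ f, (dataOf hρ e I).IsHom f) : I.Correct H e [0] := by
  refine .inl ⟨rfl, ?_⟩
  rintro ⟨g, hg⟩
  refine h ⟨fun u => if h : u < I.n then ρ (g ⟨u, h⟩) else 0, fun u hu => ?_, ?_⟩
  · change u < I.n at hu
    beta_reduce
    rw [dif_pos hu]; exact Fin.is_lt _
  · rintro u v ⟨hu, hv, huv⟩
    beta_reduce
    rw [dif_pos hu, dif_pos hv]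
    exact ⟨Fin.is_lt _, Fin.is_lt _, by simpa using hg _ _ huv⟩

/-! Bounds -/

lemma dataOf_N_le : (dataOf hρ e I).N ≤ inputSize (I.encode e) := by
  refine le_trans ?_ (I.sq_le_inputSize e)
  change I.n * (m + 1) ≤ _
  nlinarith [Nat.le_mul_self I.n]

lemma natCast_le_pow {k b : ℕ} (h : k ≤ b) : (k : ℤ) ≤ 2 ^ b := by
  exact_mod_cast h.trans Nat.lt_two_pow_self.le

lemma two_le_pow_logBound : (2 : ℤ) ≤ 2 ^ I.logBound e := by
  calc (2 : ℤ) = 2 ^ 1 := by norm_num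
    _ ≤ _ := pow_le_pow_right₀ (by norm_num) (I.logBound_pos e)

/-- With `B = 2 ^ logBound`, an integral cost is at most `B ^ 2`, so its square is at most `B ^ 4`.
There are at most `B` terms, and `1 + B ^ 5 ≤ B ^ 6`. Partial sums are included because the program
stores them. -/
lemma dataOf_partial_L_le {k : ℕ} (hk : k ≤ I.n * m) :
    1 + ∑ j ∈ range k, I.intCost e (j / m) (trans e ρ (j % m)) ^ 2 ≤
      (2 ^ I.logBound e) ^ 6 := by
  set B : ℤ := 2 ^ I.logBound e with hB
  have hB2 : 2 ≤ B := two_le_pow_logBound e I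
  have h1 : ∑ j ∈ range k, I.intCost e (j / m) (trans e ρ (j % m)) ^ 2 ≤
      ∑ j ∈ range k, B ^ 4 := by
    refine sum_le_sum fun j hj => ?_
    have hj := mem_range.1 hj
    have hm : 0 < m := Nat.pos_of_ne_zero fun h => by simp [h] at hk; omega
    have := I.abs_intCost_le e (u := j / m) (i := trans e ρ (j % m))
      (Nat.div_lt_of_lt_mul (by rw [mul_comm]; omega)) (trans_lt e ρ (Nat.mod_lt _ hm))
    rw [← sq_abs]
    calc |I.intCost e (j / m) (trans e ρ (j % m))| ^ 2 ≤ (2 ^ (2 * I.logBound e)) ^ 2 :=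
          pow_le_pow_left₀ (abs_nonneg _) this 2
      _ = B ^ 4 := by rw [hB]; ring
  rw [sum_const, card_range, nsmul_eq_mul] at h1
  have h2 : (k : ℤ) ≤ B := natCast_le_pow (by
    have := I.sq_le_inputSize e
    have := I.le_logBound e
    omega)
  have h3 : (k : ℤ) * B ^ 4 ≤ B * B ^ 4 := mul_le_mul_of_nonneg_right h2 (by positivity)
  have h4 : 1 ≤ B ^ 5 := one_le_pow₀ (by linarith)
  have h5 : B ^ 5 * 2 ≤ B ^ 5 * B := mul_le_mul_of_nonneg_left hB2 (by positivity)
  nlinarith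

lemma dataOf_L_le : (dataOf hρ e I).L ≤ (2 ^ I.logBound e) ^ 6 :=
  dataOf_partial_L_le e I le_rfl

lemma dataOf_M_le : (dataOf hρ e I).M ≤ (2 ^ I.logBound e) ^ 9 := by
  have hL := dataOf_L_le hρ e I
  have hL0 := (dataOf hρ e I).L_nonneg
  change 2 * (I.n : ℤ) * (dataOf hρ e I).L + 1 ≤ _
  have hn : (I.n : ℤ) ≤ 2 ^ I.logBound e := natCast_le_pow (by
    have := I.n_le_inputSize e
    have := I.le_logBound e
    omega)
  have hB2 := two_le_pow_logBound e I
  set B : ℤ := 2 ^ I.logBound e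
  have h1 : 2 * (I.n : ℤ) * (dataOf hρ e I).L ≤ B * B * B ^ 6 :=
    mul_le_mul (mul_le_mul hB2 hn (by positivity) (by positivity)) hL hL0 (by positivity)
  have h4 : 1 ≤ B ^ 8 := one_le_pow₀ (by linarith)
  have h5 : B ^ 8 * 2 ≤ B ^ 8 * B := mul_le_mul_of_nonneg_left hB2 (by positivity)
  nlinarith

lemma dataOf_cap_bound : 5 * (dataOf hρ e I).M + 2 * (dataOf hρ e I).L ≤
    (2 ^ I.logBound e) ^ 12 := by
  have hL := dataOf_L_le hρ e I
  have hM := dataOf_M_le hρ e I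
  have hB2 := two_le_pow_logBound e I
  set B : ℤ := 2 ^ I.logBound e
  have h1 : B ^ 6 ≤ B ^ 9 := pow_le_pow_right₀ (by linarith) (by norm_num)
  -- The sum is at most `7 * B ^ 9`, and `7 ≤ 2 ^ 3 ≤ B ^ 3`.
  have h2 : (2 : ℤ) ^ 3 ≤ B ^ 3 := pow_le_pow_left₀ (by norm_num) hB2 3
  have h3 : B ^ 9 * 2 ^ 3 ≤ B ^ 9 * B ^ 3 := mul_le_mul_of_nonneg_left h2 (by positivity)
  have h4 : 0 ≤ B ^ 9 := by positivity
  have h5 : B ^ 12 = B ^ 9 * B ^ 3 := by ring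
  linarith

lemma dataOf_safe {Λ Z : ℤ} (hΛ : ((inputSize (I.encode e) + 3 : ℕ) : ℤ) ^ 3 ≤ Λ)
    (hZ : (2 ^ I.logBound e) ^ 13 ≤ Z) :
    Safe (dataOf hρ e I).N (dataOf hρ e I).cap Λ Z := by
  have hN := dataOf_N_le hρ e I
  have hcap := dataOf_cap_bound hρ e I
  have hN2 : (((dataOf hρ e I).N + 2 : ℕ) : ℤ) ≤ 2 ^ I.logBound e := by
    -- The encoding always contains the number of vertices, so its size is positive.
    rcases Nat.eq_zero_or_pos (inputSize (I.encode e)) with h | h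
    · have := length_le_inputSize (I.encode e)
      rw [h] at this
      simp [Instance.encode] at this
    · have h2 : inputSize (I.encode e) + 2 ≤ I.logBound e := by
        have := Nat.pow_le_pow_left (show inputSize (I.encode e) + 1 ≤
          inputSize (I.encode e) + m + 1 by omega) 2
        unfold Instance.logBound
        nlinarith
      exact natCast_le_pow (by omega)
  have hB2 := two_le_pow_logBound e I
  set B : ℤ := 2 ^ I.logBound e
  have h12 : 0 ≤ B ^ 12 := by positivity
  have h13 : B ^ 13 = B * B ^ 12 := by ring
  refine ⟨fun x _ y _ => ?_, fun y _ => ?_, ?_, ?_⟩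
  · have h1 := (dataOf hρ e I).cap_le x y
    have h2 := (dataOf hρ e I).cap_le y x
    nlinarith
  · have : ∑ x ∈ range ((dataOf hρ e I).N + 2), (dataOf hρ e I).cap x y ≤
        ∑ x ∈ range ((dataOf hρ e I).N + 2), B ^ 12 :=
      sum_le_sum fun x _ => ((dataOf hρ e I).cap_le x y).trans hcap
    rw [sum_const, card_range, nsmul_eq_mul] at this
    nlinarith
  · push_cast at hN2
    have : 1 ≤ B ^ 12 := one_le_pow₀ (by linarith)
    nlinarith
  · refine le_trans ?_ hΛ
    have : numSweeps (dataOf hρ e I).N ≤ (inputSize (I.encode e) + 3) ^ 3 := by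
      refine le_trans ?_ (Nat.pow_le_pow_left (Nat.add_le_add_right hN 3) 3)
      simp only [numSweeps]
      ring_nf
      nlinarith
    exact_mod_cast this

end

end MinHOM

namespace MinHOM

open RAM Finset Flow Exp Cmd Instance

section

variable {V : Type*} {m : ℕ} {H : Digraph V}

/-! ### The program that builds the network -/

/-- Number of nodes other than source and sink. -/
def nodesE (m : ℕ) : Exp := .mul nE (.lit ((m + 1 : ℕ) : ℤ))

def arcE (u v : Exp) : Exp := .read 0 (.add (.lit 2) (.add (.mul u nE) v))

/-- Table lookup for a relation on `{0, …, m}`. -/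
noncomputable def relE (m : ℕ) (P : ℕ → ℕ → Prop) (i j : Exp) : Exp :=
  .tab ((m + 1) * (m + 1)) (fun k => ind (P (k / (m + 1)) (k % (m + 1))))
    (.add (.mul i (.lit ((m + 1 : ℕ) : ℤ))) j)

def vertexE (m : ℕ) (x : Exp) : Exp := .div x (.lit ((m + 1 : ℕ) : ℤ))
def levelE (m : ℕ) (x : Exp) : Exp := .mod x (.lit ((m + 1 : ℕ) : ℤ))

/-- The threshold implications depend only on `H`, so they enter the program as constant tables.
Arrays `24` and `25` hold the indicators of having an out-neighbour and an in-neighbour. -/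
noncomputable def countE (m : ℕ) (E : ℕ → ℕ → Prop) (x y : Exp) : Exp :=
  .add (.add
    (.mul (arcE (vertexE m x) (vertexE m y))
      (relE m (fun i j => ∀ a b, E a b → i ≤ a → j ≤ b) (levelE m x) (levelE m y)))
    (.mul (arcE (vertexE m y) (vertexE m x))
      (relE m (fun i j => ∀ a b, E a b → i ≤ b → j ≤ a) (levelE m x) (levelE m y))))
    (.mul (.eq (vertexE m x) (vertexE m y))
      (.add (.add (relE m (fun i j => j ≤ i) (levelE m x) (levelE m y))
        (.mul (.read 24 (vertexE m x))
          (relE m (fun i j => ∀ a b, E a b → i ≤ a → j ≤ a) (levelE m x) (levelE m y))))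
        (.mul (.read 25 (vertexE m x))
          (relE m (fun i j => ∀ a b, E a b → i ≤ b → j ≤ b) (levelE m x) (levelE m y)))))

noncomputable def innerE (m : ℕ) (E : ℕ → ℕ → Prop) (x y : Exp) : Exp :=
  .add (.mul (.var 12) (countE m E x y))
    (.mul (.mul (.eq y (.add x (.lit 1))) (.sub (.lit 1) (.eq (levelE m x) (.lit m))))
      (.add (.read 20 (.add (.mul (vertexE m x) (.lit m)) (levelE m x))) (.var 11)))

/-- `1` for nodes other than source and sink. -/
def isInnerE (m : ℕ) (x : Exp) : Exp :=
  .sub (.sub (.lit 1) (.eq x (nodesE m))) (.eq x (.add (nodesE m) (.lit 1)))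

noncomputable def resE (m : ℕ) (E : ℕ → ℕ → Prop) (x y : Exp) : Exp :=
  .add (.add (.mul (.mul (isInnerE m x) (isInnerE m y)) (innerE m E x y))
    (.mul (.mul (.eq y (nodesE m)) (isInnerE m x)) (.mul (.isZero (levelE m x)) (.var 12))))
    (.mul (.mul (.eq y (.add (nodesE m) (.lit 1))) (isInnerE m x))
      (.mul (.eq (levelE m x) (.lit m)) (.var 12)))

variable {ρ : V ≃ Fin m} (hρ : IsMinMax H ρ) (e : V ≃ Fin m) (I : Instance V)

/-- The store holds what is needed to compute the capacities. -/
structure Ready (τ : Store) : Prop where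
  inp : τ 0 = initStore (I.encode e) 0
  cost : ∀ u < I.n, ∀ i < m, τ 20 ((u : ℤ) * m + i) = (dataOf hρ e I).C u i
  bigL : τ 11 0 = (dataOf hρ e I).L
  bigM : τ 12 0 = (dataOf hρ e I).M
  out : ∀ u < I.n, τ 24 u = ind (∃ w, I.arc u w)
  inn : ∀ u < I.n, τ 25 u = ind (∃ w, I.arc w u)

variable {hρ e I} {τ : Store}

lemma val_nE (h : τ 0 = initStore (I.encode e) 0) : nE.val τ = I.n := by
  simp [h, I.input_n e]

lemma val_nodesE (h : τ 0 = initStore (I.encode e) 0) :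
    (nodesE m).val τ = ((dataOf hρ e I).N : ℕ) := by
  simp only [nodesE, Exp.val_mul, val_nE h, Exp.val_lit]
  rw [← Nat.cast_mul]
  rfl

lemma val_relE {P : ℕ → ℕ → Prop} {X Y : Exp} {i j : ℕ} (hi : i < m + 1) (hj : j < m + 1)
    (hX : X.val τ = i) (hY : Y.val τ = j) : (relE m P X Y).val τ = ind (P i j) := by
  have hlt : i * (m + 1) + j < (m + 1) * (m + 1) := by nlinarith
  rw [relE, Exp.val_tab (x := i * (m + 1) + j) hlt (by simp [hX, hY])]
  rw [mul_comm i, Nat.mul_add_div (by omega), Nat.div_eq_of_lt hj, Nat.mul_add_mod,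
    Nat.mod_eq_of_lt hj, add_zero]

lemma val_vertexE {X : Exp} {x : ℕ} (hX : X.val τ = x) :
    (vertexE m X).val τ = (x / (m + 1) : ℕ) := by
  rw [vertexE, Exp.val_div, hX, Exp.val_lit, Int.natCast_div]

lemma val_levelE {X : Exp} {x : ℕ} (hX : X.val τ = x) :
    (levelE m X).val τ = (x % (m + 1) : ℕ) := by
  rw [levelE, Exp.val_mod, hX, Exp.val_lit, Int.natCast_mod]

lemma val_arcE (h : τ 0 = initStore (I.encode e) 0) {X Y : Exp} {u v : ℕ} (hu : u < I.n)
    (hv : v < I.n) (hX : X.val τ = u) (hY : Y.val τ = v) :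
    (arcE X Y).val τ = ind (I.arc u v) := by
  have hk : u * I.n + v < I.n * I.n := by nlinarith
  have := I.input_arc e hk
  rw [mul_comm u, Nat.mul_add_div (by omega), Nat.div_eq_of_lt hv, Nat.mul_add_mod,
    Nat.mod_eq_of_lt hv, add_zero] at this
  rw [← this, arcE, Exp.val_read, h]
  simp only [Exp.val_add, Exp.val_lit, Exp.val_mul, hX, hY, val_nE h]
  push_cast
  ring_nf

lemma ind_eq (p : Prop) [Decidable p] : (if p then (1 : ℤ) else 0) = ind p := by
  by_cases h : p
  · rw [if_pos h, ind_of_true h]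
  · rw [if_neg h, ind_of_false h]

lemma val_countE (h : Ready hρ e I τ) {X Y : Exp} {x y : ℕ} (hx : x < (dataOf hρ e I).N)
    (hy : y < (dataOf hρ e I).N) (hX : X.val τ = x) (hY : Y.val τ = y) :
    (countE m (rel H ρ) X Y).val τ =
      (dataOf hρ e I).count (x / (m + 1)) (x % (m + 1)) (y / (m + 1)) (y % (m + 1)) := by
  have hu : x / (m + 1) < I.n := (dataOf hρ e I).div_lt hx
  have hv : y / (m + 1) < I.n := (dataOf hρ e I).div_lt hy
  have hi : x % (m + 1) < m + 1 := Nat.mod_lt _ (by omega)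
  have hj : y % (m + 1) < m + 1 := Nat.mod_lt _ (by omega)
  have vu := val_vertexE (m := m) hX
  have vv := val_vertexE (m := m) hY
  have vi := val_levelE (m := m) hX
  have vj := val_levelE (m := m) hY
  simp only [countE, Exp.val_add, Exp.val_mul, Exp.val_eq, Exp.val_read,
    val_arcE h.inp hu hv vu vv, val_arcE h.inp hv hu vv vu, val_relE hi hj vi vj]
  rw [vu, vv, h.out _ hu, h.inn _ hu]
  simp only [Nat.cast_inj, ind_eq]
  rfl

lemma val_innerE (h : Ready hρ e I τ) {X Y : Exp} {x y : ℕ} (hx : x < (dataOf hρ e I).N)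
    (hy : y < (dataOf hρ e I).N) (hX : X.val τ = x) (hY : Y.val τ = y) :
    (innerE m (rel H ρ) X Y).val τ = (dataOf hρ e I).inner x y := by
  have hu : x / (m + 1) < I.n := (dataOf hρ e I).div_lt hx
  have hi : x % (m + 1) < m + 1 := Nat.mod_lt _ (by omega)
  have vu := val_vertexE (m := m) hX
  have vi := val_levelE (m := m) hX
  simp only [innerE, Exp.val_add, Exp.val_mul, val_countE h hx hy hX hY, Exp.val_eq,
    Exp.val_sub, Exp.val_read, Exp.val_lit, h.bigM, h.bigL]
  simp only [vu, vi, hX, hY]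
  change _ = (dataOf hρ e I).M * (dataOf hρ e I).count (x / (m + 1)) (x % (m + 1)) (y / (m + 1))
    (y % (m + 1)) + ind (y = x + 1 ∧ x % (m + 1) < m) *
      ((dataOf hρ e I).C (x / (m + 1)) (x % (m + 1)) + (dataOf hρ e I).L)
  have hy1 : ((y : ℤ) = x + 1) ↔ y = x + 1 := by omega
  by_cases hlt : x % (m + 1) < m
  · rw [h.cost _ hu _ hlt, if_neg (show ¬ ((x % (m + 1) : ℕ) : ℤ) = m by omega)]
    by_cases hyx : y = x + 1
    · rw [if_pos (hy1.2 hyx), ind_of_true ⟨hyx, hlt⟩]; ring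
    · rw [if_neg (mt hy1.1 hyx), ind_of_false fun h => hyx h.1]; ring
  · rw [if_pos (show ((x % (m + 1) : ℕ) : ℤ) = m by omega), ind_of_false fun h => hlt h.2]
    ring

lemma val_isInnerE (h : τ 0 = initStore (I.encode e) 0) {X : Exp} {x : ℕ}
    (hx : x < (dataOf hρ e I).N + 2) (hX : X.val τ = x) :
    (isInnerE m X).val τ = if x < (dataOf hρ e I).N then 1 else 0 := by
  simp only [isInnerE, Exp.val_sub, Exp.val_lit, Exp.val_eq, Exp.val_add,
    val_nodesE (hρ := hρ) h, hX]
  split_ifs <;> omega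

lemma val_resE (h : Ready hρ e I τ) {X Y : Exp} {x y : ℕ} (hx : x < (dataOf hρ e I).N + 2)
    (hy : y < (dataOf hρ e I).N + 2) (hX : X.val τ = x) (hY : Y.val τ = y) :
    (resE m (rel H ρ) X Y).val τ = (dataOf hρ e I).res₀ x y := by
  have vi := val_levelE (m := m) hX
  simp only [resE, Exp.val_add, Exp.val_mul, Exp.val_eq, Exp.val_isZero, Exp.val_read,
    Exp.val_lit, val_nodesE (hρ := hρ) h.inp, val_isInnerE h.inp hx hX, val_isInnerE h.inp hy hY,
    h.bigM, vi]
  rw [hY]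
  have hcm : (((x % (m + 1) : ℕ) : ℤ) = m) ↔ x % (m + 1) = m := by omega
  have hc0 : (((x % (m + 1) : ℕ) : ℤ) = 0) ↔ x % (m + 1) = 0 := by omega
  have hyN : ((y : ℤ) = (dataOf hρ e I).N) ↔ y = (dataOf hρ e I).N := by omega
  have hyN1 : ((y : ℤ) = (dataOf hρ e I).N + 1) ↔ y = (dataOf hρ e I).N + 1 := by omega
  simp only [hcm, hc0, hyN, hyN1]
  change _ = if x < (dataOf hρ e I).N ∧ y < (dataOf hρ e I).N then (dataOf hρ e I).inner x y
    else if y = (dataOf hρ e I).N ∧ x < (dataOf hρ e I).N ∧ x % (m + 1) = 0 then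
      (dataOf hρ e I).M
    else if y = (dataOf hρ e I).N + 1 ∧ x < (dataOf hρ e I).N ∧ x % (m + 1) = m then
      (dataOf hρ e I).M
    else 0
  by_cases h1 : x < (dataOf hρ e I).N
  · by_cases h2 : y < (dataOf hρ e I).N
    · rw [val_innerE h h1 h2 hX hY, if_pos h1, if_pos h2,
        if_neg (show ¬ y = (dataOf hρ e I).N by omega),
        if_neg (show ¬ y = (dataOf hρ e I).N + 1 by omega),
        if_pos (show x < (dataOf hρ e I).N ∧ y < (dataOf hρ e I).N from ⟨h1, h2⟩)]
      ring
    · simp only [h1, h2, if_true, if_false, mul_zero, zero_mul, zero_add, and_false, true_and,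
        mul_one]
      split_ifs <;> omega
  · simp [h1]

/-! ### The complete program -/

/-- Compute the bounds `L` and `M`. -/
def boundCmd (m : ℕ) : Cmd :=
  .seq (.asg 11 (.lit 0) (.lit 1)) <|
  .seq (.scan 2 11 (.mul nE (.lit m))
    (.add (.var 11) (.mul (.read 20 (.var 2)) (.read 20 (.var 2))))) <|
  .asg 12 (.lit 0) (.add (.mul (.mul (.lit 2) nE) (.var 11)) (.lit 1))

/-- Mark the vertices with out-neighbours and those with in-neighbours. -/
def degCmd : Cmd :=
  .rep 2 (.mul nE nE) <| .ite (.read 0 (.add (.lit 2) (.var 2)))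
    (.seq (.asg 24 (.div (.var 2) nE) (.lit 1)) (.asg 25 (.mod (.var 2) nE) (.lit 1))) .skip

def nodeCountE (m : ℕ) : Exp := .add (nodesE m) (.lit 2)

/-- Only the label of the source is written; all other labels, and the excesses of source and sink,
are zero because their cells have not been touched. -/
noncomputable def netCmd (m : ℕ) (E : ℕ → ℕ → Prop) : Cmd :=
  .seq (.fill 2 21 0 (.mul (nodeCountE m) (nodeCountE m))
    (resE m E (.div (.var 2) (nodeCountE m)) (.mod (.var 2) (nodeCountE m)))) <|
  .seq (.fill 2 22 0 (nodesE m) (.mul (.isZero (levelE m (.var 2))) (.var 12))) <|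
  .asg 23 (nodesE m) (nodeCountE m)

variable {Λ Z : ℤ}

lemma wp_boundCmd (hΛ : ((I.n * m : ℕ) : ℤ) ≤ Λ) (hZ : (2 ^ I.logBound e) ^ 9 ≤ Z)
    (h0 : τ 0 = initStore (I.encode e) 0)
    (h20 : ∀ u < I.n, ∀ i < m, τ 20 ((u * m + i : ℕ) : ℤ) = (dataOf hρ e I).C u i)
    {Q : Store → Prop}
    (hQ : ∀ π : Store, (∀ b, b ≠ 2 → b ≠ 11 → b ≠ 12 → π b = τ b) →
      π 11 0 = (dataOf hρ e I).L → π 12 0 = (dataOf hρ e I).M → Q π) :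
    wp Λ Z (boundCmd m) Q τ := by
  have hB2 := two_le_pow_logBound e I
  have hn := I.input_n e
  have h69 : ((2 : ℤ) ^ I.logBound e) ^ 6 ≤ (2 ^ I.logBound e) ^ 9 :=
    pow_le_pow_right₀ (by linarith) (by norm_num)
  have h1Z : 1 ≤ Z := (one_le_pow₀ (by linarith)).trans hZ
  refine wp_seq (wp_asg (by simpa using h1Z) (wp_seq (wp_scan (by norm_num) (I.n * m)
    (fun k => 1 + ∑ j ∈ range k, I.intCost e (j / m) (trans e ρ (j % m)) ^ 2)
    (by simp [h0, hn]) hΛ (by simp [Store.set_apply]) ?_ ?_ ?_)))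
  · intro k hk
    rw [abs_of_nonneg (add_nonneg zero_le_one (sum_nonneg fun _ _ => sq_nonneg _))]
    exact (dataOf_partial_L_le e I hk).trans (h69.trans hZ)
  · intro k hk π hfr h2 hs
    have hm : 0 < m := Nat.pos_of_ne_zero fun h => by simp [h] at hk
    have h3 : π 20 k = I.intCost e (k / m) (trans e ρ (k % m)) := by
      have := h20 (k / m) (Nat.div_lt_of_lt_mul (by rwa [mul_comm])) (k % m) (Nat.mod_lt _ hm)
      rw [mul_comm (k / m), Nat.div_add_mod] at this
      rw [hfr 20 (by norm_num) (by norm_num), Store.set_apply_of_ne _ (by norm_num), this]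
      rfl
    simp only [Exp.val_add, Exp.val_mul, Exp.val_read, Exp.val_lit, h2, hs, h3, sum_range_succ]
    ring
  · intro π hfr hs
    have h0' : π 0 = initStore (I.encode e) 0 := by
      rw [hfr 0 (by norm_num) (by norm_num), Store.set_apply_of_ne _ (by norm_num), h0]
    have hv : (Exp.add (.mul (.mul (.lit 2) nE) (.var 11)) (.lit 1)).val π =
        (dataOf hρ e I).M := by
      simp only [Exp.val_add, Exp.val_mul, Exp.val_lit, Exp.val_read, h0', hn, hs]
      rfl
    refine wp_asg ?_ ?_
    · rw [hv, abs_of_pos (dataOf hρ e I).M_pos]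
      exact (dataOf_M_le hρ e I).trans hZ
    · rw [hv]
      refine hQ _ (fun b h1 h2 h3 => ?_) ?_ ?_
      · rw [Store.set_apply_of_ne _ h3, hfr b h1 h2, Store.set_apply_of_ne _ h2]
      · rw [Store.set_apply_of_ne _ (by norm_num), hs]; rfl
      · simp [Store.set_apply]

lemma wp_degCmd (hΛ : ((I.n * I.n : ℕ) : ℤ) ≤ Λ) (hZ : 1 ≤ Z)
    (h0 : τ 0 = initStore (I.encode e) 0) (h24 : ∀ i, τ 24 i = 0) (h25 : ∀ i, τ 25 i = 0)
    {Q : Store → Prop}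
    (hQ : ∀ π : Store, (∀ b, b ≠ 2 → b ≠ 24 → b ≠ 25 → π b = τ b) →
      (∀ u < I.n, π 24 u = ind (∃ w, I.arc u w)) →
      (∀ u < I.n, π 25 u = ind (∃ w, I.arc w u)) → Q π) :
    wp Λ Z degCmd Q τ := by
  have hk : ∀ b, b ≠ 2 → b ≠ 24 → b ≠ 25 → degCmd.keeps b := by
    intro b h1 h2 h3; simp [degCmd, keeps, h1.symm, h2.symm, h3.symm]
  refine wp_rep (I.n * I.n) (by simp [h0, I.input_n e]) hΛ (fun k π =>
    (∀ u < I.n, π 24 u = ind (∃ l < k, l / I.n = u ∧ I.arc (l / I.n) (l % I.n))) ∧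
    (∀ u < I.n, π 25 u = ind (∃ l < k, l % I.n = u ∧ I.arc (l / I.n) (l % I.n)))) ?_ ?_ ?_
  · constructor
    · intro u _
      rw [ind_of_false (by rintro ⟨l, hl, -⟩; omega)]
      simp [h24]
    · intro u _
      rw [ind_of_false (by rintro ⟨l, hl, -⟩; omega)]
      simp [h25]
  · rintro k π hkn h2 hfr ⟨i1, i2⟩
    have f0 : π 0 = initStore (I.encode e) 0 := by rw [hfr 0 rfl, h0]
    have hv : (Exp.read 0 (.add (.lit 2) (.var 2))).val π =
        ind (I.arc (k / I.n) (k % I.n)) := by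
      simp [f0, h2, I.input_arc e hkn]
    have hstep : ∀ (p : ℕ → Prop) , (∃ l < k + 1, p l ∧ I.arc (l / I.n) (l % I.n)) ↔
        ((∃ l < k, p l ∧ I.arc (l / I.n) (l % I.n)) ∨ (p k ∧ I.arc (k / I.n) (k % I.n))) := by
      intro p
      constructor
      · rintro ⟨l, hl, h⟩
        rcases Nat.lt_succ_iff_lt_or_eq.1 hl with hl | rfl
        · exact .inl ⟨l, hl, h⟩
        · exact .inr h
      · rintro (⟨l, hl, h⟩ | h)
        · exact ⟨l, by omega, h⟩
        · exact ⟨k, by omega, h⟩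
    have vd : (Exp.div (.var 2) nE).val π = (k / I.n : ℕ) := by
      simp [f0, h2, I.input_n e]
    have vm : (Exp.mod (.var 2) nE).val π = (k % I.n : ℕ) := by
      simp [f0, h2, I.input_n e]
    refine ⟨fun hpos => ?_, fun hneg => ?_⟩
    · rw [hv] at hpos
      have harc : I.arc (k / I.n) (k % I.n) := by
        by_contra h; rw [ind_of_false h] at hpos; exact absurd hpos (by norm_num)
      refine wp_seq (wp_asg (by simpa using hZ) ?_)
      rw [vd]
      refine wp_asg (by simpa using hZ) ?_
      have vm' : (Exp.mod (.var 2) nE).val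
          (π.set 24 ((k / I.n : ℕ) : ℤ) ((Exp.lit 1).val π)) = (k % I.n : ℕ) := by
        simp [f0, h2, I.input_n e]
      rw [vm']
      constructor
      · intro u hu
        rw [Store.set_apply_of_ne _ (by norm_num), Store.set_apply_of_ne _ (by norm_num),
          Store.set_apply]
        simp only [Nat.cast_inj]
        by_cases huk : u = k / I.n
        · rw [if_pos huk, ind_of_true ((hstep (fun l => l / I.n = u)).2
            (.inr ⟨huk.symm, harc⟩))]; rfl
        · rw [if_neg huk, i1 u hu]
          congr 1
          refine propext ⟨fun h => (hstep _).2 (.inl h), fun h => ?_⟩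
          exact ((hstep (fun l => l / I.n = u)).1 h).resolve_right fun h => huk h.1.symm
      · intro u hu
        rw [Store.set_apply_of_ne _ (by norm_num), Store.set_apply]
        simp only [Nat.cast_inj]
        by_cases huk : u = k % I.n
        · rw [if_pos huk, ind_of_true ((hstep (fun l => l % I.n = u)).2
            (.inr ⟨huk.symm, harc⟩))]; rfl
        · rw [if_neg huk, Store.set_apply_of_ne _ (by norm_num), i2 u hu]
          congr 1
          refine propext ⟨fun h => (hstep _).2 (.inl h), fun h => ?_⟩
          exact ((hstep (fun l => l % I.n = u)).1 h).resolve_right fun h => huk h.1.symm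
    · rw [hv] at hneg
      have harc : ¬ I.arc (k / I.n) (k % I.n) := fun h => by
        rw [ind_of_true h] at hneg; exact hneg (by norm_num)
      constructor
      · intro u hu
        rw [Store.set_apply_of_ne _ (by norm_num), i1 u hu]
        congr 1
        exact propext ⟨fun h => (hstep _).2 (.inl h), fun h =>
          ((hstep (fun l => l / I.n = u)).1 h).resolve_right fun h => harc h.2⟩
      · intro u hu
        rw [Store.set_apply_of_ne _ (by norm_num), i2 u hu]
        congr 1
        exact propext ⟨fun h => (hstep _).2 (.inl h), fun h =>
          ((hstep (fun l => l % I.n = u)).1 h).resolve_right fun h => harc h.2⟩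
  · rintro π hfr ⟨i1, i2⟩
    have hpair : ∀ u v, u < I.n → v < I.n → u * I.n + v < I.n * I.n ∧
        (u * I.n + v) / I.n = u ∧ (u * I.n + v) % I.n = v := by
      intro u v hu hv
      refine ⟨by nlinarith, ?_, ?_⟩
      · rw [mul_comm, Nat.mul_add_div (by omega), Nat.div_eq_of_lt hv, add_zero]
      · rw [mul_comm, Nat.mul_add_mod, Nat.mod_eq_of_lt hv]
    refine hQ π (fun b h1 h2 h3 => hfr b (hk b h1 h2 h3)) (fun u hu => ?_) fun u hu => ?_
    · rw [i1 u hu]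
      congr 1
      refine propext ⟨?_, ?_⟩
      · rintro ⟨l, hl, rfl, h⟩; exact ⟨_, h⟩
      · rintro ⟨w, h⟩
        obtain ⟨p1, p2, p3⟩ := hpair u w h.1 h.2.1
        exact ⟨_, p1, p2, by rw [p2, p3]; exact h⟩
    · rw [i2 u hu]
      congr 1
      refine propext ⟨?_, ?_⟩
      · rintro ⟨l, hl, rfl, h⟩; exact ⟨_, h⟩
      · rintro ⟨w, h⟩
        obtain ⟨p1, p2, p3⟩ := hpair w u h.1 h.2.1
        exact ⟨_, p1, p3, by rw [p2, p3]; exact h⟩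

lemma Ready.congr (h : Ready hρ e I τ) {π : Store} (h0 : π 0 = τ 0) (h1 : π 20 = τ 20)
    (h2 : π 11 = τ 11) (h3 : π 12 = τ 12) (h4 : π 24 = τ 24) (h5 : π 25 = τ 25) :
    Ready hρ e I π := by
  constructor
  · rw [h0]; exact h.inp
  · rw [h1]; exact h.cost
  · rw [h2]; exact h.bigL
  · rw [h3]; exact h.bigM
  · rw [h4]; exact h.out
  · rw [h5]; exact h.inn

lemma wp_netCmd (hS : Safe (dataOf hρ e I).N (dataOf hρ e I).cap Λ Z)
    (hΛ : ((((dataOf hρ e I).N + 2) * ((dataOf hρ e I).N + 2) : ℕ) : ℤ) ≤ Λ)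
    (hMZ : (dataOf hρ e I).M ≤ Z) (h : Ready hρ e I τ)
    (h22 : ∀ i, τ 22 i = 0) (h23 : ∀ i, τ 23 i = 0) {Q : Store → Prop}
    (hQ : ∀ π : Store, (∀ b, b ≠ 2 → b ≠ 21 → b ≠ 22 → b ≠ 23 → π b = τ b) →
      Preflow (dataOf hρ e I).N (dataOf hρ e I).cap (resOf (dataOf hρ e I).N π) (excOf π)
        (labOf π) → Q π) :
    wp Λ Z (netCmd m (rel H ρ)) Q τ := by
  set D := dataOf hρ e I with hD
  have hM := D.M_pos
  have hK : ∀ π : Store, π 0 = initStore (I.encode e) 0 →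
      (nodeCountE m).val π = (D.N + 2 : ℕ) := fun π hπ => by
    simp only [nodeCountE, Exp.val_add, val_nodesE (hρ := hρ) hπ, Exp.val_lit]
    push_cast; rfl
  refine wp_seq (wp_fill (by norm_num) ((D.N + 2) * (D.N + 2))
    (fun k => D.res₀ (k / (D.N + 2)) (k % (D.N + 2))) ?_ hΛ ?_ ?_ ?_)
  · rw [Exp.val_mul, hK τ h.inp, Nat.cast_mul]
  · intro k hk
    have h1 : k / (D.N + 2) < D.N + 2 := Nat.div_lt_of_lt_mul hk
    have h2 : k % (D.N + 2) < D.N + 2 := Nat.mod_lt _ (by omega)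
    rw [abs_of_nonneg (D.preflow₀.r_nonneg _ h1 _ h2)]
    exact (D.preflow₀.r_le h1 h2).trans (hS.res _ h1 _ h2)
  · intro k hk π hfr h2
    have hR : Ready hρ e I π := h.congr (hfr _ (by norm_num) (by norm_num))
      (hfr _ (by norm_num) (by norm_num)) (hfr _ (by norm_num) (by norm_num))
      (hfr _ (by norm_num) (by norm_num)) (hfr _ (by norm_num) (by norm_num))
      (hfr _ (by norm_num) (by norm_num))
    refine val_resE hR (Nat.div_lt_of_lt_mul hk) (Nat.mod_lt _ (by omega)) ?_ ?_
    · rw [Exp.val_div, hK π hR.inp, Int.natCast_div]; simp [h2]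
    · rw [Exp.val_mod, hK π hR.inp, Int.natCast_mod]; simp [h2]
  · intro π hfr hres _
    have g0 : π 0 = initStore (I.encode e) 0 := by
      rw [hfr 0 (by norm_num) (by norm_num), h.inp]
    refine wp_seq (wp_fill (by norm_num) D.N D.exc₀ (val_nodesE g0)
      (by have := hS.loop_node; omega) ?_ ?_ ?_)
    · intro k hk
      unfold Data.exc₀
      split_ifs
      · rw [abs_of_pos hM]; exact hMZ
      · rw [abs_zero]; linarith
    · intro k hk σ hfr' h2
      have v := val_levelE (m := m) (X := .var 2) (τ := σ) (x := k) (by simp [h2])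
      have h12 : σ 12 0 = D.M := by
        rw [hfr' 12 (by norm_num) (by norm_num), hfr 12 (by norm_num) (by norm_num), h.bigM]
      rw [Exp.val_mul, Exp.val_isZero, v]
      change (if ((k % (m + 1) : ℕ) : ℤ) = 0 then 1 else 0) * σ 12 0 =
        if k < D.N ∧ k % (m + 1) = 0 then D.M else 0
      rw [h12]
      by_cases hz : k % (m + 1) = 0
      · rw [if_pos (show ((k % (m + 1) : ℕ) : ℤ) = 0 by exact_mod_cast hz),
          if_pos (show k < D.N ∧ k % (m + 1) = 0 from ⟨hk, hz⟩), one_mul]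
      · rw [if_neg (show ¬ ((k % (m + 1) : ℕ) : ℤ) = 0 by exact_mod_cast hz),
          if_neg (show ¬ (k < D.N ∧ k % (m + 1) = 0) from fun h => hz h.2), zero_mul]
    · intro σ hfr' hexc hrest
      have g0' : σ 0 = initStore (I.encode e) 0 := by
        rw [hfr' 0 (by norm_num) (by norm_num), g0]
      have vN : (nodesE m).val σ = (D.N : ℕ) := val_nodesE g0'
      have vK := hK σ g0'
      refine wp_asg ?_ ?_
      · rw [vK, abs_of_nonneg (by positivity)]
        have := hS.lab
        exact_mod_cast this
      · rw [vN, vK]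
        refine hQ _ (fun b h1 h2 h3 h4 => ?_) (D.preflow₀.congr ?_ ?_ ?_)
        · rw [Store.set_apply_of_ne _ h4, hfr' b h1 h3, hfr b h1 h2]
        · intro x hx y hy
          have hk : x * (D.N + 2) + y < (D.N + 2) * (D.N + 2) := by nlinarith
          have := hres _ hk
          rw [mul_comm x, Nat.mul_add_div (by omega), Nat.div_eq_of_lt hy, Nat.mul_add_mod,
            Nat.mod_eq_of_lt hy, add_zero] at this
          rw [← this, resOf, Store.set_apply_of_ne _ (by norm_num),
            hfr' 21 (by norm_num) (by norm_num)]
          congr 1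
          push_cast
          ring
        · intro x hx
          rw [excOf, Store.set_apply_of_ne _ (by norm_num)]
          by_cases hxN : x < D.N
          · have := hexc x hxN
            rwa [zero_add] at this
          · rw [hrest x (fun k hk => by omega), hfr 22 (by norm_num) (by norm_num), h22,
              Data.exc₀, if_neg fun h => hxN h.1]
        · intro x hx
          rw [labOf, Store.set_apply, hfr' 23 (by norm_num) (by norm_num),
            hfr 23 (by norm_num) (by norm_num), h23, Data.label₀]
          simp only [Nat.cast_inj]
          push_cast
          rfl

end

end MinHOM

namespace MinHOM

open RAM Finset Flow Exp Cmd Instance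

section

variable {V : Type*} {m : ℕ} {H : Digraph V}

/-! ### Reading off the homomorphism -/

/-- `1` if the label in the given cell exceeds the gap, `0` otherwise. -/
def aboveE (m : ℕ) (x : Exp) : Exp :=
  .add (.lit 1) (.div (.sub (.sub (.read 23 x) (.var 13)) (.lit 1))
    (.add (nodeCountE m) (.lit 1)))

/-- The number `c` of levels above the gap is counted, and the level is `c - 1`. The table has `m +
2` entries because `c` ranges over `0, …, m + 1`. -/
def imageE (m : ℕ) (π : ℕ → ℕ) : Exp :=
  .tab (m + 2) (fun c => (π (c - 1) : ℕ))
    (.sum (fun i => aboveE m (.add (.mul (.var 2) (.lit ((m + 1 : ℕ) : ℤ))) (.lit i))) (m + 1))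

/-- The test asks whether the excess of the sink is at least `M`, that is, whether no homomorphism
exists. -/
def outCmd (m : ℕ) (π : ℕ → ℕ) : Cmd :=
  .ite (.add (.sub (.read 22 (.add (nodesE m) (.lit 1))) (.var 12)) (.lit 1))
    (.asg 1 (.lit 0) (.lit 1))
    (.seq (.asg 1 (.lit 0) (.add nE (.lit 1))) <| .seq (.asg 1 (.lit 1) (.lit 1)) <|
      .fill 2 1 2 nE (imageE m π))

noncomputable def cutCmd (m : ℕ) (E : ℕ → ℕ → Prop) (π : ℕ → ℕ) : Cmd :=
  .seq (prelude m π) <| .seq (boundCmd m) <| .seq degCmd <| .seq (netCmd m E) <|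
    .seq (sweeps (nodesE m)) <| .seq (findGap (nodesE m)) <| outCmd m π

variable {ρ : V ≃ Fin m} {hρ : IsMinMax H ρ} {e : V ≃ Fin m} {I : Instance V} {τ : Store}
  {Λ Z : ℤ}

lemma val_nodeCountE (h0 : τ 0 = initStore (I.encode e) 0) :
    (nodeCountE m).val τ = ((dataOf hρ e I).N : ℤ) + 2 := by
  simp only [nodeCountE, Exp.val_add, val_nodesE (hρ := hρ) h0, Exp.val_lit]

lemma val_aboveE (h0 : τ 0 = initStore (I.encode e) 0) {X : Exp} {x g : ℕ} (hX : X.val τ = x)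
    (hx : x < (dataOf hρ e I).N + 2) (hlab : 0 ≤ labOf τ x)
    (hlab' : labOf τ x ≤ (dataOf hρ e I).N + 2) (hg0 : 0 < g) (hg : g < (dataOf hρ e I).N + 2)
    (h13 : τ 13 0 = g) :
    (aboveE m X).val τ = if x ∈ above (dataOf hρ e I).N (labOf τ) g then 1 else 0 := by
  simp only [aboveE, Exp.val_add, Exp.val_lit, Exp.val_div, Exp.val_sub, Exp.val_read, hX, h13,
    val_nodeCountE (hρ := hρ) h0]
  change 1 + (labOf τ x - g - 1) / _ = _
  simp only [above, mem_filter, mem_range, hx, true_and]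
  split_ifs with h
  · rw [Int.ediv_eq_zero_of_lt (by omega) (by omega), add_zero]
  -- The numerator is negative and greater than minus the divisor, so division with rounding down
  -- gives `-1`.
  · have : (labOf τ x - g - 1) / (((dataOf hρ e I).N : ℤ) + 2 + 1) = -1 :=
      (Int.ediv_eq_iff_of_pos (by omega)).2 ⟨by omega, by omega⟩
    rw [this]; rfl

lemma val_imageE (h0 : τ 0 = initStore (I.encode e) 0)
    (hlab : ∀ x < (dataOf hρ e I).N + 2, 0 ≤ labOf τ x ∧ labOf τ x ≤ (dataOf hρ e I).N + 2)
    {u g : ℕ} (hu : u < I.n) (h2 : τ 2 0 = u) (hg0 : 0 < g) (hg : g < (dataOf hρ e I).N + 2)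
    (h13 : τ 13 0 = g) (π : ℕ → ℕ) :
    (imageE m π).val τ = π ((dataOf hρ e I).level (above (dataOf hρ e I).N (labOf τ) g) u) := by
  set X := above (dataOf hρ e I).N (labOf τ) g with hX
  rw [imageE, Exp.val_tab
    (x := ((range (m + 1)).filter fun i => u * (m + 1) + i ∈ X).card)]
  · rfl
  · have := card_filter_le (range (m + 1)) fun i => u * (m + 1) + i ∈ X
    rw [card_range] at this
    omega
  · rw [Exp.val_sum, card_filter, Nat.cast_sum]
    refine sum_congr rfl fun i hi => ?_
    have hN : u * (m + 1) + i < (dataOf hρ e I).N :=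
      (dataOf hρ e I).node_lt (u := u) hu (mem_range.1 hi)
    rw [val_aboveE (hρ := hρ) h0 (x := u * (m + 1) + i) (by simp [h2]) (by omega)
      (hlab _ (by omega)).1 (hlab _ (by omega)).2 hg0 hg h13]
    push_cast
    rfl

lemma wp_outCmd (hΛ : (I.n : ℤ) ≤ Λ) (hnZ : (I.n : ℤ) + 1 ≤ Z) (hmZ : (m : ℤ) ≤ Z)
    (h0 : τ 0 = initStore (I.encode e) 0) (h1 : ∀ i, τ 1 i = 0)
    (h12 : τ 12 0 = (dataOf hρ e I).M)
    (hp : Preflow (dataOf hρ e I).N (dataOf hρ e I).cap (resOf (dataOf hρ e I).N τ) (excOf τ)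
      (labOf τ))
    (hact : ∀ x < (dataOf hρ e I).N, labOf τ x < (dataOf hρ e I).N + 2 → excOf τ x ≤ 0)
    {g : ℕ} (hg0 : 0 < g) (hg : g < (dataOf hρ e I).N + 2)
    (hgap : ∀ x < (dataOf hρ e I).N + 2, labOf τ x ≠ g) (h13 : τ 13 0 = g) :
    wp Λ Z (outCmd m (trans e ρ)) (fun π => ∃ ys, HasOutput π ys ∧ I.Correct H e ys) τ := by
  obtain ⟨o1, o2⟩ := (dataOf hρ e I).of_preflow hp hact (g := g) (by exact_mod_cast hg0)
    (by exact_mod_cast hg) hgap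
  have h1Z : (1 : ℤ) ≤ Z := by omega
  have hv : (Exp.add (.sub (.read 22 (.add (nodesE m) (.lit 1))) (.var 12)) (.lit 1)).val τ =
      excOf τ ((dataOf hρ e I).N + 1) - (dataOf hρ e I).M + 1 := by
    simp only [Exp.val_add, Exp.val_sub, Exp.val_read, Exp.val_lit, h12,
      val_nodesE (hρ := hρ) h0, excOf]
    push_cast
    rfl
  refine ⟨fun hpos => ?_, fun hneg => ?_⟩
  · rw [hv] at hpos
    refine wp_asg (by simpa using h1Z) ⟨[0], ⟨by simp [Store.set_apply], fun k => ?_⟩,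
      correct_of_not_isHom hρ e I (o1 (by omega))⟩
    obtain ⟨k, hk⟩ := k
    obtain rfl : k = 0 := by simpa using hk
    simp [Store.set_apply, h1]
  · rw [hv] at hneg
    obtain ⟨hhom, hmin⟩ := o2 (by omega)
    have hn : (Exp.add nE (.lit 1)).val τ = I.n + 1 := by simp [h0, I.input_n e]
    refine wp_seq (wp_asg (by rw [hn, abs_of_nonneg (by positivity)]; exact hnZ)
      (wp_seq (wp_asg (by simpa using h1Z) (wp_fill (by norm_num) I.n
        (fun u => (trans e ρ ((dataOf hρ e I).level
          (above (dataOf hρ e I).N (labOf τ) g) u) : ℕ)) ?_ hΛ ?_ ?_ ?_))))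
    · simp [h0, I.input_n e]
    · intro u hu
      have := trans_lt e ρ (hhom.1 u hu)
      rw [abs_of_nonneg (by positivity)]
      omega
    · intro u hu π hfr h2
      have f0 : π 0 = initStore (I.encode e) 0 := by
        rw [hfr 0 (by norm_num) (by norm_num)]; simpa using h0
      have f13 : π 13 = τ 13 := by rw [hfr 13 (by norm_num) (by norm_num)]; simp
      have f23 : labOf π = labOf τ := by
        funext x
        simp only [labOf]
        rw [hfr 23 (by norm_num) (by norm_num)]; simp
      rw [← f23]
      refine val_imageE f0 (fun x hx => ?_) hu h2 hg0 hg (by rw [f13, h13]) _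
      rw [f23]
      exact ⟨hp.h_nonneg x hx, hp.h_le x hx⟩
    · intro π hfr hout hrest
      refine ⟨_, hasOutput_cons ?_ ?_ fun u => hout u u.2, correct_of_isHom hρ e I hhom hmin⟩
      · rw [hrest 0 (fun k _ => by omega), Store.set_apply, Store.set_apply, hn]; simp
      · rw [hrest 1 (fun k _ => by omega), Store.set_apply]; simp

lemma wf_cutCmd (E : ℕ → ℕ → Prop) (π : ℕ → ℕ) : (cutCmd m E π).wf := by
  simp [cutCmd, prelude, boundCmd, degCmd, netCmd, sweeps, sweep, discharge, tryPush, pushCmd,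
    findGap, outCmd, fill, scan, wf, keeps]

theorem polyTime_of_isMinMax (H : Digraph V) (h : ∀ m, ∀ _ : V ≃ Fin m, ∃ ρ : V ≃ Fin m,
    IsMinMax H ρ) : PolyTime H := by
  intro m e
  obtain ⟨ρ, hρ⟩ := h m e
  -- The cubic bound covers the number of sweeps and the number of pairs of nodes. The bound for the
  -- values is the 13th power of `2 ^ logBound`: the 12th bounds a capacity, and one more factor
  -- bounds the sum over all nodes.
  refine polyTimeSolvable_of_wp (cutCmd m (rel H ρ) (trans e ρ)) (wf_cutCmd _ _)
    ((Polynomial.X + 3) ^ 3) (13 * (Polynomial.X + Polynomial.C (m + 1)) ^ 2) ?_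
  intro I Λ Z hΛ hZ
  have hΛ' : ((inputSize (I.encode e) + 3 : ℕ) : ℤ) ^ 3 ≤ Λ := by
    refine le_trans (le_of_eq ?_) hΛ
    simp
  have hZ' : ((2 : ℤ) ^ I.logBound e) ^ 13 ≤ Z := by
    refine le_trans (le_of_eq ?_) hZ
    rw [← pow_mul]
    congr 1
    simp [logBound]
    ring
  have hS := dataOf_safe hρ e I hΛ' hZ'
  have hB2 := two_le_pow_logBound e I
  have hpow : ∀ k ≤ 13, ((2 : ℤ) ^ I.logBound e) ^ k ≤ Z := fun k hk =>
    (pow_le_pow_right₀ (by linarith) hk).trans hZ'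
  have hsz := I.sq_le_inputSize e
  have hnS := I.n_le_inputSize e
  have hNS := dataOf_N_le hρ e I
  have hlb := I.le_logBound e
  have hloop : ∀ k : ℕ, k ≤ (inputSize (I.encode e) + 3) ^ 3 → (k : ℤ) ≤ Λ := fun k hk => by
    refine le_trans ?_ hΛ'
    exact_mod_cast hk
  have hcube : (inputSize (I.encode e) + 3) ^ 2 ≤ (inputSize (I.encode e) + 3) ^ 3 :=
    Nat.pow_le_pow_right (by omega) (by norm_num)
  have hlin : inputSize (I.encode e) + 3 ≤ (inputSize (I.encode e) + 3) ^ 3 :=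
    Nat.le_self_pow (by norm_num) _
  have hsm : ∀ k : ℕ, k ≤ I.logBound e → (k : ℤ) ≤ Z := fun k hk =>
    (natCast_le_pow hk).trans (by simpa using hpow 1 (by norm_num))
  refine wp_seq (I.wp_prelude e (fun i hi => trans_lt e ρ hi) (hloop _ (by omega)) ?_ ?_)
  · have := hpow 2 (by norm_num)
    rwa [← pow_mul, mul_comm] at this
  intro τ₁ f₁ c₁
  refine wp_seq (wp_boundCmd (hρ := hρ) (hloop _ (by omega)) (hpow 9 (by norm_num))
    (f₁ 0 (by norm_num) (by norm_num) (by norm_num)) c₁ ?_)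
  intro τ₂ f₂ hL hM
  have z₂ : ∀ b, b ≠ 0 → b ≠ 2 → b ≠ 10 → b ≠ 11 → b ≠ 12 → b ≠ 20 → ∀ i, τ₂ b i = 0 :=
    fun b h0 h1 h2 h3 h4 h5 i => by
      rw [f₂ b h1 h3 h4, f₁ b h1 h2 h5, initStore_of_ne h0]
  have i₂ : τ₂ 0 = initStore (I.encode e) 0 := by
    rw [f₂ 0 (by norm_num) (by norm_num) (by norm_num),
      f₁ 0 (by norm_num) (by norm_num) (by norm_num)]
  refine wp_seq (wp_degCmd (hloop _ (by omega)) (by simpa using hpow 0 (by norm_num)) i₂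
    (z₂ 24 (by norm_num) (by norm_num) (by norm_num) (by norm_num) (by norm_num) (by norm_num))
    (z₂ 25 (by norm_num) (by norm_num) (by norm_num) (by norm_num) (by norm_num) (by norm_num))
    ?_)
  intro τ₃ f₃ ho hi
  have hR : Ready hρ e I τ₃ := by
    refine ⟨?_, fun u hu i hi => ?_, ?_, ?_, ho, hi⟩
    · rw [f₃ 0 (by norm_num) (by norm_num) (by norm_num), i₂]
    · rw [f₃ 20 (by norm_num) (by norm_num) (by norm_num),
        f₂ 20 (by norm_num) (by norm_num) (by norm_num)]
      have := c₁ u hu i hi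
      push_cast at this
      exact this
    · rw [f₃ 11 (by norm_num) (by norm_num) (by norm_num), hL]
    · rw [f₃ 12 (by norm_num) (by norm_num) (by norm_num), hM]
  have z₃ : ∀ b, b ≠ 0 → b ≠ 2 → b ≠ 10 → b ≠ 11 → b ≠ 12 → b ≠ 20 → b ≠ 24 → b ≠ 25 →
      ∀ i, τ₃ b i = 0 := fun b h0 h1 h2 h3 h4 h5 h6 h7 i => by
    rw [f₃ b h1 h6 h7, z₂ b h0 h1 h2 h3 h4 h5]
  refine wp_seq (wp_netCmd hS (hloop _ ?_) ((dataOf_M_le hρ e I).trans (hpow 9 (by norm_num))) hR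
    (z₃ 22 (by norm_num) (by norm_num) (by norm_num) (by norm_num) (by norm_num) (by norm_num)
      (by norm_num) (by norm_num))
    (z₃ 23 (by norm_num) (by norm_num) (by norm_num) (by norm_num) (by norm_num) (by norm_num)
      (by norm_num) (by norm_num)) ?_)
  · refine le_trans ?_ hcube
    rw [sq]
    exact Nat.mul_le_mul (by omega) (by omega)
  intro τ₄ f₄ hp₄
  have i₄ : τ₄ 0 = initStore (I.encode e) 0 := by
    rw [f₄ 0 (by norm_num) (by norm_num) (by norm_num) (by norm_num), hR.inp]
  refine wp_seq (wp_sweeps hS (fun τ h => val_nodesE h) i₄ hp₄ ?_)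
  intro τ₅ f₅ hp₅ hact
  have i₅ : τ₅ 0 = initStore (I.encode e) 0 := by rw [f₅ 0 rfl, i₄]
  refine wp_seq (wp_findGap hS (fun τ h => val_nodesE h) i₅ hp₅ ?_)
  intro τ₆ f₆ g hg0 hg hgap h13
  have r₆ : resOf (dataOf hρ e I).N τ₆ = resOf (dataOf hρ e I).N τ₅ := by
    funext x y; simp only [resOf, f₆ 21 rfl]
  have e₆ : excOf τ₆ = excOf τ₅ := by funext x; simp only [excOf, f₆ 22 rfl]
  have l₆ : labOf τ₆ = labOf τ₅ := by funext x; simp only [labOf, f₆ 23 rfl]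
  refine wp_outCmd (hloop _ (by omega)) ?_ (hsm _ (by omega)) ?_ (fun i => ?_) ?_ ?_ ?_ hg0 hg ?_
    h13
  · have := hsm (I.n + 1) (by omega)
    exact_mod_cast this
  · rw [f₆ 0 rfl, i₅]
  · rw [f₆ 1 rfl, f₅ 1 rfl, f₄ 1 (by norm_num) (by norm_num) (by norm_num) (by norm_num)]
    exact z₃ 1 (by norm_num) (by norm_num) (by norm_num) (by norm_num) (by norm_num)
      (by norm_num) (by norm_num) (by norm_num) i
  · rw [f₆ 12 rfl, f₅ 12 rfl, f₄ 12 (by norm_num) (by norm_num) (by norm_num) (by norm_num),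
      hR.bigM]
  · rw [r₆, e₆, l₆]; exact hp₅
  · rw [e₆, l₆]; exact hact
  · rw [l₆]; exact hgap

end

end MinHOM

namespace MinHOM

open RAM Finset Instance

/-! ### Homomorphisms to extensions of directed cycles -/

/-- Homomorphisms to a directed cycle, for a relation on the natural numbers. -/
def IsPotential (k : ℕ) (A : ℕ → ℕ → Prop) (p : ℕ → ZMod k) : Prop :=
  ∀ u v, A u v → p v = p u + 1

/-- The state after inspection of the first `t` pairs of vertices: in every homomorphism to the
directed cycle, the image of `w` exceeds that of the representative `c w` by `o w`, and `b ≠ 0`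
signals a contradiction. -/
structure Components (k n : ℕ) (A : ℕ → ℕ → Prop) (t : ℕ) (c o : ℕ → ℕ) (b : ℤ) : Prop where
  c_lt : ∀ w < n, c w < n
  o_lt : ∀ w < n, o w < k
  sound : ∀ p, IsPotential k A p → ∀ w < n, p w = p (c w) + o w
  arcs : b = 0 → ∀ l < t, A (l / n) (l % n) → c (l / n) = c (l % n) ∧
    (o (l % n) : ZMod k) = o (l / n) + 1
  bad : b ≠ 0 → ∀ p, ¬ IsPotential k A p

namespace Components

variable {k n t : ℕ} {A : ℕ → ℕ → Prop} {c o : ℕ → ℕ} {b : ℤ}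

lemma init (hk : 0 < k) : Components k n A 0 (fun w => w) (fun _ => 0) 0 where
  c_lt _ h := h
  o_lt _ _ := hk
  sound _ _ _ _ := by simp
  arcs _ l hl := absurd hl (Nat.not_lt_zero l)
  bad h := absurd rfl h

lemma step (h : Components k n A t c o b)
    (ht : A (t / n) (t % n) → c (t / n) = c (t % n) ∧ (o (t % n) : ZMod k) = o (t / n) + 1) :
    Components k n A (t + 1) c o b where
  c_lt := h.c_lt
  o_lt := h.o_lt
  sound := h.sound
  arcs hb l hl hA := by
    rcases Nat.lt_succ_iff_lt_or_eq.1 hl with hl | rfl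
    · exact h.arcs hb l hl hA
    · exact ht hA
  bad := h.bad

/-- An arc inside a class whose offsets do not differ by one rules out every potential. From then on
the field `arcs` is vacuous. -/
lemma contradiction (h : Components k n A t c o b) (hu : t / n < n) (hv : t % n < n)
    (hA : A (t / n) (t % n)) (hc : c (t / n) = c (t % n))
    (ho : (o (t % n) : ZMod k) ≠ o (t / n) + 1) : Components k n A (t + 1) c o 1 where
  c_lt := h.c_lt
  o_lt := h.o_lt
  sound := h.sound
  arcs hb := absurd hb one_ne_zero
  bad _ p hp := by
    refine ho ?_
    have h1 := h.sound p hp _ hu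
    have h2 := h.sound p hp _ hv
    have h3 := hp _ _ hA
    rw [h1, h2, ← hc, add_assoc] at h3
    exact add_left_cancel h3

/-- The arc forces the values of a potential at the two representatives to differ by `d`. The class
of the head is moved as a whole, so offsets along arcs inside it keep their differences. -/
lemma merge (h : Components k n A t c o b) (hk : 0 < k) (hu : t / n < n) (hv : t % n < n)
    (hA : A (t / n) (t % n)) (hc : c (t / n) ≠ c (t % n)) {d : ℕ}
    (hd : (d : ZMod k) = o (t / n) + 1 - o (t % n)) :
    Components k n A (t + 1) (fun w => if c w = c (t % n) then c (t / n) else c w)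
      (fun w => if c w = c (t % n) then (o w + d) % k else o w) b where
  c_lt w hw := by split_ifs; exacts [h.c_lt _ hu, h.c_lt w hw]
  o_lt w hw := by split_ifs; exacts [Nat.mod_lt _ hk, h.o_lt w hw]
  sound p hp w hw := by
    have h1 := h.sound p hp _ hu
    have h2 := h.sound p hp _ hv
    have h3 := hp _ _ hA
    have h4 := h.sound p hp w hw
    split_ifs with hcw
    · rw [hcw] at h4
      rw [h4, ZMod.natCast_mod]
      push_cast
      rw [hd]
      rw [h1, h2] at h3
      linear_combination h3
    · exact h4
  arcs hb l hl hl' := by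
    rcases Nat.lt_succ_iff_lt_or_eq.1 hl with hl | rfl
    · obtain ⟨h1, h2⟩ := h.arcs hb l hl hl'
      rw [h1]
      split_ifs
      · refine ⟨rfl, ?_⟩
        rw [ZMod.natCast_mod, ZMod.natCast_mod]
        push_cast
        rw [h2]; ring
      · exact ⟨rfl, h2⟩
    · simp only [if_neg hc, if_true, true_and]
      rw [ZMod.natCast_mod]
      push_cast
      rw [hd]; ring
  bad := h.bad

end Components

/-! ### Optimal homomorphisms from components and shifts -/

section

variable {V : Type*} {m k : ℕ} {H : Digraph V} (φ : V → ZMod k) (e : V ≃ Fin m) (I : Instance V)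

/-- The part of the extension to which a vertex belongs. -/
def part (i : ℕ) : ℕ := if h : i < m then (φ (e.symm ⟨i, h⟩)).val else 0

lemma part_apply (v : V) : part φ e (e v) = (φ v).val := by
  simp [part]

lemma natCast_part [NeZero k] {i : ℕ} (h : i < m) :
    (part φ e i : ZMod k) = φ (e.symm ⟨i, h⟩) := by
  rw [part, dif_pos h, ZMod.natCast_zmod_val]

/-- The image of a vertex under a homomorphism, as a potential. -/
def potentialOf (g : Fin I.n → V) (w : ℕ) : ZMod k := if h : w < I.n then φ (g ⟨w, h⟩) else 0

variable {φ I}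

lemma isPotential_potentialOf (hadj : ∀ u v, H.Adj u v ↔ φ v = φ u + 1) {g : Fin I.n → V}
    (hg : IsHom I.graph H g) : IsPotential k I.arc (potentialOf φ I g) := by
  rintro u v ⟨hu, hv, huv⟩
  rw [potentialOf, potentialOf, dif_pos hu, dif_pos hv]
  exact (hadj _ _).1 (hg _ _ huv)

lemma correct_of_bad (hadj : ∀ u v, H.Adj u v ↔ φ v = φ u + 1) {t : ℕ} {c o : ℕ → ℕ} {b : ℤ}
    (hc : Components k I.n I.arc t c o b) (hb : b ≠ 0) : I.Correct H e [0] :=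
  .inl ⟨rfl, fun ⟨_, hg⟩ => hc.bad hb _ (isPotential_potentialOf hadj hg)⟩

variable (I) in
/-- The cost of the vertices represented by `r`, if `r` is mapped to part `s`. -/
def shiftCost (k : ℕ) (c o : ℕ → ℕ) (B : ℕ → ℕ → ℕ) (r s : ℕ) : ℤ :=
  ∑ w ∈ range I.n, if c w = r then I.intCost e w (B w ((s + o w) % k)) else 0

/-- The total cost splits over the classes. Indices that represent no vertex contribute nothing, so
they need not be singled out. -/
lemma sum_shiftCost {c o : ℕ → ℕ} {B : ℕ → ℕ → ℕ} (hc : ∀ w < I.n, c w < I.n) (s : ℕ → ℕ) :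
    ∑ r ∈ range I.n, shiftCost e I k c o B r (s r) =
      ∑ w ∈ range I.n, I.intCost e w (B w ((s (c w) + o w) % k)) := by
  simp only [shiftCost]
  rw [sum_comm]
  refine sum_congr rfl fun w hw => ?_
  rw [sum_ite_eq, if_pos (mem_range.2 (hc w (mem_range.1 hw)))]

/-- The classes can be shifted independently of each other, so the cheapest shift of each is
globally optimal once every vertex uses its cheapest image in the part assigned to it. -/
lemma correct_of_shifts [NeZero k] (hadj : ∀ u v, H.Adj u v ↔ φ v = φ u + 1) {c o : ℕ → ℕ}
    (hc : Components k I.n I.arc (I.n * I.n) c o 0) {B : ℕ → ℕ → ℕ}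
    (hB : ∀ w < I.n, ∀ a < k, B w a < m ∧ part φ e (B w a) = a ∧
      ∀ j < m, part φ e j = a → I.intCost e w (B w a) ≤ I.intCost e w j) {s : ℕ → ℕ}
    (hs : ∀ r < I.n, ∀ a < k, shiftCost e I k c o B r (s r) ≤ shiftCost e I k c o B r a) :
    I.Correct H e (1 :: List.ofFn fun u : Fin I.n => (B u ((s (c u) + o u) % k) : ℤ)) := by
  have hk : 0 < k := Nat.pos_of_ne_zero (NeZero.ne k)
  have hB' := fun u : Fin I.n => hB u u.2 ((s (c u) + o u) % k) (Nat.mod_lt _ hk)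
  have hφ : ∀ u : Fin I.n, φ (e.symm ⟨_, (hB' u).1⟩) = s (c u) + o u := fun u => by
    rw [← natCast_part φ e (hB' u).1, (hB' u).2.1, ZMod.natCast_mod, Nat.cast_add]
  refine .inr ⟨fun u => e.symm ⟨_, (hB' u).1⟩, ⟨fun u v huv => ?_, fun g hg => ?_⟩, by simp⟩
  · rw [hadj, hφ, hφ]
    have hn : 0 < I.n := u.pos
    have hl : (u : ℕ) * I.n + v < I.n * I.n := by
      have := u.2; have := v.2; nlinarith
    have h1 : ((u : ℕ) * I.n + v) / I.n = u := by
      rw [mul_comm, Nat.mul_add_div hn, Nat.div_eq_of_lt v.2, add_zero]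
    have h2 : ((u : ℕ) * I.n + v) % I.n = v := by
      rw [mul_comm, Nat.mul_add_mod, Nat.mod_eq_of_lt v.2]
    have h3 := hc.arcs rfl _ hl
    rw [h1, h2] at h3
    obtain ⟨h4, h5⟩ := h3 ⟨u.2, v.2, huv⟩
    rw [h4, h5]; ring
  · set p := potentialOf φ I g with hp
    have hpot := isPotential_potentialOf hadj hg
    set g' : ℕ → ℕ := fun u => if h : u < I.n then e (g ⟨u, h⟩) else 0 with hg'
    have hgu : ∀ u : Fin I.n, g' u = e (g u) := fun u => by simp [hg']
    refine I.totalCost_le_of_sum_le e (g := fun u => B u ((s (c u) + o u) % k))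
      (fun u => by simp) hgu ?_
    rw [← sum_shiftCost e hc.c_lt s]
    -- The competitor `g` is compared with the shifts that its own potential prescribes at the
    -- representatives; it then differs from cheapest images only within the parts.
    refine (sum_le_sum fun r hr => hs r (mem_range.1 hr) (p r).val (ZMod.val_lt _)).trans ?_
    rw [sum_shiftCost e hc.c_lt fun r => (p r).val]
    refine sum_le_sum fun w hw => ?_
    have hw := mem_range.1 hw
    have hgw := hgu ⟨w, hw⟩
    simp only at hgw
    refine (hB w hw _ (Nat.mod_lt _ hk)).2.2 _ (by rw [hgw]; exact Fin.is_lt _) ?_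
    have h1 : p w = φ (g ⟨w, hw⟩) := by rw [hp, potentialOf, dif_pos hw]
    rw [hgw, part_apply, ← h1, hc.sound p hpot w hw, ZMod.val_add, ZMod.val_natCast,
      Nat.add_mod_mod]

end

end MinHOM

/-! ### Loops that tabulate a subprogram or search for a minimum -/

namespace RAM.Cmd

variable {Λ Z : ℤ}

/-- Fill an array with the values that `P` computes in cell `0` of array `y`. -/
def fillBy (x a y : ℕ) (e : Exp) (P : Cmd) : Cmd := rep x e (seq P (asg a (.var x) (.var y)))

lemma wp_fillBy {x a y : ℕ} {e : Exp} {P : Cmd} {Q : Store → Prop} {σ : Store} (hxa : a ≠ x)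
    (hPa : P.keeps a) (hPx : P.keeps x) (n : ℕ) (R : ℕ → ℤ → Prop) (he : e.val σ = n)
    (hn : (n : ℤ) ≤ Λ)
    (hP : ∀ k < n, ∀ τ : Store, (∀ b, (fillBy x a y e P).keeps b → τ b = σ b) →
      τ x 0 = (k : ℤ) → wp Λ Z P (fun ρ => |ρ y 0| ≤ Z ∧ R k (ρ y 0)) τ)
    (hQ : ∀ τ : Store, (∀ b, (fillBy x a y e P).keeps b → τ b = σ b) →
      (∀ k : ℕ, k < n → R k (τ a k)) → Q τ) :
    wp Λ Z (fillBy x a y e P) Q σ := by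
  refine wp_rep n he hn (fun k τ => ∀ j : ℕ, j < k → R j (τ a j)) ?_ ?_ hQ
  · exact fun j hj => absurd hj (Nat.not_lt_zero j)
  · intro k τ hk hx hfr hI
    refine wp_seq (wp_mono (wp_frame (hP k hk τ hfr hx)) ?_)
    rintro ρ ⟨⟨h1, h2⟩, hf⟩
    refine ⟨h1, fun j hj => ?_⟩
    rw [Store.set_apply_of_ne _ hxa, Store.set_apply]
    simp only [Exp.val_read, Exp.val_lit, hf x hPx, hx, Nat.cast_inj]
    split_ifs with hjk
    · rw [hjk]; exact h2
    · rw [hf a hPa]; exact hI j (by omega)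

/-- Replace the content of a variable by the loop counter whenever `g` is positive. -/
def argmin (x a : ℕ) (e g : Exp) : Cmd := rep x e (ite g (asg a (.lit 0) (.var x)) skip)

/-- The predicate `p` restricts the candidates. An admissible starting value `i₀` ensures that the
stored index is admissible at all times. -/
lemma wp_argmin {x a : ℕ} {e g : Exp} {Q : Store → Prop} {σ : Store} (hxa : a ≠ x) (n : ℕ)
    (he : e.val σ = n) (hn : (n : ℤ) ≤ Λ) (hZ : (n : ℤ) ≤ Z) (p : ℕ → Prop) (F : ℕ → ℤ) {i₀ : ℕ}
    (h0 : σ a 0 = i₀) (hi₀ : i₀ < n) (hp : p i₀)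
    (hg : ∀ k < n, ∀ i < n, ∀ τ : Store, (∀ b, b ≠ x → b ≠ a → τ b = σ b) → τ x 0 = (k : ℤ) →
      τ a 0 = (i : ℤ) → (0 < g.val τ ↔ p k ∧ F k < F i))
    (hQ : ∀ τ : Store, (∀ b, b ≠ x → b ≠ a → τ b = σ b) → ∀ i < n, τ a 0 = (i : ℤ) → p i →
      (∀ j < n, p j → F i ≤ F j) → Q τ) :
    wp Λ Z (argmin x a e g) Q σ := by
  have hk : ∀ b, b ≠ x → b ≠ a → (argmin x a e g).keeps b := by
    intro b h1 h2; simp [argmin, keeps, h1.symm, h2.symm]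
  refine wp_rep n he hn (fun k τ => ∃ i < n, τ a 0 = (i : ℤ) ∧ p i ∧ ∀ j < k, p j → F i ≤ F j)
    ?_ ?_ ?_
  · exact ⟨i₀, hi₀, by simp [hxa, h0], hp, fun j hj => absurd hj (Nat.not_lt_zero j)⟩
  · rintro k τ hkn hx hfr ⟨i, hi, ha, hpi, hmin⟩
    have hgk := hg k hkn i hi τ (fun b h1 h2 => hfr b (hk b h1 h2)) hx ha
    refine ⟨fun hpos => ?_, fun hneg => ?_⟩
    · obtain ⟨h1, h2⟩ := hgk.1 hpos
      refine wp_asg (by simp [hx]; omega) ⟨k, hkn, ?_, h1, fun j hj hpj => ?_⟩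
      · simp [hxa, Store.set_apply, hx]
      · rcases Nat.lt_succ_iff_lt_or_eq.1 hj with hj | rfl
        · exact h2.le.trans (hmin j hj hpj)
        · exact le_rfl
    · refine ⟨i, hi, by simp [hxa, ha], hpi, fun j hj hpj => ?_⟩
      rcases Nat.lt_succ_iff_lt_or_eq.1 hj with hj | rfl
      · exact hmin j hj hpj
      · exact not_lt.1 fun h => hneg (hgk.2 ⟨hpj, h⟩)
  · rintro τ hfr ⟨i, hi, ha, hpi, hmin⟩
    exact hQ τ (fun b h1 h2 => hfr b (hk b h1 h2)) i hi ha hpi hmin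

end RAM.Cmd

namespace MinHOM

open RAM Finset Exp Cmd Instance

/-! ### The program for extensions of directed cycles -/

/-- The vertices represented by the content of array `5` become represented by that of
array `4`. -/
def mergeCmd (k : ℕ) : Cmd :=
  .rep 3 nE <| .ite (.eq (.read 26 (.var 3)) (.var 5))
    (.seq (.asg 26 (.var 3) (.var 4))
      (.asg 27 (.var 3) (.mod (.add (.read 27 (.var 3)) (.var 6)) (.lit k)))) .skip

/-- The two representatives and the shift are copied to arrays `4`, `5` and `6` beforehand, because
merging overwrites the entries from which they are read. -/
def pairCmd (k : ℕ) (U V : Exp) : Cmd :=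
  .ite (.eq (.read 26 U) (.read 26 V))
    (.ite (.eq (.mod (.add (.read 27 U) (.lit 1)) (.lit k)) (.read 27 V)) .skip
      (.asg 28 (.lit 0) (.lit 1)))
    (.seq (.asg 4 (.lit 0) (.read 26 U)) <| .seq (.asg 5 (.lit 0) (.read 26 V)) <|
      .seq (.asg 6 (.lit 0) (.mod (.sub (.add (.read 27 U) (.lit 1)) (.read 27 V)) (.lit k))) <|
      mergeCmd k)

/-- Representatives in array `26`, offsets in array `27`, contradictions in array `28`. -/
def componentsCmd (k : ℕ) : Cmd :=
  .seq (.fill 2 26 0 nE (.var 2)) <|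
  .rep 2 (.mul nE nE) <| .ite (.read 0 (.add (.lit 2) (.var 2)))
    (pairCmd k (.div (.var 2) nE) (.mod (.var 2) nE)) .skip

/-- The cheapest image of each vertex in each part. -/
def bestCmd (k m : ℕ) (cl first : ℕ → ℕ) : Cmd :=
  .fillBy 2 29 5 (.mul nE (.lit k)) <|
    .seq (.asg 5 (.lit 0) (.tab k (fun a => first a) (.mod (.var 2) (.lit k)))) <|
    .argmin 3 5 (.lit m) <|
      .mul (.eq (.tab m (fun i => cl i) (.var 3)) (.mod (.var 2) (.lit k)))
        (.sub (.read 20 (.add (.mul (.div (.var 2) (.lit k)) (.lit m)) (.var 5)))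
          (.read 20 (.add (.mul (.div (.var 2) (.lit k)) (.lit m)) (.var 3))))

/-- The costs of the shifts. -/
def shiftCostCmd (k m : ℕ) : Cmd :=
  .fillBy 2 30 6 (.mul nE (.lit k)) <|
    .seq (.asg 6 (.lit 0) (.lit 0)) <|
    .scan 3 6 nE <| .add (.var 6) <|
      .mul (.eq (.read 26 (.var 3)) (.div (.var 2) (.lit k)))
        (.read 20 (.add (.mul (.var 3) (.lit m)) (.read 29 (.add (.mul (.var 3) (.lit k))
          (.mod (.add (.mod (.var 2) (.lit k)) (.read 27 (.var 3))) (.lit k))))))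

/-- The cheapest shift of each component. -/
def shiftCmd (k : ℕ) : Cmd :=
  .fillBy 2 31 5 nE <|
    .seq (.asg 5 (.lit 0) (.lit 0)) <|
    .argmin 3 5 (.lit k) <|
      .sub (.read 30 (.add (.mul (.var 2) (.lit k)) (.var 5)))
        (.read 30 (.add (.mul (.var 2) (.lit k)) (.var 3)))

def answerCmd (k : ℕ) : Cmd :=
  .ite (.mul (.var 28) (.var 28)) (.asg 1 (.lit 0) (.lit 1)) <|
    .seq (.asg 1 (.lit 0) (.add nE (.lit 1))) <| .seq (.asg 1 (.lit 1) (.lit 1)) <|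
    .fill 2 1 2 nE (.read 29 (.add (.mul (.var 2) (.lit k))
      (.mod (.add (.read 31 (.read 26 (.var 2))) (.read 27 (.var 2))) (.lit k))))

def cycleCmd (k m : ℕ) (cl first : ℕ → ℕ) : Cmd :=
  .seq (prelude m id) <| .seq (componentsCmd k) <| .seq (bestCmd k m cl first) <|
    .seq (shiftCostCmd k m) <| .seq (shiftCmd k) <| answerCmd k

lemma wf_cycleCmd (k m : ℕ) (cl first : ℕ → ℕ) : (cycleCmd k m cl first).wf := by
  simp [cycleCmd, prelude, componentsCmd, pairCmd, mergeCmd, bestCmd, shiftCostCmd, shiftCmd,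
    answerCmd, fill, scan, fillBy, argmin, wf, keeps]

/-- Representatives and offsets as stored. -/
def Holds (n : ℕ) (τ : Store) (c o : ℕ → ℕ) : Prop :=
  ∀ w < n, τ 26 (w : ℤ) = c w ∧ τ 27 (w : ℤ) = o w

variable {n k m : ℕ} {τ : Store} {Λ Z : ℤ} {c o : ℕ → ℕ}

lemma Holds.congr (h : Holds n τ c o) {π : Store} (h1 : π 26 = τ 26) (h2 : π 27 = τ 27) :
    Holds n π c o := by
  unfold Holds; rw [h1, h2]; exact h

lemma wp_mergeCmd (hΛ : (n : ℤ) ≤ Λ) (hkZ : (k : ℤ) ≤ Z) (hk : 0 < k) (hn : τ 0 1 = n)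
    {a b d : ℕ} (haZ : (a : ℤ) ≤ Z) (h4 : τ 4 0 = a) (h5 : τ 5 0 = b) (h6 : τ 6 0 = d)
    (h : Holds n τ c o) {Q : Store → Prop}
    (hQ : ∀ π : Store, (∀ b, (mergeCmd k).keeps b → π b = τ b) →
      Holds n π (fun w => if c w = b then a else c w)
        (fun w => if c w = b then (o w + d) % k else o w) → Q π) :
    wp Λ Z (mergeCmd k) Q τ := by
  refine wp_rep n (by simp [hn]) hΛ (fun j π => Holds n π
    (fun w => if w < j ∧ c w = b then a else c w)
    (fun w => if w < j ∧ c w = b then (o w + d) % k else o w)) ?_ ?_ ?_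
  · intro w hw
    simpa using h w hw
  · intro j π hj h3 hfr hI
    -- Entry `j` still has its original values before its own round.
    have hIj := hI j hj
    simp only [lt_irrefl, false_and, if_false] at hIj
    have f4 : π 4 = τ 4 := hfr 4 rfl
    have f5 : π 5 = τ 5 := hfr 5 rfl
    have f6 : π 6 = τ 6 := hfr 6 rfl
    have hv : (Exp.eq (.read 26 (.var 3)) (.var 5)).val π = if c j = b then 1 else 0 := by
      simp [h3, hIj.1, f5, h5]
    refine ⟨fun hpos => ?_, fun hneg => ?_⟩
    · have hcj : c j = b := by
        by_contra hne; rw [hv, if_neg hne] at hpos; exact lt_irrefl _ hpos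
      refine wp_seq (wp_asg (by simpa [f4, h4] using haZ) (wp_asg ?_ ?_))
      · simp only [Exp.val_mod, Exp.val_add, Exp.val_read, Exp.val_lit]
        rw [abs_of_nonneg (Int.emod_nonneg _ (by omega))]
        exact (Int.emod_lt_of_pos _ (by omega)).le.trans hkZ
      · intro w hw
        have hIw := hI w hw
        simp only [Store.set_read, Exp.val_mod, Exp.val_add, Exp.val_read, Exp.val_lit, h3, f4, f6,
          h4, h6, Nat.cast_inj]
        by_cases hwj : w = j
        · subst hwj
          simp [hcj, hIj.2]
        · have hlt : w < j + 1 ↔ w < j := by omega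
          simp only [hlt]
          simpa [hwj] using hIw
    · have hcj : c j ≠ b := by
        intro he; rw [hv, if_pos he] at hneg; exact hneg one_pos
      intro w hw
      have hIw := hI w hw
      simp only [Store.set_read]
      by_cases hwj : w = j
      · subst hwj
        simpa [hcj] using hIw
      · have hlt : w < j + 1 ↔ w < j := by omega
        simp only [hlt]
        simpa using hIw
  · intro π hfr hI
    refine hQ π hfr fun w hw => ?_
    have := hI w hw
    simpa only [hw, true_and] using this

lemma wp_pairCmd {A : ℕ → ℕ → Prop} {t : ℕ} (hΛ : (n : ℤ) ≤ Λ) (hkZ : (k : ℤ) ≤ Z) (hk : 0 < k)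
    (hnZ : (n : ℤ) ≤ Z) (hn : τ 0 1 = n) (hu : t / n < n) (hv : t % n < n)
    (hA : A (t / n) (t % n)) (h2 : τ 2 0 = t) (h : Holds n τ c o)
    (hC : Components k n A t c o (τ 28 0)) {Q : Store → Prop}
    (hQ : ∀ π : Store, (∀ b, (pairCmd k (.div (.var 2) nE) (.mod (.var 2) nE)).keeps b →
      π b = τ b) → ∀ c' o', Holds n π c' o' → Components k n A (t + 1) c' o' (π 28 0) → Q π) :
    wp Λ Z (pairCmd k (.div (.var 2) nE) (.mod (.var 2) nE)) Q τ := by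
  have h1Z : (1 : ℤ) ≤ Z := by omega
  have vU : ∀ π : Store, π 0 = τ 0 → π 2 = τ 2 →
      (Exp.div (.var 2) nE).val π = (t / n : ℕ) := fun π e0 e2 => by simp [e0, e2, hn, h2]
  have vV : ∀ π : Store, π 0 = τ 0 → π 2 = τ 2 →
      (Exp.mod (.var 2) nE).val π = (t % n : ℕ) := fun π e0 e2 => by simp [e0, e2, hn, h2]
  obtain ⟨cu, ou⟩ := h _ hu
  obtain ⟨cv, ov⟩ := h _ hv
  have hval : (Exp.eq (.read 26 (.div (.var 2) nE)) (.read 26 (.mod (.var 2) nE))).val τ =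
      if c (t / n) = c (t % n) then 1 else 0 := by
    rw [Exp.val_eq, Exp.val_read, Exp.val_read, vU τ rfl rfl, vV τ rfl rfl, cu, cv]
    simp only [Nat.cast_inj]
  have hval' : (Exp.eq (.mod (.add (.read 27 (.div (.var 2) nE)) (.lit 1)) (.lit k))
      (.read 27 (.mod (.var 2) nE))).val τ =
      if (o (t % n) : ZMod k) = o (t / n) + 1 then 1 else 0 := by
    rw [Exp.val_eq, Exp.val_read, Exp.val_mod, Exp.val_add, Exp.val_read, vU τ rfl rfl,
      vV τ rfl rfl, ou, ov, Exp.val_lit, Exp.val_lit]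
    refine if_congr ?_ rfl rfl
    have h3 : ((o (t % n) : ZMod k) = o (t / n) + 1) ↔ o (t % n) % k = (o (t / n) + 1) % k := by
      rw [← Nat.cast_one, ← Nat.cast_add, ZMod.natCast_eq_natCast_iff']
    rw [h3, Nat.mod_eq_of_lt (hC.o_lt _ hv)]
    constructor
    · intro h; exact_mod_cast h.symm
    · intro h; exact_mod_cast h.symm
  refine ⟨fun hpos => ⟨fun hpos' => ?_, fun hneg' => ?_⟩, fun hneg => ?_⟩
  · refine hQ τ (fun _ _ => rfl) c o h (hC.step fun _ => ⟨?_, ?_⟩)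
    · by_contra hne; rw [hval, if_neg hne] at hpos; exact lt_irrefl _ hpos
    · by_contra hne; rw [hval', if_neg hne] at hpos'; exact lt_irrefl _ hpos'
  · refine wp_asg (by simpa using h1Z) (hQ _ (fun b hb => ?_) c o
      (h.congr (by simp) (by simp)) ?_)
    · refine Store.set_apply_of_ne _ ?_ _ _
      rintro rfl
      simp [pairCmd, keeps] at hb
    · rw [show (τ.set 28 ((Exp.lit 0).val τ) ((Exp.lit 1).val τ)) 28 0 = 1 by
        simp [Store.set_apply]]
      refine hC.contradiction hu hv hA ?_ ?_
      · by_contra hne; rw [hval, if_neg hne] at hpos; exact lt_irrefl _ hpos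
      · intro he; rw [hval', if_pos he] at hneg'; exact hneg' one_pos
  · have hne : c (t / n) ≠ c (t % n) := by
      intro he; rw [hval, if_pos he] at hneg; exact hneg one_pos
    -- `d` is the residue in `0, …, k - 1` of the amount by which the class of the head has to be
    -- shifted.
    obtain ⟨d, hd⟩ := Int.eq_ofNat_of_zero_le
      (Int.emod_nonneg ((o (t / n) : ℤ) + 1 - o (t % n)) (b := k) (by omega))
    have hdk : (d : ℤ) < k := by rw [← hd]; exact Int.emod_lt_of_pos _ (by omega)
    have hcu := hC.c_lt _ hu
    have hcv := hC.c_lt _ hv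
    have v4 : (Exp.read 26 (.div (.var 2) nE)).val τ = (c (t / n) : ℕ) := by
      rw [Exp.val_read, vU τ rfl rfl, cu]
    refine wp_seq (wp_asg (by rw [v4, abs_of_nonneg (by positivity)]; omega) (wp_seq ?_))
    rw [v4]
    set τ₁ := τ.set 4 ((Exp.lit 0).val τ) ((c (t / n) : ℕ) : ℤ) with hτ₁
    have v5 : (Exp.read 26 (.mod (.var 2) nE)).val τ₁ = (c (t % n) : ℕ) := by
      rw [Exp.val_read, vV τ₁ (by simp [hτ₁]) (by simp [hτ₁]),
        show τ₁ 26 = τ 26 by simp [hτ₁], cv]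
    refine wp_asg (by rw [v5, abs_of_nonneg (by positivity)]; omega) (wp_seq ?_)
    rw [v5]
    set τ₂ := τ₁.set 5 ((Exp.lit 0).val τ₁) ((c (t % n) : ℕ) : ℤ) with hτ₂
    have v6 : (Exp.mod (.sub (.add (.read 27 (.div (.var 2) nE)) (.lit 1))
        (.read 27 (.mod (.var 2) nE))) (.lit k)).val τ₂ = (d : ℤ) := by
      rw [Exp.val_mod, Exp.val_sub, Exp.val_add, Exp.val_read, Exp.val_read,
        vU τ₂ (by simp [hτ₁, hτ₂]) (by simp [hτ₁, hτ₂]),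
        vV τ₂ (by simp [hτ₁, hτ₂]) (by simp [hτ₁, hτ₂])]
      simp only [Exp.val_lit]
      rw [show τ₂ 27 = τ 27 by simp [hτ₁, hτ₂], ou, ov]
      exact hd
    refine wp_asg (by rw [v6, abs_of_nonneg (by positivity)]; omega) ?_
    rw [v6]
    set τ₃ := τ₂.set 6 ((Exp.lit 0).val τ₂) (d : ℤ) with hτ₃
    have hfr₃ : ∀ b, b ≠ 4 → b ≠ 5 → b ≠ 6 → τ₃ b = τ b := fun b h4 h5 h6 => by
      simp [hτ₁, hτ₂, hτ₃, h4, h5, h6]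
    refine wp_mergeCmd hΛ hkZ hk (a := c (t / n)) (b := c (t % n)) (d := d) ?_ ?_ ?_ ?_ ?_
      (h.congr (hfr₃ 26 (by norm_num) (by norm_num) (by norm_num))
        (hfr₃ 27 (by norm_num) (by norm_num) (by norm_num))) ?_
    · rw [hfr₃ 0 (by norm_num) (by norm_num) (by norm_num), hn]
    · omega
    · simp [hτ₁, hτ₂, hτ₃, Store.set_apply]
    · simp [hτ₁, hτ₂, hτ₃, Store.set_apply]
    · simp [hτ₁, hτ₂, hτ₃, Store.set_apply]
    · intro π hfr hH
      refine hQ π (fun b hb => ?_) _ _ hH ?_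
      · simp only [pairCmd, keeps, Bool.and_eq_true, bne_iff_ne] at hb
        obtain ⟨-, h4, h5, h6, h7⟩ := hb
        rw [hfr b h7, hfr₃ b h4.symm h5.symm h6.symm]
      · rw [hfr 28 rfl, hfr₃ 28 (by norm_num) (by norm_num) (by norm_num)]
        refine hC.merge hk hu hv hA hne ?_
        have : ((d : ℤ) : ZMod k) = (((o (t / n) : ℤ) + 1 - o (t % n) : ℤ) : ZMod k) := by
          rw [← hd, ZMod.intCast_mod]
        simpa using this

lemma wp_componentsCmd {V : Type*} {e : V ≃ Fin m} {I : Instance V}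
    (hΛ : ((I.n * I.n : ℕ) : ℤ) ≤ Λ) (hkZ : (k : ℤ) ≤ Z) (hk : 0 < k) (hnZ : (I.n : ℤ) ≤ Z)
    (h0 : τ 0 = initStore (I.encode e) 0) (h27 : ∀ i, τ 27 i = 0) (h28 : τ 28 0 = 0)
    {Q : Store → Prop}
    (hQ : ∀ π : Store, (∀ b, (componentsCmd k).keeps b → π b = τ b) →
      ∀ c o, Holds I.n π c o → Components k I.n I.arc (I.n * I.n) c o (π 28 0) → Q π) :
    wp Λ Z (componentsCmd k) Q τ := by
  have hn := I.input_n e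
  have hnΛ : (I.n : ℤ) ≤ Λ := le_trans (by exact_mod_cast Nat.le_mul_self I.n) hΛ
  have hsub : ∀ b, (componentsCmd k).keeps b →
      keeps b (pairCmd k (.div (.var 2) nE) (.mod (.var 2) nE)) ∧ b ≠ 2 ∧ b ≠ 26 := by
    intro b hb
    simp only [componentsCmd, fill, keeps, Bool.and_eq_true, bne_iff_ne] at hb
    exact ⟨hb.2.2.1, hb.1.1.symm, hb.1.2.symm⟩
  refine wp_seq (wp_fill (by norm_num) I.n (fun w => w) (by simp [h0, hn]) hnΛ
    (fun w hw => by rw [abs_of_nonneg (by positivity)]; omega)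
    (fun w _ π _ h2 => by simpa using h2) ?_)
  intro τ₁ f₁ h26 _
  have hn₁ : τ₁ 0 1 = I.n := by rw [f₁ 0 (by norm_num) (by norm_num), h0, hn]
  refine wp_rep (I.n * I.n) (by simp [hn₁]) hΛ (fun t π => ∃ c o, Holds I.n π c o ∧
    Components k I.n I.arc t c o (π 28 0)) ?_ ?_ ?_
  · refine ⟨fun w => w, fun _ => 0, fun w hw => ⟨?_, ?_⟩, ?_⟩
    rotate_left 2
    · rw [Store.set_apply_of_ne _ (by norm_num), Store.set_apply_of_ne _ (by norm_num),
        f₁ 28 (by norm_num) (by norm_num), h28]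
      exact Components.init hk
    · have := h26 w hw
      rw [zero_add] at this
      simpa using this
    · simp [f₁, h27]
  · rintro t π ht h2 hfr ⟨c, o, hH, hC⟩
    have f0 : π 0 = initStore (I.encode e) 0 := by
      rw [hfr 0 rfl, f₁ 0 (by norm_num) (by norm_num), h0]
    have hv : (Exp.read 0 (.add (.lit 2) (.var 2))).val π =
        ind (I.arc (t / I.n) (t % I.n)) := by
      simp [f0, h2, I.input_arc e ht]
    refine ⟨fun hpos => ?_, fun hneg => ?_⟩
    · have hA : I.arc (t / I.n) (t % I.n) := by
        by_contra h; rw [hv, ind_of_false h] at hpos; exact lt_irrefl _ hpos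
      refine wp_pairCmd hnΛ hkZ hk hnZ (by rw [f0, hn]) hA.1 hA.2.1 hA h2 hH hC ?_
      intro ρ _ c' o' hH' hC'
      exact ⟨c', o', hH'.congr (by simp) (by simp), by simpa using hC'⟩
    · have hA : ¬ I.arc (t / I.n) (t % I.n) := fun h => by
        rw [hv, ind_of_true h] at hneg; exact hneg one_pos
      exact ⟨c, o, hH.congr (by simp) (by simp), by simpa using hC.step fun h => absurd h hA⟩
  · rintro π hfr ⟨c, o, hH, hC⟩
    refine hQ π (fun b hb => ?_) c o hH hC
    obtain ⟨h1, h2, h3⟩ := hsub b hb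
    rw [hfr b (by simp [keeps, h1, h2.symm]), f₁ b h2 h3]

lemma div_mod_of_lt {n k t : ℕ} (h : t < n * k) : 0 < k ∧ t / k < n ∧ t % k < k := by
  have hk : 0 < k := Nat.pos_of_ne_zero fun h0 => by simp [h0] at h
  exact ⟨hk, Nat.div_lt_of_lt_mul (by rwa [mul_comm]), Nat.mod_lt _ hk⟩

lemma add_mul_div_mod {w a k : ℕ} (h : a < k) : (w * k + a) / k = w ∧ (w * k + a) % k = a := by
  rw [mul_comm, Nat.mul_add_div (by omega), Nat.div_eq_of_lt h, add_zero, Nat.mul_add_mod,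
    Nat.mod_eq_of_lt h]
  exact ⟨rfl, rfl⟩

lemma add_mul_lt {w a k n : ℕ} (hw : w < n) (h : a < k) : w * k + a < n * k := calc
  w * k + a < w * k + k := by omega
  _ = (w + 1) * k := by ring
  _ ≤ _ := Nat.mul_le_mul_right _ hw

/-- The test of the search is the product of the indicator of the right part and the saving in cost;
it is positive exactly for a strictly cheaper candidate in that part. The vertices `first a` start
the search. -/
lemma wp_bestCmd {C : ℕ → ℕ → ℤ} {cl first : ℕ → ℕ} (hΛ : ((n * k : ℕ) : ℤ) ≤ Λ)
    (hmΛ : (m : ℤ) ≤ Λ) (hmZ : (m : ℤ) ≤ Z) (hn : τ 0 1 = n)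
    (hC : ∀ u < n, ∀ i < m, τ 20 ((u * m + i : ℕ) : ℤ) = C u i)
    (hfirst : ∀ a < k, first a < m ∧ cl (first a) = a) {Q : Store → Prop}
    (hQ : ∀ π : Store, (∀ b, (bestCmd k m cl first).keeps b → π b = τ b) →
      ∀ B : ℕ → ℕ → ℕ, (∀ w < n, ∀ a < k, π 29 ((w * k + a : ℕ) : ℤ) = B w a) →
      (∀ w < n, ∀ a < k, B w a < m ∧ cl (B w a) = a ∧
        ∀ j < m, cl j = a → C w (B w a) ≤ C w j) → Q π) :
    wp Λ Z (bestCmd k m cl first) Q τ := by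
  refine wp_fillBy (by norm_num) rfl rfl (n * k) (fun t z => ∃ i : ℕ, z = i ∧ i < m ∧
    cl i = t % k ∧ ∀ j < m, cl j = t % k → C (t / k) i ≤ C (t / k) j) (by simp [hn]) hΛ ?_ ?_
  · intro t ht π hfr h2
    obtain ⟨hk, hu, ha⟩ := div_mod_of_lt ht
    obtain ⟨g1, g2⟩ := hfirst _ ha
    have vmod : ∀ ρ : Store, ρ 2 0 = (t : ℤ) →
        (Exp.mod (.var 2) (.lit k)).val ρ = (t % k : ℕ) := fun ρ h => by simp [h]
    have vtab : (Exp.tab k (fun a => (first a : ℤ)) (.mod (.var 2) (.lit k))).val π =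
        first (t % k) := Exp.val_tab ha (vmod π h2)
    refine wp_seq (wp_asg (by rw [vtab, abs_of_nonneg (by positivity)]; omega) ?_)
    rw [vtab]
    refine wp_argmin (by norm_num) m rfl hmΛ hmZ (fun i => cl i = t % k) (fun i => C (t / k) i)
      (i₀ := first (t % k)) (by simp [Store.set_apply]) g1 g2 ?_ ?_
    · intro j hj i hi ρ hfr' h3 h5
      have f2 : ρ 2 0 = (t : ℤ) := by
        rw [hfr' 2 (by norm_num) (by norm_num), Store.set_apply_of_ne _ (by norm_num), h2]
      have f20 : ρ 20 = τ 20 := by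
        rw [hfr' 20 (by norm_num) (by norm_num), Store.set_apply_of_ne _ (by norm_num),
          hfr 20 rfl]
      have vcl : (Exp.tab m (fun i => (cl i : ℤ)) (.var 3)).val ρ = cl j :=
        Exp.val_tab hj (by simpa using h3)
      have ci := hC _ hu i hi
      have cj := hC _ hu j hj
      push_cast at ci cj
      rw [Exp.val_mul, Exp.val_eq, vcl, vmod ρ f2]
      simp only [Exp.val_sub, Exp.val_read, Exp.val_add, Exp.val_mul, Exp.val_div, Exp.val_lit,
        f2, f20, h3, h5, ci, cj, Nat.cast_inj]
      by_cases hcl : cl j = t % k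
      · simp [hcl]
      · simp [hcl]
    · intro ρ hfr' i hi h5 hcl hmin
      rw [h5, abs_of_nonneg (by positivity)]
      exact ⟨by omega, i, rfl, hi, hcl, hmin⟩
  · intro π hfr hR
    choose! B hB using hR
    refine hQ π hfr (fun w a => B (w * k + a)) (fun w hw a ha => (hB _ (add_mul_lt hw ha)).1)
      fun w hw a ha => ?_
    obtain ⟨-, h1, h2, h3⟩ := hB _ (add_mul_lt hw ha)
    obtain ⟨e1, e2⟩ := add_mul_div_mod (w := w) ha
    rw [e1, e2] at h3
    rw [e2] at h2
    exact ⟨h1, h2, h3⟩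

lemma wp_shiftCostCmd {C : ℕ → ℕ → ℤ} {B : ℕ → ℕ → ℕ} {K : ℤ} (hΛ : ((n * k : ℕ) : ℤ) ≤ Λ)
    (hnΛ : (n : ℤ) ≤ Λ) (hKZ : n * K ≤ Z) (hZ : 0 ≤ Z) (hn : τ 0 1 = n)
    (hC : ∀ u < n, ∀ i < m, τ 20 ((u * m + i : ℕ) : ℤ) = C u i)
    (hCK : ∀ u < n, ∀ i < m, |C u i| ≤ K) (hH : Holds n τ c o)
    (hB : ∀ w < n, ∀ a < k, τ 29 ((w * k + a : ℕ) : ℤ) = B w a)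
    (hBm : ∀ w < n, ∀ a < k, B w a < m) {Q : Store → Prop}
    (hQ : ∀ π : Store, (∀ b, (shiftCostCmd k m).keeps b → π b = τ b) →
      (∀ r < n, ∀ a < k, π 30 ((r * k + a : ℕ) : ℤ) =
        ∑ w ∈ range n, if c w = r then C w (B w ((a + o w) % k)) else 0) → Q π) :
    wp Λ Z (shiftCostCmd k m) Q τ := by
  refine wp_fillBy (by norm_num) rfl rfl (n * k) (fun t z => z = ∑ w ∈ range n,
    if c w = t / k then C w (B w ((t % k + o w) % k)) else 0) (by simp [hn]) hΛ ?_ ?_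
  · intro t ht π hfr h2
    obtain ⟨hk, hu, ha⟩ := div_mod_of_lt ht
    -- All partial sums are stored, so each of them has to be bounded by `Z`, not only the final
    -- one.
    have hbound : ∀ j ≤ n, |∑ w ∈ range j,
        if c w = t / k then C w (B w ((t % k + o w) % k)) else 0| ≤ Z := by
      intro j hj
      rcases Nat.eq_zero_or_pos j with rfl | hj0
      · simpa using hZ
      have hK : 0 ≤ K := (abs_nonneg _).trans
        (hCK 0 (by omega) _ (hBm 0 (by omega) (t % k) ha))
      refine (abs_sum_le_sum_abs _ _).trans ((sum_le_sum (g := fun _ => K) fun w hw => ?_).trans ?_)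
      · have := mem_range.1 hw
        split_ifs
        · exact hCK w (by omega) _ (hBm w (by omega) _ (Nat.mod_lt _ hk))
        · simpa using hK
      · rw [sum_const, card_range, nsmul_eq_mul]
        exact (mul_le_mul_of_nonneg_right (by exact_mod_cast hj) hK).trans hKZ
    refine wp_seq (wp_asg (by simpa using hZ) (wp_scan (by norm_num) n (fun j => ∑ w ∈ range j,
      if c w = t / k then C w (B w ((t % k + o w) % k)) else 0) ?_ hnΛ ?_ ?_ ?_ ?_))
    · simp [hfr 0 rfl, hn]
    · simp [Store.set_apply]
    · exact fun j hj => hbound _ hj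
    · intro j hj ρ hfr' h3 h6
      have g : ∀ b, b ≠ 3 → b ≠ 6 → ρ b = π b := fun b h3 h6 => by
        rw [hfr' b h3 h6, Store.set_apply_of_ne _ h6]
      have f2 : ρ 2 0 = (t : ℤ) := by rw [g 2 (by norm_num) (by norm_num), h2]
      have f20 : ρ 20 = τ 20 := by rw [g 20 (by norm_num) (by norm_num), hfr 20 rfl]
      have f26 : ρ 26 = τ 26 := by rw [g 26 (by norm_num) (by norm_num), hfr 26 rfl]
      have f27 : ρ 27 = τ 27 := by rw [g 27 (by norm_num) (by norm_num), hfr 27 rfl]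
      have f29 : ρ 29 = τ 29 := by rw [g 29 (by norm_num) (by norm_num), hfr 29 rfl]
      have hb := hB j hj _ (Nat.mod_lt (t % k + o j) hk)
      have hc := hC j hj _ (hBm j hj _ (Nat.mod_lt (t % k + o j) hk))
      push_cast at hb hc
      simp only [Exp.val_add, Exp.val_mul, Exp.val_eq, Exp.val_read, Exp.val_lit, Exp.val_div,
        Exp.val_mod, f2, f20, f26, f27, f29, h3, h6, (hH j hj).1, (hH j hj).2, sum_range_succ]
      rw [hb, hc]
      congr 1
      have : ((c j : ℤ) = t / k) ↔ c j = t / k := by exact_mod_cast Iff.rfl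
      simp only [this]
      split_ifs <;> simp
    · intro ρ _ h6
      rw [h6]
      exact ⟨hbound n le_rfl, rfl⟩
  · intro π hfr hR
    refine hQ π hfr fun r hr a ha => ?_
    obtain ⟨e1, e2⟩ := add_mul_div_mod (w := r) ha
    rw [hR _ (add_mul_lt hr ha), e1, e2]

lemma wp_shiftCmd {T : ℕ → ℕ → ℤ} (hk : 0 < k) (hnΛ : (n : ℤ) ≤ Λ) (hkΛ : (k : ℤ) ≤ Λ)
    (hkZ : (k : ℤ) ≤ Z) (hn : τ 0 1 = n)
    (hT : ∀ r < n, ∀ a < k, τ 30 ((r * k + a : ℕ) : ℤ) = T r a) {Q : Store → Prop}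
    (hQ : ∀ π : Store, (∀ b, (shiftCmd k).keeps b → π b = τ b) → ∀ s : ℕ → ℕ,
      (∀ r < n, π 31 r = s r) → (∀ r < n, ∀ a < k, T r (s r) ≤ T r a) → Q π) :
    wp Λ Z (shiftCmd k) Q τ := by
  refine wp_fillBy (by norm_num) rfl rfl n (fun r z => ∃ i : ℕ, z = i ∧
    ∀ a < k, T r i ≤ T r a) (by simp [hn]) hnΛ ?_ ?_
  · intro r hr π hfr h2
    refine wp_seq (wp_asg (by simp; omega) ?_)
    refine wp_argmin (by norm_num) k rfl hkΛ hkZ (fun _ => True) (T r) (i₀ := 0)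
      (by simp [Store.set_apply]) hk trivial ?_ ?_
    · intro j hj i hi ρ hfr' h3 h5
      have f2 : ρ 2 0 = (r : ℤ) := by
        rw [hfr' 2 (by norm_num) (by norm_num), Store.set_apply_of_ne _ (by norm_num), h2]
      have f30 : ρ 30 = τ 30 := by
        rw [hfr' 30 (by norm_num) (by norm_num), Store.set_apply_of_ne _ (by norm_num),
          hfr 30 rfl]
      have ti := hT r hr i hi
      have tj := hT r hr j hj
      push_cast at ti tj
      simp only [Exp.val_sub, Exp.val_read, Exp.val_add, Exp.val_mul, Exp.val_lit, f2, f30, h3, h5,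
        ti, tj]
      simp
    · intro ρ _ i hi h5 _ hmin
      rw [h5, abs_of_nonneg (by positivity)]
      exact ⟨by omega, i, rfl, fun a ha => hmin a ha trivial⟩
  · intro π hfr hR
    choose! s hs using hR
    exact hQ π hfr s (fun r hr => (hs r hr).1) fun r hr => (hs r hr).2

/-! ### Polynomial time for extensions of directed cycles -/

section

variable {V : Type*} {H : Digraph V}

theorem polyTime_of_cyclic [NeZero k] {φ : V → ZMod k} (hφ : Function.Surjective φ)
    (hadj : ∀ u v, H.Adj u v ↔ φ v = φ u + 1) : PolyTime H := by
  intro m e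
  have hk : 0 < k := Nat.pos_of_ne_zero (NeZero.ne k)
  choose ψ hψ using hφ
  -- No part is empty, so there are at most `m` parts and loops over pairs of a vertex and a part
  -- stay within the input size.
  have hkm : k ≤ m := by
    have h1 := Fintype.card_le_of_injective (fun x => e (ψ x)) fun x y h => by
      rw [← hψ x, ← hψ y, e.injective h]
    simpa using h1
  refine polyTimeSolvable_of_wp
    (cycleCmd k m (part φ e) fun a => (e (ψ (a : ZMod k)) : ℕ)) (wf_cycleCmd _ _ _ _)
    (Polynomial.X + Polynomial.C m) (3 * (Polynomial.X + Polynomial.C (m + 1)) ^ 2) ?_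
  intro I Λ Z hΛ hZ
  have hΛ' : ((inputSize (I.encode e) + m : ℕ) : ℤ) ≤ Λ := by simpa using hΛ
  have hZ' : ((2 : ℤ) ^ I.logBound e) ^ 3 ≤ Z := by
    refine le_trans (le_of_eq ?_) hZ
    rw [← pow_mul]
    congr 1
    simp [logBound]
    ring
  have hB2 := two_le_pow_logBound e I
  have hpow : ∀ j ≤ 3, ((2 : ℤ) ^ I.logBound e) ^ j ≤ Z := fun j hj =>
    (pow_le_pow_right₀ (by linarith) hj).trans hZ'
  have hsz := I.sq_le_inputSize e
  have hnS := I.n_le_inputSize e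
  have hlb := I.le_logBound e
  have hnk : I.n * k ≤ I.n * m := Nat.mul_le_mul_left _ hkm
  have hloop : ∀ j : ℕ, j ≤ inputSize (I.encode e) + m → (j : ℤ) ≤ Λ := fun j hj => by
    refine le_trans ?_ hΛ'
    exact_mod_cast hj
  have hsm : ∀ j : ℕ, j ≤ I.logBound e → (j : ℤ) ≤ Z := fun j hj =>
    (natCast_le_pow hj).trans (by simpa using hpow 1 (by norm_num))
  have h1Z : (1 : ℤ) ≤ Z := by simpa using hpow 0 (by norm_num)
  have hn := I.input_n e
  refine wp_seq (I.wp_prelude e (fun i hi => hi) (hloop _ (by omega)) ?_ ?_)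
  · have := hpow 2 (by norm_num)
    rwa [← pow_mul, mul_comm] at this
  intro τ₁ f₁ c₁
  have z₁ : ∀ b, b ≠ 0 → b ≠ 2 → b ≠ 10 → b ≠ 20 → ∀ i, τ₁ b i = 0 := fun b h0 h1 h2 h3 i => by
    rw [f₁ b h1 h2 h3, initStore_of_ne h0]
  have i₁ : τ₁ 0 = initStore (I.encode e) 0 := f₁ 0 (by norm_num) (by norm_num) (by norm_num)
  refine wp_seq (wp_componentsCmd (hloop _ (by omega)) (hsm _ (by omega)) hk (hsm _ (by omega)) i₁
    (z₁ 27 (by norm_num) (by norm_num) (by norm_num) (by norm_num))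
    (z₁ 28 (by norm_num) (by norm_num) (by norm_num) (by norm_num) 0) ?_)
  intro τ₂ f₂ c o hH hC
  have n₂ : τ₂ 0 1 = I.n := by rw [f₂ 0 rfl, i₁, hn]
  have c₂ : ∀ u < I.n, ∀ i < m, τ₂ 20 ((u * m + i : ℕ) : ℤ) = I.intCost e u i := by
    rw [f₂ 20 rfl]; exact c₁
  refine wp_seq (wp_bestCmd (hloop _ (by omega)) (hloop _ (by omega)) (hsm _ (by omega)) n₂ c₂
    (fun a ha => ⟨Fin.is_lt _, ?_⟩) ?_)
  · rw [part_apply, hψ, ZMod.val_natCast, Nat.mod_eq_of_lt ha]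
  intro τ₃ f₃ B hB hBmin
  have n₃ : τ₃ 0 1 = I.n := by rw [f₃ 0 rfl, n₂]
  -- One integral cost is at most the square of `2 ^ logBound`, and a sum of `n` of them at most the
  -- cube, which is the bound chosen for `Z`.
  refine wp_seq (wp_shiftCostCmd (K := (2 ^ I.logBound e) ^ 2) (hloop _ (by omega))
    (hloop _ (by omega)) ?_ (by omega) n₃ (by rw [f₃ 20 rfl]; exact c₂)
    (fun u hu i hi => ?_) (hH.congr (f₃ 26 rfl) (f₃ 27 rfl)) hB
    (fun w hw a ha => (hBmin w hw a ha).1) ?_)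
  · refine le_trans ?_ hZ'
    rw [pow_succ' _ 2]
    exact mul_le_mul_of_nonneg_right (natCast_le_pow (by omega)) (by positivity)
  · rw [← pow_mul, mul_comm]
    exact I.abs_intCost_le e hu hi
  intro τ₄ f₄ hT
  have n₄ : τ₄ 0 1 = I.n := by rw [f₄ 0 rfl, n₃]
  refine wp_seq (wp_shiftCmd (T := shiftCost e I k c o B) hk (hloop _ (by omega))
    (hloop _ (by omega)) (hsm _ (by omega)) n₄ hT ?_)
  intro τ₅ f₅ s hs hsmin
  have n₅ : τ₅ 0 1 = I.n := by rw [f₅ 0 rfl, n₄]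
  have z₅ : ∀ i, τ₅ 1 i = 0 := by
    rw [f₅ 1 rfl, f₄ 1 rfl, f₃ 1 rfl, f₂ 1 rfl]
    exact z₁ 1 (by norm_num) (by norm_num) (by norm_num) (by norm_num)
  have b₅ : τ₅ 28 0 = τ₂ 28 0 := by rw [f₅ 28 rfl, f₄ 28 rfl, f₃ 28 rfl]
  have H₅ : Holds I.n τ₅ c o := hH.congr
    (by rw [f₅ 26 rfl, f₄ 26 rfl, f₃ 26 rfl]) (by rw [f₅ 27 rfl, f₄ 27 rfl, f₃ 27 rfl])
  have B₅ : ∀ w < I.n, ∀ a < k, τ₅ 29 ((w * k + a : ℕ) : ℤ) = B w a := by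
    rw [f₅ 29 rfl, f₄ 29 rfl]; exact hB
  refine ⟨fun hpos => ?_, fun hneg => ?_⟩
  · refine wp_asg (by simpa using h1Z) ⟨[0], ⟨by simp [Store.set_apply], fun j => ?_⟩,
      correct_of_bad e hadj hC (by rw [← b₅]; exact mul_self_pos.1 hpos)⟩
    obtain ⟨j, hj⟩ := j
    obtain rfl : j = 0 := by simpa using hj
    simp [Store.set_apply, z₅]
  · have hb : τ₂ 28 0 = 0 := by
      rw [← b₅]
      by_contra hne
      exact hneg (mul_self_pos.2 hne)
    rw [hb] at hC
    have hn1 : (Exp.add nE (.lit 1)).val τ₅ = I.n + 1 := by simp [n₅]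
    refine wp_seq (wp_asg (by
      rw [hn1, abs_of_nonneg (by positivity)]; exact_mod_cast hsm (I.n + 1) (by omega))
      (wp_seq (wp_asg (by simpa using h1Z) (wp_fill (by norm_num) I.n
        (fun w => (B w ((s (c w) + o w) % k) : ℕ)) ?_ (hloop _ (by omega)) ?_ ?_ ?_))))
    · simp [n₅]
    · intro w hw
      have h1 := (hBmin w hw _ (Nat.mod_lt (s (c w) + o w) hk)).1
      rw [abs_of_nonneg (by positivity)]
      exact hsm _ (by omega)
    · intro w hw π hfr h2
      have g : ∀ b, b ≠ 2 → b ≠ 1 → π b = τ₅ b := fun b h2 h1 => by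
        rw [hfr b h2 h1, Store.set_apply_of_ne _ h1, Store.set_apply_of_ne _ h1]
      have hBw := B₅ w hw _ (Nat.mod_lt (s (c w) + o w) hk)
      push_cast at hBw
      simp only [Exp.val_read, Exp.val_add, Exp.val_mul, Exp.val_lit, Exp.val_mod, h2,
        g 26 (by norm_num) (by norm_num), g 27 (by norm_num) (by norm_num),
        g 29 (by norm_num) (by norm_num), g 31 (by norm_num) (by norm_num), (H₅ w hw).1,
        (H₅ w hw).2, hs _ (hC.c_lt w hw), hBw]
    · intro π hfr hout hrest
      refine ⟨_, hasOutput_cons ?_ ?_ fun u => hout u u.2,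
        correct_of_shifts e hadj hC hBmin hsmin⟩
      · rw [hrest 0 (fun k _ => by omega), Store.set_apply, Store.set_apply, hn1]; simp
      · rw [hrest 1 (fun k _ => by omega), Store.set_apply]; simp

end

end MinHOM

theorem theorem3p3 {V : Type*} [Finite V] (H : Digraph V) (hloop : MinHOM.Loopless H)
    (hconn : MinHOM.Connected H) (hquasi : MinHOM.QuasiTransitive H)
    (h : (MinHOM.Isomorphic H (MinHOM.dirCycle 2) ∨ MinHOM.IsExtension H (MinHOM.dirCycle 3)) ∨
      (MinHOM.Acyclic H ∧ MinHOM.IsProperIntervalBigraph (MinHOM.bip H) ∧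
        ∀ a b : Bool, ¬ MinHOM.ContainsInduced H (MinHOM.obstruction a b))) :
    MinHOM.PolyTime H := by
  rcases h with (⟨⟨φ⟩⟩ | ⟨φ, hφ, hadj⟩) | ⟨hacyc, hB, hO⟩
  -- An isomorphism to the directed 2-cycle is itself a surjection to `ZMod 2` with the required
  -- property.
  · exact MinHOM.polyTime_of_cyclic φ.surjective fun u v => φ.map_rel_iff.symm
  · exact MinHOM.polyTime_of_cyclic hφ hadj
  · exact MinHOM.polyTime_of_isMinMax H fun m e =>
      MinHOM.exists_isMinMax e hacyc hquasi hB hO
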